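/- \textbf{Problem (predecessor in shrinking nested sets, PISNS).} An instance consists of a positive integer $N$ and nonempty sets $S_1,\dots,S_k\subseteq[1,N]$ of integers ($k\ge 1$) for which there exist integers $1\le n_1\le n_2\le\dots\le n_k$ such that $S_i\subseteq[n_i,N]$ for all $i\le k$ and $S_i\cap[n_{i+1},N]\subseteq S_{i+1}$ for all $i<k$. The input is $N$, $k$, the cardinalities $|S_i|$, and for every $i$ a list of the elements of $S_i$ in arbitrary order (the $n_i$ are not given). The instance is to be preprocessed so that, given $i\in\{1,\dots,k\}$ and $x\in[1,N]$, one can return the rank in $S_i$ of the predecessor of $x$ (the largest element of $S_i$ that is at most $x$), i.e. $|\{y\in S_i: y\le x\}|$, which is $0$ if there is no predecessor. \textbf{Model.} Word-RAM with words of $\mathcal W$ bits: unit-cost arithmetic modulo $2^{\mathcal W}$, bitwise operations, shifts, comparisons and indirect memory access. A universal table answering $\mathtt{rank}$ (number of $1$ bits among the first $j$ bits of a word) and $\mathtt{select}$ (position of the $j$-th $1$ bit of a word) in unit time is available at no cost. Words are long enough to address the memory used: $\mathcal W\ge\log_2\bigl(N+\sum_i|S_i|\bigr)+O(1)$. Space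 is measured in words, time is deterministic worst-case. \textbf{Lemma.} For every constant $t_2\ge 1$, PISNS can be solved with $\mathcal O\bigl(N/\mathcal W^{t_2}+\sum_i|S_i|\bigr)$ preprocessing time, $\mathcal O\bigl(N/\mathcal W^{t_2}+\sum_i|S_i|\bigr)$ space (including the input and the working space of the preprocessing) and $\mathcal O(1)$ query time. Precisely: there are a preprocessing program, a query program and a constant $c$, all depending only on $t_2$, such that for every word size $\mathcal W$ and every instance with $c\,(N+\sum_i|S_i|)\le 2^{\mathcal W}$, on a machine whose memory has $\lfloor c\,(N/\mathcal W^{t_2}+\sum_i|S_i|)\rfloor$ words and is zero outside the input, the preprocessing halts within $c\,(N/\mathcal W^{t_2}+\sum_i|S_i|)$ steps, and afterwards every query $(i,x)$ is answered correctly within $c$ steps without changing the memory. -/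

import Mathlib

/-! ## The word-RAM

Words are natural numbers below `2 ^ W`, where `W` is the word size in bits.  A program uses the
finitely many registers named in its text and a memory of words addressed indirectly. -/

namespace WordRAM

/-- `rank v j`: the number of 1 bits of the word `v` among its first `j` bits
(least significant bit first; the bit at position `p ≥ 1` is `v.testBit (p - 1)`). -/
def rank (v j : ℕ) : ℕ := Nat.count (fun b => v.testBit b = true) j

/-- `select W v j`: the position (counted from `1`) of the `j`-th 1 bit of the `W`-bit word `v`,
and `0` if there is no such bit. -/
noncomputable def select (W v j : ℕ) : ℕ :=
  if 1 ≤ j ∧ j ≤ rank v W then Nat.nth (fun b => v.testBit b = true) (j - 1) + 1 else 0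

/-- The binary word instructions: arithmetic modulo `2 ^ W` (with `a / 0 = 0`, `a mod 0 = a`),
bitwise operations, shifts, comparisons (with value `1` or `0`), and `rank` / `select` on a single
word.  The last two stand for the look-ups in the universal table that the model supplies. -/
inductive Op
  | add | sub | mul | div | mod
  | and | or | xor | shl | shr
  | lt | eq
  | rank | select

/-- The value of an instruction on two `W`-bit words. -/
noncomputable def Op.eval (W : ℕ) : Op → ℕ → ℕ → ℕ
  | .add, a, b => (a + b) % 2 ^ W
  | .sub, a, b => (a + (2 ^ W - b)) % 2 ^ W
  | .mul, a, b => (a * b) % 2 ^ W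
  | .div, a, b => a / b
  | .mod, a, b => a % b
  | .and, a, b => a &&& b
  | .or, a, b => a ||| b
  | .xor, a, b => a ^^^ b
  | .shl, a, b => (a <<< b) % 2 ^ W
  | .shr, a, b => a >>> b
  | .lt, a, b => if a < b then 1 else 0
  | .eq, a, b => if a = b then 1 else 0
  | .rank, a, b => WordRAM.rank a b
  | .select, a, b => WordRAM.select W a b

/-- Expressions over registers. -/
inductive Expr
  | const (c : ℕ)
  | wordSize
  | reg (r : ℕ)
  | bin (o : Op) (e₁ e₂ : Expr)

/-- The value of an expression under the register contents `ρ`. -/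
noncomputable def Expr.eval (W : ℕ) (ρ : ℕ → ℕ) : Expr → ℕ
  | .const c => c % 2 ^ W
  | .wordSize => W
  | .reg r => ρ r
  | .bin o e₁ e₂ => o.eval W (e₁.eval W ρ) (e₂.eval W ρ)

/-- The number of steps needed to evaluate an expression: one for each node. -/
def Expr.cost : Expr → ℕ
  | .const _ => 1
  | .wordSize => 1
  | .reg _ => 1
  | .bin _ e₁ e₂ => e₁.cost + e₂.cost + 1

/-- Programs. -/
inductive Stmt
  | skip
  /-- put the value of `e` into register `r` -/
  | assign (r : ℕ) (e : Expr)
  /-- put the content of the memory cell with address `a` into register `r` -/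
  | load (r : ℕ) (a : Expr)
  /-- put the value of `e` into the memory cell with address `a` -/
  | store (a e : Expr)
  | seq (s₁ s₂ : Stmt)
  /-- run `s₁` if the value of `e` is nonzero, and `s₂` otherwise -/
  | cond (e : Expr) (s₁ s₂ : Stmt)
  /-- run `s` as long as the value of `e` is nonzero -/
  | loop (e : Expr) (s : Stmt)

/-- A configuration: the contents of the registers and of the memory. -/
structure State where
  regs : ℕ → ℕ
  mem : ℕ → ℕ

/-- `Exec W M s σ T σ'`: on a machine with words of `W` bits and a memory of `M` words (the cells
`0, …, M - 1`), the program `s` started in `σ` halts in `σ'` after exactly `T` steps.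
There is no transition for an access to a cell outside the memory. -/
inductive Exec (W M : ℕ) : Stmt → State → ℕ → State → Prop
  | skip (σ : State) : Exec W M .skip σ 1 σ
  | assign (r : ℕ) (e : Expr) (σ : State) :
      Exec W M (.assign r e) σ (e.cost + 1)
        ⟨Function.update σ.regs r (e.eval W σ.regs), σ.mem⟩
  | load (r : ℕ) (a : Expr) (σ : State) (h : a.eval W σ.regs < M) :
      Exec W M (.load r a) σ (a.cost + 1)
        ⟨Function.update σ.regs r (σ.mem (a.eval W σ.regs)), σ.mem⟩
  | store (a e : Expr) (σ : State) (h : a.eval W σ.regs < M) :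
      Exec W M (.store a e) σ (a.cost + e.cost + 1)
        ⟨σ.regs, Function.update σ.mem (a.eval W σ.regs) (e.eval W σ.regs)⟩
  | seq {s₁ s₂ : Stmt} {σ σ₁ σ₂ : State} {T₁ T₂ : ℕ} :
      Exec W M s₁ σ T₁ σ₁ → Exec W M s₂ σ₁ T₂ σ₂ → Exec W M (.seq s₁ s₂) σ (T₁ + T₂) σ₂
  | cond_true {e : Expr} {s₁ s₂ : Stmt} {σ σ' : State} {T : ℕ} :
      e.eval W σ.regs ≠ 0 → Exec W M s₁ σ T σ' →
      Exec W M (.cond e s₁ s₂) σ (e.cost + 1 + T) σ'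
  | cond_false {e : Expr} {s₁ s₂ : Stmt} {σ σ' : State} {T : ℕ} :
      e.eval W σ.regs = 0 → Exec W M s₂ σ T σ' →
      Exec W M (.cond e s₁ s₂) σ (e.cost + 1 + T) σ'
  | loop_done {e : Expr} {s : Stmt} {σ : State} :
      e.eval W σ.regs = 0 → Exec W M (.loop e s) σ (e.cost + 1) σ
  | loop_step {e : Expr} {s : Stmt} {σ σ₁ σ₂ : State} {T₁ T₂ : ℕ} :
      e.eval W σ.regs ≠ 0 → Exec W M s σ T₁ σ₁ → Exec W M (.loop e s) σ₁ T₂ σ₂ →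
      Exec W M (.loop e s) σ (e.cost + 1 + T₁ + T₂) σ₂

end WordRAM

/-! ## Predecessor in shrinking nested sets -/

namespace PISNS

/-- `S₁, …, S_k` (with `k ≥ 1`) are nonempty, and there are `1 ≤ n₁ ≤ n₂ ≤ … ≤ n_k` with
`S_i ⊆ [n_i, N]` and `S_i ∩ [n_{i+1}, N] ⊆ S_{i+1}`. -/
structure IsInstance {k : ℕ} (N : ℕ) (S : Fin k → Finset ℕ) : Prop where
  pos : 0 < k
  nonempty : ∀ i, (S i).Nonempty
  shrinking : ∃ n : Fin k → ℕ, Monotone n ∧ (∀ i, 1 ≤ n i) ∧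
    (∀ i, S i ⊆ Finset.Icc (n i) N) ∧
    (∀ i j : Fin k, (i : ℕ) + 1 = (j : ℕ) → S i ∩ Finset.Icc (n j) N ⊆ S j)

/-- `L` lists the elements of every `S i`, without repetition and in an arbitrary order. -/
def Lists {k : ℕ} (L : Fin k → List ℕ) (S : Fin k → Finset ℕ) : Prop :=
  ∀ i, (L i).Nodup ∧ (L i).toFinset = S i

/-- The input as a sequence of words: `N`, `k`, the `k` cardinalities, and then the elements of
the first set, of the second set, and so on. -/
def inputWords {k : ℕ} (N : ℕ) (L : Fin k → List ℕ) : List ℕ :=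
  N :: k :: (List.ofFn fun i => (L i).length) ++ (List.ofFn L).flatten

/-- The configuration before the preprocessing: the input occupies the first memory cells, all
other cells and all registers are `0`. -/
def inputState {k : ℕ} (N : ℕ) (L : Fin k → List ℕ) : WordRAM.State :=
  ⟨fun _ => 0, fun a => (inputWords N L).getD a 0⟩

/-- The configuration before a query: register `0` holds the index `i` of the set (counted from
`0`), register `1` the value `x`, every other register `0`, and the memory is `mem`. -/
def queryState (mem : ℕ → ℕ) (i x : ℕ) : WordRAM.State :=
  ⟨Function.update (Function.update (fun _ => 0) 0 i) 1 x, mem⟩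

/-- The rank of the predecessor of `x` in `A`, the largest element that is at most `x`: the
number of elements of `A` that are at most `x` (`0` if and only if `x` has no predecessor). -/
def predRank (A : Finset ℕ) (x : ℕ) : ℕ := (A.filter (· ≤ x)).card

/-- The quantity `N / W ^ t + ∑ |S_i|`. -/
noncomputable def bound {k : ℕ} (t : ℝ) (W N : ℕ) (S : Fin k → Finset ℕ) : ℝ :=
  (N : ℝ) / (W : ℝ) ^ t + ∑ i, ((S i).card : ℝ)

end PISNS

/-! Let `t` be an integer. The universe is cut into blocks of length `W ^ (t + 1)`. As the sets
shrink, the sets that meet a block `b`, apart from those that start in or after it, are the ones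
with an index in an interval `[birth b, death b)`, and `death` is monotone in `b`. So past the first
block of the set `i`, the next block from `b` on that is met by `i` is the next one with
`birth ≤ i`. It is found in constant time as in the jump-pointer and ladder algorithm for level
ancestors: `b` stores the next block whose birth is earlier by `2 ^ j` for every `j ≤ log k`, and a
ladder as long as its lifetime. One jump of the largest possible length and one rung of the ladder
at its target suffice. The jumps take `(N / W ^ (t + 1)) * log k ≤ N / W ^ t` words, and the
lifetimes add up to at most `∑ |S i|`, since a set uses up an element in every block that is alive
at its index.

Inside a block, the elements of a set form a trie of height `t + 1` whose nodes have `W` possible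
digits and hold the bitmap of those that occur. The nodes of a level are numbered by the sets, then
by the blocks, then by the digits, so that `rank` in the bitmap gives the number of a child, also
for a digit that is absent, and the number reached at the bottom is the number of the elements
before the query. -/

namespace WordRAM

/-! ## Arithmetic without overflow -/

/-- The number of `W`-bit words, kept folded so that linear arithmetic treats it as an atom. -/
def cap (W : ℕ) : ℕ := 2 ^ W

theorem cap_pos (W : ℕ) : 0 < cap W := Nat.two_pow_pos W

/-- The value of an instruction over the natural numbers, without reduction modulo `2 ^ W`. -/
@[simp] noncomputable def Op.natEval (W : ℕ) : Op → ℕ → ℕ → ℕ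
  | .add, a, b => a + b
  | .sub, a, b => a - b
  | .mul, a, b => a * b
  | .div, a, b => a / b
  | .mod, a, b => a % b
  | .and, a, b => a &&& b
  | .or, a, b => a ||| b
  | .xor, a, b => a ^^^ b
  | .shl, a, b => a * 2 ^ b
  | .shr, a, b => a >>> b
  | .lt, a, b => if a < b then 1 else 0
  | .eq, a, b => if a = b then 1 else 0
  | .rank, a, b => WordRAM.rank a b
  | .select, a, b => WordRAM.select W a b

/-- The instruction does not overflow on the given arguments. -/
@[simp] def Op.Fits (W : ℕ) : Op → ℕ → ℕ → Prop
  | .add, a, b => a + b < cap W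
  | .sub, a, b => b ≤ a ∧ a < cap W
  | .mul, a, b => a * b < cap W
  | .shl, a, b => a * 2 ^ b < cap W
  | .div, _, _ | .mod, _, _ | .and, _, _ | .or, _, _ | .xor, _, _ | .shr, _, _ | .lt, _, _
  | .eq, _, _ | .rank, _, _ | .select, _, _ => True

/-- The value of an expression over the natural numbers, without reduction modulo `2 ^ W`. -/
@[simp] noncomputable def Expr.natEval (W : ℕ) (ρ : ℕ → ℕ) : Expr → ℕ
  | .const c => c
  | .wordSize => W
  | .reg r => ρ r
  | .bin o e₁ e₂ => o.natEval W (e₁.natEval W ρ) (e₂.natEval W ρ)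

/-- No instruction of the expression overflows. -/
@[simp] def Expr.Fits (W : ℕ) (ρ : ℕ → ℕ) : Expr → Prop
  | .const c => c < cap W
  | .wordSize => True
  | .reg _ => True
  | .bin o e₁ e₂ => e₁.Fits W ρ ∧ e₂.Fits W ρ ∧ o.Fits W (e₁.natEval W ρ) (e₂.natEval W ρ)

theorem Op.eval_eq_natEval {W : ℕ} {o : Op} {a b : ℕ} (h : o.Fits W a b) :
    o.eval W a b = o.natEval W a b := by
  cases o <;> simp only [Op.Fits, Op.eval, Op.natEval, cap] at *
  · exact Nat.mod_eq_of_lt h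
  · obtain ⟨hle, hlt⟩ := h
    have : a + (2 ^ W - b) = (a - b) + 2 ^ W := by omega
    rw [this, Nat.add_mod_right, Nat.mod_eq_of_lt (by omega)]
  · exact Nat.mod_eq_of_lt h
  · rw [Nat.shiftLeft_eq, Nat.mod_eq_of_lt h]

theorem Expr.eval_eq_natEval {W : ℕ} {ρ : ℕ → ℕ} {e : Expr} (h : e.Fits W ρ) :
    e.eval W ρ = e.natEval W ρ := by
  induction e with
  | const c => exact Nat.mod_eq_of_lt h
  | wordSize => rfl
  | reg r => rfl
  | bin o e₁ e₂ ih₁ ih₂ =>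
    obtain ⟨h₁, h₂, ho⟩ := h
    simp only [Expr.eval, Expr.natEval, ih₁ h₁, ih₂ h₂, Op.eval_eq_natEval ho]

instance : Add Expr := ⟨.bin .add⟩
instance : Sub Expr := ⟨.bin .sub⟩
instance : Mul Expr := ⟨.bin .mul⟩
instance : Div Expr := ⟨.bin .div⟩

@[simp] theorem Expr.add_def (a b : Expr) : a + b = .bin .add a b := rfl
@[simp] theorem Expr.sub_def (a b : Expr) : a - b = .bin .sub a b := rfl
@[simp] theorem Expr.mul_def (a b : Expr) : a * b = .bin .mul a b := rfl
@[simp] theorem Expr.div_def (a b : Expr) : a / b = .bin .div a b := rfl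

/-! ## Programs with arrays -/

/-- The register that holds the address of the first array cell. -/
notation "rBase" => 100

/-- A division of a memory of `cells` words into a read-only region of `inputLen` words with the
contents `inp`, followed by `arrays` arrays of length `len` each.  The arrays are interleaved: the
cell with index `i` of array `q` has the address `inputLen + (arrays * i + q)`, so that the address
of an array does not depend on the instance. -/
structure Layout where
  W : ℕ
  cells : ℕ
  inputLen : ℕ
  arrays : ℕ
  len : ℕ
  inp : ℕ → ℕ
  inputLen_pos : 0 < inputLen
  le_cells : inputLen + arrays * len ≤ cells
  cells_le : cells ≤ cap W

/-- The contents of the registers and of the arrays. -/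
structure Store where
  regs : ℕ → ℕ
  arr : ℕ → ℕ → ℕ

namespace Store

variable (σ : Store)

/-- The store after putting the value `v` into the register `r`. -/
def put (r v : ℕ) : Store := ⟨Function.update σ.regs r v, σ.arr⟩

/-- The store after putting the value `v` into the cell with index `i` of the array `q`. -/
def write (q i v : ℕ) : Store :=
  ⟨σ.regs, Function.update σ.arr q (Function.update (σ.arr q) i v)⟩

@[simp] theorem put_regs (r v r' : ℕ) :
    (σ.put r v).regs r' = if r' = r then v else σ.regs r' :=
  Function.update_apply ..

@[simp] theorem put_arr (r v : ℕ) : (σ.put r v).arr = σ.arr := rfl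

@[simp] theorem write_regs (q i v : ℕ) : (σ.write q i v).regs = σ.regs := rfl

@[simp] theorem write_arr_self (q i v : ℕ) :
    (σ.write q i v).arr q = Function.update (σ.arr q) i v :=
  Function.update_self ..

theorem write_arr_of_ne {q q' : ℕ} (i v : ℕ) (h : q' ≠ q) : (σ.write q i v).arr q' = σ.arr q' :=
  Function.update_of_ne h ..

/-- The side condition is a Boolean equation because the simplifier evaluates it on numerals. -/
@[simp] theorem write_arr_of_beq {q q' : ℕ} (i v : ℕ) (h : (q' == q) = false) :
    (σ.write q i v).arr q' = σ.arr q' :=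
  σ.write_arr_of_ne i v (beq_eq_false_iff_ne.1 h)

@[simp] theorem put_write (q i v r w : ℕ) : (σ.put r w).write q i v = (σ.write q i v).put r w := rfl

/-- The first `n` cells of the array `q` hold the values of `f`. -/
def Holds (q n : ℕ) (f : ℕ → ℕ) : Prop := ∀ i < n, σ.arr q i = f i

/-- The `n` cells of the array `q` from the index `s` on hold the values of `f`. -/
def HoldsFrom (q s n : ℕ) (f : ℕ → ℕ) : Prop := ∀ i < n, σ.arr q (s + i) = f i

variable {σ} {q s n i v : ℕ} {f : ℕ → ℕ}

@[simp] theorem holds_put (r : ℕ) : (σ.put r v).Holds q n f ↔ σ.Holds q n f := Iff.rfl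

@[simp] theorem holds_write_of_beq {q' : ℕ} (h : (q' == q) = false) :
    (σ.write q i v).Holds q' n f ↔ σ.Holds q' n f := by
  simp only [Holds, h, write_arr_of_beq]

@[simp] theorem holds_write_write_of_beq {q' i' v' : ℕ} (h : (q' == q) = false) :
    ((σ.write q i v).write q' i' v').Holds q' n f ↔ (σ.write q' i' v').Holds q' n f := by
  simp only [Holds, write_arr_self, h, write_arr_of_beq]

theorem holds_zero (σ : Store) (q : ℕ) (f : ℕ → ℕ) : σ.Holds q 0 f := nofun

theorem Holds.write {g : ℕ → ℕ} (h : σ.Holds q n f) (hne : ∀ j < n, j ≠ i → g j = f j)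
    (hi : i < n → v = g i) : (σ.write q i v).Holds q n g := by
  intro j hj
  rw [write_arr_self, Function.update_apply]
  split_ifs with hji
  · exact hji ▸ hi (hji ▸ hj)
  · rw [h j hj, hne j hj hji]

theorem Holds.write_succ (h : σ.Holds q n f) (hv : v = f n) :
    (σ.write q n v).Holds q (n + 1) f := by
  intro j hj
  rw [write_arr_self, Function.update_apply]
  split_ifs with hjn
  · rw [hjn, hv]
  · exact h j (by omega)

@[simp] theorem holdsFrom_put (r : ℕ) :
    (σ.put r v).HoldsFrom q s n f ↔ σ.HoldsFrom q s n f := Iff.rfl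

@[simp] theorem holdsFrom_write_of_beq {q' : ℕ} (h : (q' == q) = false) :
    (σ.write q i v).HoldsFrom q' s n f ↔ σ.HoldsFrom q' s n f := by
  simp only [HoldsFrom, h, write_arr_of_beq]

theorem holdsFrom_zero (σ : Store) (q s : ℕ) (f : ℕ → ℕ) : σ.HoldsFrom q s 0 f := nofun

theorem HoldsFrom.write_of_disjoint (h : σ.HoldsFrom q s n f) (hi : i < s ∨ s + n ≤ i) :
    (σ.write q i v).HoldsFrom q s n f := by
  intro j hj
  rw [write_arr_self, Function.update_of_ne (by omega), h j hj]

theorem HoldsFrom.write_succ (h : σ.HoldsFrom q s n f) (hv : v = f n) :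
    (σ.write q (s + n) v).HoldsFrom q s (n + 1) f := by
  intro j hj
  rw [write_arr_self, Function.update_apply]
  split_ifs with hjn
  · rw [hv, show j = n by omega]
  · exact h j (by omega)

end Store

/-- Programs for a memory with arrays: the instructions of the word-RAM, with the memory access
split into access to an array (`ld`, `st`) and reading from the read-only region (`inp`). -/
inductive Cmd
  | skip
  | set (r : ℕ) (e : Expr)
  | ld (r q : ℕ) (e : Expr)
  | st (q : ℕ) (e e' : Expr)
  | inp (r : ℕ) (e : Expr)
  | seq (a b : Cmd)
  | ite (e : Expr) (a b : Cmd)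
  | whl (e : Expr) (a : Cmd)

infixr:60 " ;; " => Cmd.seq

/-- The expression for the address of the cell with index `e` of the array `q`. -/
def cell (arrays q : ℕ) (e : Expr) : Expr := .reg rBase + (.const arrays * e + .const q)

theorem cell_cost (arrays q : ℕ) (e : Expr) : (cell arrays q e).cost = e.cost + 6 := by
  simp only [cell, Expr.add_def, Expr.mul_def, Expr.cost]
  omega

namespace Cmd

/-- The translation into word-RAM programs. -/
def toStmt (arrays : ℕ) : Cmd → Stmt
  | .skip => .skip
  | .set r e => .assign r e
  | .ld r q e => .load r (cell arrays q e)
  | .st q e e' => .store (cell arrays q e) e'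
  | .inp r e => .load r e
  | .seq a b => .seq (a.toStmt arrays) (b.toStmt arrays)
  | .ite e a b => .cond e (a.toStmt arrays) (b.toStmt arrays)
  | .whl e a => .loop e (a.toStmt arrays)

/-- The registers that a program writes. -/
def regs : Cmd → List ℕ
  | .skip | .st _ _ _ => []
  | .set r _ | .ld r _ _ | .inp r _ => [r]
  | .seq a b | .ite _ a b => a.regs ++ b.regs
  | .whl _ a => a.regs

/-- The arrays that a program writes. -/
def arrs : Cmd → List ℕ
  | .skip | .set _ _ | .ld _ _ _ | .inp _ _ => []
  | .st q _ _ => [q]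
  | .seq a b | .ite _ a b => a.arrs ++ b.arrs
  | .whl _ a => a.arrs

/-- `σ'` agrees with `σ` on the registers and arrays that the program does not write. -/
structure Frame (c : Cmd) (σ σ' : Store) : Prop where
  regs : ∀ r, r ∉ c.regs → σ'.regs r = σ.regs r
  arr : ∀ q, q ∉ c.arrs → σ'.arr q = σ.arr q

theorem Frame.refl (c : Cmd) (σ : Store) : c.Frame σ σ := ⟨fun _ _ => rfl, fun _ _ => rfl⟩

theorem Frame.trans {c : Cmd} {σ₁ σ₂ σ₃ : Store} (h : c.Frame σ₁ σ₂) (h' : c.Frame σ₂ σ₃) :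
    c.Frame σ₁ σ₃ :=
  ⟨fun r hr => (h'.regs r hr).trans (h.regs r hr), fun q hq => (h'.arr q hq).trans (h.arr q hq)⟩

theorem Frame.mono {c d : Cmd} {σ σ' : Store} (h : c.Frame σ σ') (hr : c.regs ⊆ d.regs)
    (ha : c.arrs ⊆ d.arrs) : d.Frame σ σ' :=
  ⟨fun r h' => h.regs r fun hc => h' (hr hc), fun q h' => h.arr q fun hc => h' (ha hc)⟩

theorem Frame.put {c : Cmd} {r : ℕ} (hr : r ∈ c.regs) (σ : Store) (v : ℕ) :
    c.Frame σ (σ.put r v) :=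
  ⟨fun r' h => by rw [σ.put_regs, if_neg (by rintro rfl; exact h hr)], fun _ _ => rfl⟩

theorem Frame.holds {c : Cmd} {σ σ' : Store} {q n : ℕ} {f : ℕ → ℕ} (hframe : c.Frame σ σ')
    (hq : q ∉ c.arrs) (h : σ.Holds q n f) : σ'.Holds q n f := by
  rw [Store.Holds, hframe.arr q hq]
  exact h

theorem Frame.holdsFrom {c : Cmd} {σ σ' : Store} {q s n : ℕ} {f : ℕ → ℕ} (hframe : c.Frame σ σ')
    (hq : q ∉ c.arrs) (h : σ.HoldsFrom q s n f) : σ'.HoldsFrom q s n f := by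
  rw [Store.HoldsFrom, hframe.arr q hq]
  exact h

end Cmd

/-- The memory `m` holds the read-only region and the arrays `A`. -/
structure Layout.Represents (G : Layout) (m : ℕ → ℕ) (A : ℕ → ℕ → ℕ) : Prop where
  inp : ∀ a < G.inputLen, m a = G.inp a
  arr : ∀ q < G.arrays, ∀ i < G.len, m (G.inputLen + (G.arrays * i + q)) = A q i

/-- The program `c` started in `σ` halts within `T` steps in a store satisfying `Q`; it touches only
the registers and arrays that it names, and leaves the memory alone if it names no array. -/
def Does (G : Layout) (c : Cmd) (T : ℕ) (σ : Store) (Q : Store → Prop) : Prop :=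
  ∀ m, G.Represents m σ.arr → ∃ T' ≤ T, ∃ σ' m',
    Exec G.W G.cells (c.toStmt G.arrays) ⟨σ.regs, m⟩ T' ⟨σ'.regs, m'⟩ ∧
    G.Represents m' σ'.arr ∧ c.Frame σ σ' ∧ (c.arrs = [] → m' = m) ∧ Q σ'

section

variable {G : Layout} {m : ℕ → ℕ} {σ : Store} {q i v : ℕ} {e e' : Expr} {Q : Store → Prop}

theorem Layout.address_lt_cells (hi : i < G.len) (hq : q < G.arrays) :
    G.inputLen + (G.arrays * i + q) < G.cells := by
  have := G.le_cells
  have : G.arrays * i + G.arrays ≤ G.arrays * G.len := Nat.mul_le_mul_left G.arrays hi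
  omega

theorem Layout.Represents.write (hm : G.Represents m σ.arr) (hq : q < G.arrays) :
    G.Represents (Function.update m (G.inputLen + (G.arrays * i + q)) v) (σ.write q i v).arr := by
  refine ⟨fun a ha => ?_, fun q' hq' i' hi' => ?_⟩
  · rw [Function.update_of_ne (by omega), hm.inp a ha]
  by_cases hcell : G.arrays * i' + q' = G.arrays * i + q
  · have hmod := congrArg (· % G.arrays) hcell
    have hdiv := congrArg (· / G.arrays) hcell
    simp only [Nat.mul_add_mod, Nat.mod_eq_of_lt hq, Nat.mod_eq_of_lt hq'] at hmod
    simp only [Nat.mul_add_div (Nat.zero_lt_of_lt hq), Nat.div_eq_of_lt hq,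
      Nat.div_eq_of_lt hq', add_zero] at hdiv
    rw [hmod, hdiv, Function.update_self, σ.write_arr_self, Function.update_self]
  · rw [Function.update_of_ne (by omega), hm.arr q' hq' i' hi']
    by_cases hqq : q' = q
    · subst hqq
      rw [σ.write_arr_self, Function.update_of_ne (by rintro rfl; exact hcell rfl)]
    · rw [σ.write_arr_of_ne i v hqq]

theorem cell_eval {ρ : ℕ → ℕ} (he : e.Fits G.W ρ) (hi : e.natEval G.W ρ < G.len)
    (hq : q < G.arrays) (hbase : ρ rBase = G.inputLen) :
    (cell G.arrays q e).eval G.W ρ = G.inputLen + (G.arrays * e.natEval G.W ρ + q) := by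
  have hlt := (G.address_lt_cells hi hq).trans_le G.cells_le
  have hone : G.arrays ≤ G.arrays * G.len := Nat.le_mul_of_pos_right _ (by omega)
  have := G.le_cells
  have := G.cells_le
  have := G.inputLen_pos
  rw [Expr.eval_eq_natEval]
  · simp [cell, hbase]
  · simp only [cell, Expr.add_def, Expr.mul_def, Expr.Fits, Op.Fits, Expr.natEval, Op.natEval,
      hbase]
    exact ⟨trivial, ⟨⟨by omega, he, by omega⟩, by omega, by omega⟩, by omega⟩

namespace Does

theorem mono {c : Cmd} {T T' : ℕ} {Q' : Store → Prop} (h : Does G c T σ Q) (hT : T ≤ T')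
    (hQ : ∀ σ', c.Frame σ σ' → Q σ' → Q' σ') : Does G c T' σ Q' := by
  intro m hm
  obtain ⟨t, ht, σ', m', hexec, hrep, hframe, hmem, hpost⟩ := h m hm
  exact ⟨t, ht.trans hT, σ', m', hexec, hrep, hframe, hmem, hQ _ hframe hpost⟩

protected theorem skip (h : Q σ) : Does G .skip 1 σ Q := fun m hm =>
  ⟨1, le_rfl, σ, m, .skip _, hm, .refl _ _, fun _ => rfl, h⟩

protected theorem set {r : ℕ} (he : e.Fits G.W σ.regs) (h : Q (σ.put r (e.natEval G.W σ.regs))) :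
    Does G (.set r e) (e.cost + 1) σ Q := by
  intro m hm
  have hexec := Exec.assign (W := G.W) (M := G.cells) r e ⟨σ.regs, m⟩
  rw [Expr.eval_eq_natEval he] at hexec
  exact ⟨_, le_rfl, σ.put r (e.natEval G.W σ.regs), m, hexec, hm,
    .put (List.mem_singleton_self r) _ _, fun _ => rfl, h⟩

protected theorem ld {r : ℕ} (he : e.Fits G.W σ.regs) (hi : e.natEval G.W σ.regs < G.len)
    (hq : q < G.arrays) (hbase : σ.regs rBase = G.inputLen)
    (h : Q (σ.put r (σ.arr q (e.natEval G.W σ.regs)))) : Does G (.ld r q e) (e.cost + 7) σ Q := by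
  intro m hm
  have haddr := cell_eval he hi hq hbase
  have hexec := Exec.load (W := G.W) r (cell G.arrays q e) ⟨σ.regs, m⟩
    (haddr ▸ G.address_lt_cells hi hq)
  simp only [haddr, hm.arr q hq _ hi, cell_cost] at hexec
  exact ⟨_, le_rfl, σ.put r (σ.arr q (e.natEval G.W σ.regs)), m, hexec, hm,
    .put (List.mem_singleton_self r) _ _, fun _ => rfl, h⟩

protected theorem st (he : e.Fits G.W σ.regs) (he' : e'.Fits G.W σ.regs)
    (hi : e.natEval G.W σ.regs < G.len) (hq : q < G.arrays) (hbase : σ.regs rBase = G.inputLen)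
    (h : Q (σ.write q (e.natEval G.W σ.regs) (e'.natEval G.W σ.regs))) :
    Does G (.st q e e') (e.cost + e'.cost + 7) σ Q := by
  intro m hm
  have haddr := cell_eval he hi hq hbase
  have hexec := Exec.store (W := G.W) (cell G.arrays q e) e' ⟨σ.regs, m⟩
    (haddr ▸ G.address_lt_cells hi hq)
  simp only [haddr, Expr.eval_eq_natEval he', cell_cost] at hexec
  refine ⟨_, by omega, σ.write q (e.natEval G.W σ.regs) (e'.natEval G.W σ.regs), _, hexec,
    hm.write hq, ⟨fun _ _ => rfl, fun q' hq' => ?_⟩, nofun, h⟩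
  exact σ.write_arr_of_ne _ _ fun hc => hq' (hc ▸ List.mem_singleton_self q)

protected theorem inp {r : ℕ} (he : e.Fits G.W σ.regs) (hi : e.natEval G.W σ.regs < G.inputLen)
    (h : Q (σ.put r (G.inp (e.natEval G.W σ.regs)))) : Does G (.inp r e) (e.cost + 1) σ Q := by
  intro m hm
  have haddr := Expr.eval_eq_natEval he
  have hexec := Exec.load (W := G.W) (M := G.cells) r e ⟨σ.regs, m⟩
    (haddr ▸ hi.trans_le ((Nat.le_add_right _ _).trans G.le_cells))
  simp only [haddr, hm.inp _ hi] at hexec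
  exact ⟨_, le_rfl, σ.put r (G.inp (e.natEval G.W σ.regs)), m, hexec, hm,
    .put (List.mem_singleton_self r) _ _, fun _ => rfl, h⟩

protected theorem seq {a b : Cmd} {T₁ T₂ : ℕ} {P : Store → Prop} (ha : Does G a T₁ σ P)
    (hb : ∀ σ', a.Frame σ σ' → P σ' → Does G b T₂ σ' Q) : Does G (a ;; b) (T₁ + T₂) σ Q := by
  intro m hm
  obtain ⟨t₁, ht₁, σ₁, m₁, hexec₁, hrep₁, hframe₁, hmem₁, hpost₁⟩ := ha m hm
  obtain ⟨t₂, ht₂, σ₂, m₂, hexec₂, hrep₂, hframe₂, hmem₂, hpost₂⟩ := hb σ₁ hframe₁ hpost₁ m₁ hrep₁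
  refine ⟨t₁ + t₂, by omega, σ₂, m₂, .seq hexec₁ hexec₂, hrep₂, ?_, fun h => ?_, hpost₂⟩
  · exact (hframe₁.mono (List.subset_append_left _ _) (List.subset_append_left _ _)).trans
      (hframe₂.mono (List.subset_append_right _ _) (List.subset_append_right _ _))
  · obtain ⟨ha, hb⟩ := List.append_eq_nil_iff.1 h
    rw [hmem₂ hb, hmem₁ ha]

protected theorem ite {a b : Cmd} {T₁ T₂ : ℕ} (he : e.Fits G.W σ.regs)
    (ha : e.natEval G.W σ.regs ≠ 0 → Does G a T₁ σ Q)
    (hb : e.natEval G.W σ.regs = 0 → Does G b T₂ σ Q) :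
    Does G (.ite e a b) (e.cost + 1 + (T₁ + T₂)) σ Q := by
  intro m hm
  rw [← Expr.eval_eq_natEval he] at ha hb
  by_cases hcond : e.eval G.W σ.regs = 0
  · obtain ⟨t, ht, σ', m', hexec, hrep, hframe, hmem, hpost⟩ := hb hcond m hm
    exact ⟨_, by omega, σ', m', .cond_false hcond hexec, hrep,
      hframe.mono (List.subset_append_right _ _) (List.subset_append_right _ _),
      fun h => hmem (List.append_eq_nil_iff.1 h).2, hpost⟩
  · obtain ⟨t, ht, σ', m', hexec, hrep, hframe, hmem, hpost⟩ := ha hcond m hm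
    exact ⟨_, by omega, σ', m', .cond_true hcond hexec, hrep,
      hframe.mono (List.subset_append_left _ _) (List.subset_append_left _ _),
      fun h => hmem (List.append_eq_nil_iff.1 h).1, hpost⟩

theorem whl_done {a : Cmd} (he : e.Fits G.W σ.regs) (hcond : e.natEval G.W σ.regs = 0) (h : Q σ) :
    Does G (.whl e a) (e.cost + 1) σ Q := fun m hm =>
  ⟨_, le_rfl, σ, m, .loop_done (by rwa [Expr.eval_eq_natEval he]), hm, .refl _ _, fun _ => rfl, h⟩

theorem whl_step {a : Cmd} {T₁ T₂ : ℕ} {P : Store → Prop} (he : e.Fits G.W σ.regs)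
    (hcond : e.natEval G.W σ.regs ≠ 0) (ha : Does G a T₁ σ P)
    (hrest : ∀ σ', a.Frame σ σ' → P σ' → Does G (.whl e a) T₂ σ' Q) :
    Does G (.whl e a) (e.cost + 1 + T₁ + T₂) σ Q := by
  intro m hm
  obtain ⟨t₁, ht₁, σ₁, m₁, hexec₁, hrep₁, hframe₁, hmem₁, hpost₁⟩ := ha m hm
  obtain ⟨t₂, ht₂, σ₂, m₂, hexec₂, hrep₂, hframe₂, hmem₂, hpost₂⟩ :=
    hrest σ₁ hframe₁ hpost₁ m₁ hrep₁
  have hframe₁' : (Cmd.whl e a).Frame σ σ₁ := ⟨hframe₁.regs, hframe₁.arr⟩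
  exact ⟨_, by omega, σ₂, m₂, .loop_step (by rwa [Expr.eval_eq_natEval he]) hexec₁ hexec₂, hrep₂,
    hframe₁'.trans hframe₂, fun h => (hmem₂ h).trans (hmem₁ h), hpost₂⟩

end Does

end

/-! ## Weakest preconditions and counting loops -/

/-- The weakest precondition of a program without `whl`; a loop has the precondition `False`. -/
def Cmd.wp (G : Layout) : Cmd → (Store → Prop) → Store → Prop
  | .skip, Q, σ => Q σ
  | .set r e, Q, σ => e.Fits G.W σ.regs ∧ Q (σ.put r (e.natEval G.W σ.regs))
  | .ld r q e, Q, σ => (e.Fits G.W σ.regs ∧ e.natEval G.W σ.regs < G.len ∧ q < G.arrays ∧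
      σ.regs rBase = G.inputLen) ∧ Q (σ.put r (σ.arr q (e.natEval G.W σ.regs)))
  | .st q e e', Q, σ => (e.Fits G.W σ.regs ∧ e'.Fits G.W σ.regs ∧ e.natEval G.W σ.regs < G.len ∧
      q < G.arrays ∧ σ.regs rBase = G.inputLen) ∧
      Q (σ.write q (e.natEval G.W σ.regs) (e'.natEval G.W σ.regs))
  | .inp r e, Q, σ => (e.Fits G.W σ.regs ∧ e.natEval G.W σ.regs < G.inputLen) ∧
      Q (σ.put r (G.inp (e.natEval G.W σ.regs)))
  | .seq a b, Q, σ => a.wp G (b.wp G Q) σ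
  | .ite e a b, Q, σ => e.Fits G.W σ.regs ∧ (e.natEval G.W σ.regs ≠ 0 → a.wp G Q σ) ∧
      (e.natEval G.W σ.regs = 0 → b.wp G Q σ)
  | .whl _ _, _, _ => False

/-- A bound for the number of steps of a program without `whl`. -/
def Cmd.cost : Cmd → ℕ
  | .skip => 1
  | .set _ e => e.cost + 1
  | .ld _ _ e => e.cost + 7
  | .st _ e e' => e.cost + e'.cost + 7
  | .inp _ e => e.cost + 1
  | .seq a b => a.cost + b.cost
  | .ite e a b => e.cost + 1 + (a.cost + b.cost)
  | .whl _ _ => 0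

namespace Does

variable {G : Layout} {σ : Store} {Q : Store → Prop}

theorem of_wp {c : Cmd} (h : c.wp G Q σ) : Does G c c.cost σ Q := by
  induction c generalizing σ Q with
  | skip => exact .skip h
  | set r e => exact .set h.1 h.2
  | ld r q e =>
    obtain ⟨⟨he, hi, hq, hbase⟩, hpost⟩ := h
    exact .ld he hi hq hbase hpost
  | st q e e' =>
    obtain ⟨⟨he, he', hi, hq, hbase⟩, hpost⟩ := h
    exact .st he he' hi hq hbase hpost
  | inp r e => exact .inp h.1.1 h.1.2 h.2
  | seq a b iha ihb => exact (iha h).seq fun σ' _ h' => ihb h'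
  | ite e a b iha ihb => exact .ite h.1 (fun he => iha (h.2.1 he)) fun he => ihb (h.2.2 he)
  | whl e a _ => exact h.elim

/-- The variable postcondition `Q'` hides `Q` from the simplifier while it computes `c.wp`. -/
theorem block {c : Cmd} {T : ℕ} (hT : c.cost ≤ T)
    (h : ∀ Q' : Store → Prop, (∀ σ', Q σ' → Q' σ') → c.wp G Q' σ) : Does G c T σ Q :=
  (of_wp (h Q fun _ hQ => hQ)).mono hT fun _ _ hQ => hQ

theorem of_wp_eq {c : Cmd} {T : ℕ} (σ' : Store) (hT : c.cost ≤ T)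
    (hwp : c.wp G (fun σ'' => σ'' = σ') σ) (hQ : Q σ') : Does G c T σ Q :=
  (of_wp hwp).mono hT fun _ _ h => h ▸ hQ

end Does

/-- Run `a` with register `r` holding `0, 1, …` up to the content of register `lim`. -/
def Cmd.for (r lim : ℕ) (a : Cmd) : Cmd :=
  .set r (.const 0) ;; .whl (.bin .lt (.reg r) (.reg lim)) (a ;; .set r (.reg r + .const 1))

@[simp] theorem Cmd.mem_regs_for {r lim r' : ℕ} {a : Cmd} :
    r' ∈ (Cmd.for r lim a).regs ↔ r' = r ∨ r' ∈ a.regs := by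
  simp [Cmd.for, Cmd.regs, or_comm]

@[simp] theorem Cmd.arrs_for (r lim : ℕ) (a : Cmd) : (Cmd.for r lim a).arrs = a.arrs := by
  simp [Cmd.for, Cmd.arrs]

section For

variable {G : Layout} {r lim n : ℕ} {a : Cmd} {σ : Store}

theorem Does.for_from (I : ℕ → Store → Prop) (T : ℕ → ℕ) (hn : σ.regs lim = n)
    (hlim : lim ∉ (Cmd.for r lim a).regs) (hr : r ∉ a.regs) (hW : n < cap G.W)
    (hstep : ∀ i < n, ∀ σ', (Cmd.for r lim a).Frame σ σ' → σ'.regs r = i → I i σ' →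
      Does G a (T i) σ' fun σ'' => I (i + 1) (σ''.put r (i + 1)))
    {i : ℕ} (hi : i ≤ n) {σ' : Store} (hframe : (Cmd.for r lim a).Frame σ σ')
    (hri : σ'.regs r = i) (hI : I i σ') :
    Does G (.whl (.bin .lt (.reg r) (.reg lim)) (a ;; .set r (.reg r + .const 1)))
      (∑ j ∈ Finset.Ico i n, (T j + 8) + 4) σ' (I n) := by
  have hcond : (Expr.bin .lt (.reg r) (.reg lim)).natEval G.W σ'.regs = if i < n then 1 else 0 := by
    simp [hri, hframe.regs lim hlim, hn]
  induction h : n - i generalizing i σ' with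
  | zero =>
    obtain rfl : i = n := by omega
    simpa [Expr.cost] using Does.whl_done (a := a ;; .set r (.reg r + .const 1))
      (e := .bin .lt (.reg r) (.reg lim)) (by simp) (by simpa using hcond) hI
  | succ m ih =>
    have hlt : i < n := by omega
    have hbody : Does G (a ;; .set r (.reg r + .const 1)) (T i + 4) σ'
        fun σ₂ => (Cmd.for r lim a).Frame σ' σ₂ ∧ σ₂.regs r = i + 1 ∧ I (i + 1) σ₂ := by
      refine (hstep i hlt σ' hframe hri hI).seq fun σ₁ hframe₁ hI₁ => ?_
      have hr₁ : σ₁.regs r = i := (hframe₁.regs r hr).trans hri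
      have hframe' : (Cmd.for r lim a).Frame σ' σ₁ :=
        hframe₁.mono (fun _ h => Cmd.mem_regs_for.2 (.inr h)) (by simp)
      refine Does.set (by simp; omega) ?_
      simpa [hr₁] using And.intro (hframe'.trans (.put (Cmd.mem_regs_for.2 (.inl rfl)) _ _)) hI₁
    have hloop := Does.whl_step (by simp) (by rw [hcond, if_pos hlt]; exact one_ne_zero) hbody
      fun σ₂ _ ⟨hframe₂, hr₂, hI₂⟩ => ih hlt (hframe.trans hframe₂) hr₂ hI₂
        (by simp [hr₂, (hframe.trans hframe₂).regs lim hlim, hn]) (by omega)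
    refine hloop.mono ?_ fun _ _ hQ => hQ
    rw [Finset.sum_eq_sum_Ico_succ_bot hlt]
    simp only [Expr.cost, Nat.succ_eq_add_one]
    omega

theorem Does.for (I : ℕ → Store → Prop) (T : ℕ → ℕ) (hn : σ.regs lim = n)
    (hlim : lim ∉ (Cmd.for r lim a).regs) (hr : r ∉ a.regs) (hW : n < cap G.W)
    (hzero : I 0 (σ.put r 0))
    (hstep : ∀ i < n, ∀ σ', (Cmd.for r lim a).Frame σ σ' → σ'.regs r = i → I i σ' →
      Does G a (T i) σ' fun σ'' => I (i + 1) (σ''.put r (i + 1))) :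
    Does G (.for r lim a) (∑ i ∈ Finset.range n, (T i + 8) + 6) σ (I n) := by
  have hframe : (Cmd.for r lim a).Frame σ (σ.put r 0) := .put (Cmd.mem_regs_for.2 (.inl rfl)) _ _
  have hinit : Does G (.set r (.const 0)) 2 σ fun σ' => σ' = σ.put r 0 :=
    .set (by simpa using cap_pos G.W) rfl
  have hloop := Does.for_from I T hn hlim hr hW hstep (Nat.zero_le n) hframe (by simp) hzero
  refine (hinit.seq fun _ _ hσ' => hσ' ▸ hloop).mono ?_ fun _ _ hQ => hQ
  rw [Finset.range_eq_Ico]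
  omega

end For

end WordRAM

namespace PISNS

open WordRAM Finset

/-! ## One level of the trie -/

theorem rank_mono (v : ℕ) {d d' : ℕ} (h : d ≤ d') : rank v d ≤ rank v d' :=
  Nat.count_monotone _ h

theorem rank_lt_rank {v d d' : ℕ} (h : v.testBit d = true) (hd : d < d') : rank v d < rank v d' :=
  Nat.count_strict_mono h hd

theorem rank_eq_card_filter (v d : ℕ) : rank v d = #{i ∈ range d | v.testBit i = true} :=
  Nat.count_eq_card_filter_range ..

theorem sum_card_filter_eq {α : Type*} (s : Finset α) (f : α → ℕ) (r : ℕ) :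
    ∑ u ∈ range r, #{e ∈ s | f e = u} = #{e ∈ s | f e < r} := by
  rw [card_eq_sum_card_fiberwise (f := f) (t := range r)]
  · refine sum_congr rfl fun u hu => ?_
    rw [filter_filter]
    exact congrArg card (filter_congr fun e _ => by have := mem_range.1 hu; omega)
  · exact fun e he => mem_coe.2 (mem_range.2 (mem_filter.1 he).2)

section

variable {W : ℕ} {bm : ℕ → ℕ} {u r d δ : ℕ}

/-- The children of the nodes with the bitmaps `bm 0, bm 1, …` of width `W` are numbered
consecutively, in the order of the nodes and then of the digits.  This is the number of the first
child of the node `r`. -/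
def firstChild (W : ℕ) (bm : ℕ → ℕ) (r : ℕ) : ℕ := ∑ u ∈ range r, rank (bm u) W

/-- The number of the child of the node `r` for the digit `d`; if there is none, this is the number
of the first later child. -/
def child (W : ℕ) (bm : ℕ → ℕ) (r d : ℕ) : ℕ := firstChild W bm r + rank (bm r) d

theorem firstChild_succ (W : ℕ) (bm : ℕ → ℕ) (r : ℕ) :
    firstChild W bm (r + 1) = firstChild W bm r + rank (bm r) W := sum_range_succ _ _

theorem firstChild_mono (W : ℕ) (bm : ℕ → ℕ) : Monotone (firstChild W bm) := fun _ _ h =>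
  sum_le_sum_of_subset (range_mono h)

theorem firstChild_le_child (W : ℕ) (bm : ℕ → ℕ) (r d : ℕ) :
    firstChild W bm r ≤ child W bm r d := Nat.le_add_right _ _

theorem child_le_firstChild_succ (hd : d ≤ W) : child W bm r d ≤ firstChild W bm (r + 1) := by
  rw [firstChild_succ]
  exact Nat.add_le_add_left (rank_mono _ hd) _

theorem child_lt_firstChild_succ (hd : d < W) (h : (bm r).testBit d = true) :
    child W bm r d < firstChild W bm (r + 1) := by
  rw [firstChild_succ]
  exact Nat.add_lt_add_left (rank_lt_rank h hd) _

theorem child_lt_child_iff (hd : d < W) (h : (bm u).testBit d = true) (hδ : δ ≤ W) :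
    child W bm u d < child W bm r δ ↔ u < r ∨ u = r ∧ d < δ := by
  rcases lt_trichotomy u r with hlt | rfl | hgt
  · simpa [hlt] using (child_lt_firstChild_succ hd h).trans_le
      ((firstChild_mono W bm hlt).trans (firstChild_le_child ..))
  · simp only [lt_irrefl, true_and, false_or, child, Nat.add_lt_add_iff_left]
    exact ⟨fun hlt => not_le.1 fun hle => hlt.not_ge (rank_mono _ hle), rank_lt_rank h⟩
  · simpa [hgt.not_gt, hgt.ne'] using (child_le_firstChild_succ hδ).trans
      ((firstChild_mono W bm hgt).trans (firstChild_le_child ..))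

theorem child_eq_child_iff (hd : d < W) (h : (bm u).testBit d = true) (hδ : δ < W)
    (h' : (bm r).testBit δ = true) : child W bm u d = child W bm r δ ↔ u = r ∧ d = δ := by
  have hlt := child_lt_child_iff (r := r) hd h hδ.le
  have hgt := child_lt_child_iff (r := u) hδ h' hd.le
  refine ⟨fun heq => ?_, by rintro ⟨rfl, rfl⟩; rfl⟩
  simp only [heq, lt_irrefl, false_iff] at hlt hgt
  omega

end

/-- The child of `r` for the digit `δ` if `ex` holds, and the first child of `r` otherwise: where a
search continues that has reached the node `r` with `ex`, or the gap before `r` without. -/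
noncomputable def descend (W : ℕ) (bm : ℕ → ℕ) (r δ : ℕ) (ex : Prop) [Decidable ex] : ℕ :=
  child W bm r (if ex then δ else 0)

/-- The elements `e < n` sit in the nodes `v e` of a level of a trie and have there the digits
`dg e`, and the bitmap `bm u` of the node `u` marks the digits that occur in `u`. -/
structure TrieLevel (W n : ℕ) (v dg bm : ℕ → ℕ) : Prop where
  digit_lt : ∀ e < n, dg e < W
  testBit_iff : ∀ u d, (bm u).testBit d = true ↔ ∃ e < n, v e = u ∧ dg e = d

namespace TrieLevel

variable {W n : ℕ} {v dg bm : ℕ → ℕ} (L : TrieLevel W n v dg bm)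
include L

theorem testBit_digit {e : ℕ} (he : e < n) : (bm (v e)).testBit (dg e) = true :=
  (L.testBit_iff _ _).2 ⟨e, he, rfl, rfl⟩

theorem child_lt_child_iff {e r δ : ℕ} (he : e < n) (hδ : δ ≤ W) :
    child W bm (v e) (dg e) < child W bm r δ ↔ v e < r ∨ v e = r ∧ dg e < δ :=
  PISNS.child_lt_child_iff (L.digit_lt e he) (L.testBit_digit he) hδ

theorem child_injective {e e' : ℕ} (he : e < n) (he' : e' < n)
    (h : child W bm (v e) (dg e) = child W bm (v e') (dg e')) : v e = v e' ∧ dg e = dg e' :=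
  (child_eq_child_iff (L.digit_lt e he) (L.testBit_digit he) (L.digit_lt e' he')
    (L.testBit_digit he')).1 h

theorem before_iff_before_descend {e r δ : ℕ} (he : e < n) (hδ : δ < W) (ex : Prop) [Decidable ex]
    (p : Prop) :
    (v e < r ∨ ex ∧ v e = r ∧ (dg e < δ ∨ dg e = δ ∧ p)) ↔
      (child W bm (v e) (dg e) < descend W bm r δ ex ∨
        (ex ∧ (bm r).testBit δ = true) ∧ child W bm (v e) (dg e) = descend W bm r δ ex ∧ p) := by
  rw [descend, L.child_lt_child_iff he (by split_ifs <;> omega)]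
  by_cases hex : ex
  · simp only [hex, if_true, true_and]
    by_cases hbit : (bm r).testBit δ = true
    · rw [child_eq_child_iff (L.digit_lt e he) (L.testBit_digit he) hδ hbit]
      tauto
    · have : ¬ (v e = r ∧ dg e = δ) := fun h => hbit ((L.testBit_iff _ _).2 ⟨e, he, h.1, h.2⟩)
      tauto
  · simp [hex]

theorem rank_le_card (u δ : ℕ) : rank (bm u) δ ≤ #{e ∈ range n | v e = u ∧ dg e < δ} := by
  rw [rank_eq_card_filter]
  refine (card_le_card fun d hd => ?_).trans (card_image_le (f := dg))
  simp only [mem_filter, mem_range, mem_image] at hd ⊢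
  obtain ⟨e, he, hv, rfl⟩ := (L.testBit_iff _ _).1 hd.2
  exact ⟨e, ⟨he, hv, hd.1⟩, rfl⟩

theorem firstChild_le (r : ℕ) : firstChild W bm r ≤ n :=
  calc firstChild W bm r ≤ ∑ u ∈ range r, #{e ∈ range n | v e = u} :=
        sum_le_sum fun u _ => (L.rank_le_card u W).trans
          (card_le_card (monotone_filter_right _ fun _ _ h => h.1))
    _ = #{e ∈ range n | v e < r} := sum_card_filter_eq ..
    _ ≤ n := (card_filter_le _ _).trans (card_range n).le

section

variable (hinj : ∀ e < n, ∀ e' < n, v e = v e' → dg e = dg e' → e = e')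
include hinj

theorem rank_eq_card (u δ : ℕ) : rank (bm u) δ = #{e ∈ range n | v e = u ∧ dg e < δ} := by
  refine (L.rank_le_card u δ).antisymm ?_
  rw [rank_eq_card_filter]
  refine card_le_card_of_injOn dg (fun e he => ?_) fun e he e' he' h => ?_
  · simp only [coe_filter, mem_range, Set.mem_ofPred_eq] at *
    exact ⟨he.2.2, (L.testBit_iff _ _).2 ⟨e, he.1, he.2.1, rfl⟩⟩
  · simp only [coe_filter, mem_range, Set.mem_ofPred_eq] at *
    exact hinj e he.1 e' he'.1 (he.2.1.trans he'.2.1.symm) h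

theorem card_child_lt (r : ℕ) {δ : ℕ} (hδ : δ ≤ W) :
    #{e ∈ range n | child W bm (v e) (dg e) < child W bm r δ} = child W bm r δ := by
  have hfirst : firstChild W bm r = #{e ∈ range n | v e < r} := by
    rw [← sum_card_filter_eq]
    refine sum_congr rfl fun u _ => (L.rank_eq_card hinj u W).trans ?_
    exact congrArg card (filter_congr fun e he =>
      and_iff_left (L.digit_lt e (mem_range.1 he)))
  rw [filter_congr fun e he => L.child_lt_child_iff (mem_range.1 he) hδ, filter_or,
    card_union_of_disjoint (disjoint_filter.2 fun e _ h h' => by omega), ← hfirst,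
    ← L.rank_eq_card hinj, child]

theorem card_child_eq_descend {r δ : ℕ} {ex : Prop} [Decidable ex] (hex : ex)
    (hbit : (bm r).testBit δ = true) :
    #{e ∈ range n | child W bm (v e) (dg e) = descend W bm r δ ex} = 1 := by
  obtain ⟨e, he, rfl, rfl⟩ := (L.testBit_iff _ _).1 hbit
  refine card_eq_one.2 ⟨e, ?_⟩
  ext e'
  simp only [mem_filter, mem_range, mem_singleton, descend, if_pos hex]
  refine ⟨fun ⟨he', h⟩ => ?_, by rintro rfl; exact ⟨he, rfl⟩⟩
  obtain ⟨hv, hdg⟩ := L.child_injective he' he h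
  exact hinj e' he' e he hv hdg

/-- A search that ends at the level of the single elements has the number of the elements before
it. -/
theorem card_before_descend (r : ℕ) {δ : ℕ} (hδ : δ < W) (ex : Prop) [Decidable ex] :
    #{e ∈ range n | child W bm (v e) (dg e) < descend W bm r δ ex ∨
        (ex ∧ (bm r).testBit δ = true) ∧ child W bm (v e) (dg e) = descend W bm r δ ex} =
      descend W bm r δ ex + if ex ∧ (bm r).testBit δ = true then 1 else 0 := by
  rw [filter_or, card_union_of_disjoint (disjoint_filter.2 fun e _ h h' => by omega)]
  congr 1
  · exact L.card_child_lt hinj r (by split_ifs <;> omega)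
  · split_ifs with h
    · simpa only [h, true_and] using L.card_child_eq_descend hinj h.1 h.2
    · simp [h]

end

end TrieLevel

/-! ## Families of shrinking nested sets -/

/-- The data of an instance as the programs see it: `k` sets of elements up to `N`, the set `i` with
`card i` elements, and the universe divided into blocks of length `B`.  The sets are listed one
after the other, `elem e` is the `e`-th of the `n` elements of this list, and `owner e` is the index
of its set. -/
structure Family where
  N : ℕ
  k : ℕ
  n : ℕ
  B : ℕ
  card : ℕ → ℕ
  elem : ℕ → ℕ
  owner : ℕ → ℕ
  k_pos : 0 < k
  card_pos : ∀ i < k, 1 ≤ card i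
  sum_card : ∑ i ∈ range k, card i = n
  owner_lt : ∀ e < n, owner e < k
  owner_eq_iff : ∀ e < n, ∀ i < k, owner e = i ↔
    ∑ j ∈ range i, card j ≤ e ∧ e < ∑ j ∈ range (i + 1), card j
  elem_le : ∀ e < n, elem e ≤ N
  elem_inj : ∀ e < n, ∀ e' < n, owner e = owner e' → elem e = elem e' → e = e'
  nested : ∀ e < n, ∀ e' < n, ∀ i, owner e ≤ i → i ≤ owner e' → elem e' ≤ elem e →
    ∃ e'' < n, owner e'' = i ∧ elem e'' = elem e

namespace Family

variable (D : Family)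

/-- The position of the first element of the set `i`. -/
def offset (i : ℕ) : ℕ := ∑ j ∈ range i, D.card j

/-- The block of the element `e`. -/
def block (e : ℕ) : ℕ := D.elem e / D.B

/-- The number of blocks; `M` itself serves as the index of a sentinel block. -/
def M : ℕ := D.N / D.B + 1

theorem offset_succ (i : ℕ) : D.offset (i + 1) = D.offset i + D.card i := sum_range_succ _ _

theorem offset_zero : D.offset 0 = 0 := rfl

theorem offset_mono : Monotone D.offset := fun _ _ h => sum_le_sum_of_subset (range_mono h)

theorem offset_k : D.offset D.k = D.n := D.sum_card

theorem offset_le {i : ℕ} (h : i ≤ D.k) : D.offset i ≤ D.n := D.offset_k ▸ D.offset_mono h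

theorem owner_eq {e i : ℕ} (hi : i < D.k) (hle : D.offset i ≤ e) (hlt : e < D.offset (i + 1)) :
    D.owner e = i :=
  (D.owner_eq_iff e (hlt.trans_le (D.offset_le hi)) i hi).2 ⟨hle, hlt⟩

theorem offset_owner_le {e : ℕ} (he : e < D.n) : D.offset (D.owner e) ≤ e :=
  ((D.owner_eq_iff e he _ (D.owner_lt e he)).1 rfl).1

theorem lt_offset_owner_succ {e : ℕ} (he : e < D.n) : e < D.offset (D.owner e + 1) :=
  ((D.owner_eq_iff e he _ (D.owner_lt e he)).1 rfl).2

theorem owner_lt_iff {e i : ℕ} (he : e < D.n) : D.owner e < i ↔ e < D.offset i :=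
  ⟨fun h => (D.lt_offset_owner_succ he).trans_le (D.offset_mono h), fun h => not_le.1 fun hle =>
    h.not_ge ((D.offset_mono hle).trans (D.offset_owner_le he))⟩

theorem owner_mono {e e' : ℕ} (h : e ≤ e') (he' : e' < D.n) : D.owner e ≤ D.owner e' :=
  Nat.lt_succ_iff.1 ((D.owner_lt_iff (h.trans_lt he')).2 (h.trans_lt (D.lt_offset_owner_succ he')))

theorem k_le_n : D.k ≤ D.n :=
  calc D.k = ∑ _i ∈ range D.k, 1 := by simp
    _ ≤ ∑ i ∈ range D.k, D.card i := sum_le_sum fun i hi => D.card_pos i (mem_range.1 hi)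
    _ = D.n := D.sum_card

theorem block_lt {e : ℕ} (he : e < D.n) : D.block e < D.M :=
  Nat.lt_succ_of_le (Nat.div_le_div_right (D.elem_le e he))

theorem filter_owner_eq {i : ℕ} (hi : i < D.k) :
    {e ∈ range D.n | D.owner e = i} = Ico (D.offset i) (D.offset (i + 1)) := by
  ext e
  simp only [mem_filter, mem_range, mem_Ico]
  refine ⟨?_, fun ⟨hle, hlt⟩ => ⟨hlt.trans_le (D.offset_le hi), D.owner_eq hi hle hlt⟩⟩
  rintro ⟨he, rfl⟩
  exact ⟨D.offset_owner_le he, D.lt_offset_owner_succ he⟩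

theorem card_filter_owner_eq {i : ℕ} (hi : i < D.k) :
    #{e ∈ range D.n | D.owner e = i} = D.card i := by
  rw [D.filter_owner_eq hi, Nat.card_Ico, offset_succ, Nat.add_sub_cancel_left]

theorem exists_owner_eq {i : ℕ} (hi : i < D.k) : ∃ e < D.n, D.owner e = i := by
  obtain ⟨e, he⟩ := Finset.card_pos.1 ((D.card_pos i hi).trans_eq (D.card_filter_owner_eq hi).symm)
  exact ⟨e, mem_range.1 (mem_filter.1 he).1, (mem_filter.1 he).2⟩

theorem card_filter_before {i : ℕ} (hi : i < D.k) (x : ℕ) :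
    #{e ∈ range D.n | D.owner e < i ∨ D.owner e = i ∧ D.elem e ≤ x} =
      D.offset i + #{e ∈ range D.n | D.owner e = i ∧ D.elem e ≤ x} := by
  rw [filter_or, card_union_of_disjoint (disjoint_filter.2 fun e _ h h' => by omega),
    filter_congr fun e he => D.owner_lt_iff (mem_range.1 he)]
  have hle := D.offset_le hi.le
  have hbefore : {e ∈ range D.n | e < D.offset i} = range (D.offset i) := by
    ext e
    simp only [mem_filter, mem_range]
    omega
  rw [hbefore, card_range]

/-! ### Births and deaths of blocks -/

/-- The first block met by the set `i`, as far as the elements below `m` are concerned. -/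
def firstUpTo (i : ℕ) : ℕ → ℕ
  | 0 => D.M
  | e + 1 => if D.owner e = i ∧ D.block e < firstUpTo i e then D.block e else firstUpTo i e

/-- The first block met by the set `i`. -/
def first (i : ℕ) : ℕ := D.firstUpTo i D.n

/-- One more than the last set below `m` whose first block is `b`, or `0`. -/
def lastUpTo (b : ℕ) : ℕ → ℕ
  | 0 => 0
  | j + 1 => if D.first j = b then j + 1 else lastUpTo b j

/-- One more than the last set whose first block is less than `b`, or `0`. -/
def death : ℕ → ℕ
  | 0 => 0
  | b + 1 => max (death b) (D.lastUpTo b D.k)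

/-- One more than the first set that meets the block `b`, as far as the elements below `m` are
concerned, or `0`. -/
def meetUpTo (b : ℕ) : ℕ → ℕ
  | 0 => 0
  | e + 1 => if D.block e = b ∧ meetUpTo b e = 0 then D.owner e + 1 else meetUpTo b e

/-- One more than the first set that meets the block `b`, or `0`; all sets meet the sentinel. -/
def meet (b : ℕ) : ℕ := if b = D.M then 1 else D.meetUpTo b D.n

/-- The first set that meets the block `b`, but at most `death b`.  The sets are nested as long as
they start before `b`, so that the block is met by all sets from its birth to its death. -/
def birth (b : ℕ) : ℕ := if D.meet b = 0 then D.death b else min (D.death b) (D.meet b - 1)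

theorem firstUpTo_le {e m : ℕ} (he : e < m) : D.firstUpTo (D.owner e) m ≤ D.block e := by
  induction m with
  | zero => omega
  | succ m ih =>
    rw [firstUpTo]
    rcases Nat.lt_succ_iff_lt_or_eq.1 he with hlt | rfl
    · have := ih hlt
      split_ifs <;> omega
    · split_ifs <;> omega

theorem firstUpTo_attained (i m : ℕ) :
    D.firstUpTo i m = D.M ∨ ∃ e < m, D.owner e = i ∧ D.firstUpTo i m = D.block e := by
  induction m with
  | zero => exact .inl rfl
  | succ m ih =>
    rw [firstUpTo]
    split_ifs with h
    · exact .inr ⟨m, m.lt_succ_self, h.1, rfl⟩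
    · exact ih.imp_right fun ⟨e, he, h⟩ => ⟨e, he.trans m.lt_succ_self, h⟩

theorem first_le {e : ℕ} (he : e < D.n) : D.first (D.owner e) ≤ D.block e := D.firstUpTo_le he

theorem first_attained {i : ℕ} (hi : i < D.k) :
    ∃ e < D.n, D.owner e = i ∧ D.block e = D.first i := by
  rcases D.firstUpTo_attained i D.n with hnone | ⟨e, he, howner, hfirst⟩
  · obtain ⟨e, he, rfl⟩ := D.exists_owner_eq hi
    exact absurd (hnone ▸ D.firstUpTo_le he) (D.block_lt he).not_ge
  · exact ⟨e, he, howner, hfirst.symm⟩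

theorem first_lt {i : ℕ} (hi : i < D.k) : D.first i < D.M := by
  obtain ⟨e, he, -, hfirst⟩ := D.first_attained hi
  exact hfirst ▸ D.block_lt he

theorem lt_lastUpTo_iff (b m i : ℕ) :
    i < D.lastUpTo b m ↔ ∃ j, i ≤ j ∧ j < m ∧ D.first j = b := by
  induction m with
  | zero => simp [lastUpTo]
  | succ m ih =>
    rw [lastUpTo]
    split_ifs with h
    · exact ⟨fun hi => ⟨m, by omega, by omega, h⟩, by rintro ⟨j, hij, hj, -⟩; omega⟩
    · rw [ih]
      refine exists_congr fun j => and_congr_right fun _ => and_congr_left fun hj => ?_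
      have : j ≠ m := by rintro rfl; exact h hj
      omega

theorem lt_death_iff (b i : ℕ) : i < D.death b ↔ ∃ j, i ≤ j ∧ j < D.k ∧ D.first j < b := by
  induction b with
  | zero => simp [death]
  | succ b ih =>
    simp only [death, lt_max_iff, ih, lt_lastUpTo_iff, ← exists_or, ← and_or_left, Nat.lt_succ_iff,
      le_iff_lt_or_eq (a := D.first _)]

theorem lt_death {b i : ℕ} (hi : i < D.k) (h : D.first i < b) : i < D.death b :=
  (D.lt_death_iff _ _).2 ⟨i, le_rfl, hi, h⟩

theorem death_mono : Monotone D.death := fun b b' h => by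
  refine le_of_forall_lt fun i hi => ?_
  obtain ⟨j, hij, hj, hfirst⟩ := (D.lt_death_iff b i).1 hi
  exact (D.lt_death_iff b' i).2 ⟨j, hij, hj, hfirst.trans_le h⟩

theorem death_le (b : ℕ) : D.death b ≤ D.k := by
  refine le_of_forall_lt fun i hi => ?_
  obtain ⟨j, hij, hj, -⟩ := (D.lt_death_iff b i).1 hi
  exact hij.trans_lt hj

theorem meetUpTo_attained (b m : ℕ) :
    D.meetUpTo b m = 0 ∨ ∃ e < m, D.block e = b ∧ D.meetUpTo b m = D.owner e + 1 := by
  induction m with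
  | zero => exact .inl rfl
  | succ m ih =>
    rw [meetUpTo]
    split_ifs with h
    · exact .inr ⟨m, m.lt_succ_self, h.1, rfl⟩
    · exact ih.imp_right fun ⟨e, he, h⟩ => ⟨e, he.trans m.lt_succ_self, h⟩

theorem meetUpTo_mem_Icc {e m : ℕ} (he : e < m) (hm : m ≤ D.n) :
    D.meetUpTo (D.block e) m ∈ Icc 1 (D.owner e + 1) := by
  induction m with
  | zero => omega
  | succ m ih =>
    rw [meetUpTo, mem_Icc]
    rcases Nat.lt_succ_iff_lt_or_eq.1 he with hlt | rfl
    · have := mem_Icc.1 (ih hlt (Nat.le_of_succ_le hm))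
      rwa [if_neg (by omega)]
    · split_ifs with h
      · omega
      · rcases D.meetUpTo_attained (D.block e) e with hzero | ⟨e', he', -, heq⟩
        · exact absurd ⟨rfl, hzero⟩ h
        · have := D.owner_mono he'.le hm
          omega

theorem birth_le_death (b : ℕ) : D.birth b ≤ D.death b := by
  unfold birth
  split_ifs <;> omega

theorem birth_M : D.birth D.M = 0 := by simp [birth, meet]

theorem exists_mem_of_alive {b i : ℕ} (hb : b < D.M) (hbirth : D.birth b ≤ i)
    (hdeath : i < D.death b) : ∃ e < D.n, D.owner e = i ∧ D.block e = b := by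
  have hmeet : D.meet b ≠ 0 ∧ D.meet b ≤ i + 1 := by
    unfold birth at hbirth
    split_ifs at hbirth <;> omega
  rw [meet, if_neg hb.ne] at hmeet
  obtain ⟨e, he, rfl, hmin⟩ := (D.meetUpTo_attained b D.n).resolve_left hmeet.1
  obtain ⟨j, hij, hj, hlt⟩ := (D.lt_death_iff _ _).1 hdeath
  obtain ⟨e', he', rfl, hfirst⟩ := D.first_attained hj
  have hle : D.elem e' ≤ D.elem e :=
    (Nat.lt_of_div_lt_div (show D.block e' < D.block e from hfirst ▸ hlt)).le
  obtain ⟨e'', he'', howner, helem⟩ := D.nested e he e' he' i (by omega) hij hle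
  exact ⟨e'', he'', howner, congrArg (· / D.B) helem⟩

theorem birth_le_owner {e : ℕ} (he : e < D.n) (h : D.owner e < D.death (D.block e)) :
    D.birth (D.block e) ≤ D.owner e := by
  have hmeet := mem_Icc.1 (D.meetUpTo_mem_Icc he le_rfl)
  rw [birth, meet, if_neg (D.block_lt he).ne, if_neg (by omega)]
  omega

theorem birth_le_iff {b i : ℕ} (hi : i < D.k) (h : D.first i < b) (hb : b < D.M) :
    D.birth b ≤ i ↔ ∃ e < D.n, D.owner e = i ∧ D.block e = b := by
  refine ⟨fun hbirth => D.exists_mem_of_alive hb hbirth (D.lt_death hi h), ?_⟩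
  rintro ⟨e, he, rfl, rfl⟩
  exact D.birth_le_owner he (D.lt_death hi h)

/-- The sum of the lifetimes of the blocks before `b`. -/
def life (b : ℕ) : ℕ := ∑ b' ∈ range b, (D.death b' - D.birth b')

theorem life_succ (b : ℕ) : D.life (b + 1) = D.life b + (D.death b - D.birth b) :=
  sum_range_succ _ _

theorem life_mono : Monotone D.life := fun _ _ h => sum_le_sum_of_subset (range_mono h)

/-- A block that is alive at `i` is met by the set `i`, and so uses up an element of it. -/
theorem life_M_le : D.life D.M ≤ D.n := by
  have hcard : D.life D.M = #((range D.M).sigma fun b => Ico (D.birth b) (D.death b)) := by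
    simp [life, card_sigma]
  rw [hcard, ← card_range D.n]
  refine (card_le_card ?_).trans
    (card_image_le (f := fun e => (⟨D.block e, D.owner e⟩ : Σ _ : ℕ, ℕ)))
  rintro ⟨b, i⟩ h
  simp only [mem_sigma, mem_range, mem_Ico] at h
  obtain ⟨e, he, rfl, rfl⟩ := D.exists_mem_of_alive h.1 h.2.1 h.2.2
  exact mem_image_of_mem _ (mem_range.2 he)

theorem life_le {b : ℕ} (hb : b ≤ D.M + 1) : D.life b ≤ D.n + D.k :=
  calc D.life b ≤ D.life (D.M + 1) := D.life_mono hb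
    _ = D.life D.M + (D.death D.M - D.birth D.M) := D.life_succ _
    _ ≤ D.n + D.k :=
      Nat.add_le_add D.life_M_le ((Nat.sub_le _ _).trans (D.death_le _))

/-- The number of blocks before `b` alive at `i`. -/
def alive (b i : ℕ) : ℕ := #{b' ∈ range b | D.birth b' ≤ i ∧ i < D.death b'}

theorem alive_succ (b i : ℕ) : D.alive (b + 1) i =
    D.alive b i + if D.birth b ≤ i ∧ i < D.death b then 1 else 0 := by
  rw [alive, range_add_one, filter_insert]
  split_ifs with h
  · rw [card_insert_of_notMem (by simp), alive]
  · rfl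

theorem alive_mono (i : ℕ) : Monotone (D.alive · i) := fun _ _ h =>
  card_le_card (filter_subset_filter _ (range_mono h))

theorem alive_eq_of_lt_birth {b s i : ℕ} (h : b ≤ s)
    (hs : ∀ s', b ≤ s' → s' < s → i < D.birth s') : D.alive s i = D.alive b i := by
  induction s, h using Nat.le_induction with
  | base => rfl
  | succ s h ih =>
    have := hs s h (by omega)
    rw [alive_succ, ih fun s' hle hlt => hs s' hle (by omega), if_neg (by omega), Nat.add_zero]

theorem alive_le_card {b i : ℕ} (hb : b ≤ D.M) (hi : i < D.k) : D.alive b i ≤ D.card i := by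
  rw [← D.card_filter_owner_eq hi]
  refine (card_le_card fun b' h => ?_).trans (card_image_le (f := D.block))
  simp only [mem_filter, mem_range, mem_image] at h ⊢
  obtain ⟨e, he, howner, hblock⟩ := D.exists_mem_of_alive (h.1.trans_le hb) h.2.1 h.2.2
  exact ⟨e, ⟨he, howner⟩, hblock⟩

/-! ### The top nodes -/

/-- The number of the top node for the block `b` of the set `i`.  The set has `2 * card i` numbers
at its disposal: the first one is for its first block, and the later blocks it meets, which are
exactly those alive at `i`, follow in their order. -/
def top (i b : ℕ) : ℕ :=
  if b ≤ D.first i then 2 * D.offset i else 2 * D.offset i + 1 + D.alive b i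

theorem two_mul_offset_le_top (i b : ℕ) : 2 * D.offset i ≤ D.top i b := by
  unfold top
  split_ifs <;> omega

theorem top_le {i b : ℕ} (hi : i < D.k) (hb : b ≤ D.M) : D.top i b ≤ 2 * D.offset (i + 1) := by
  have := D.alive_le_card hb hi
  have := D.card_pos i hi
  have := D.offset_succ i
  unfold top
  split_ifs <;> omega

theorem top_mono (i : ℕ) : Monotone (D.top i) := fun b b' h => by
  have := D.alive_mono i h
  simp only [top] at this ⊢
  split_ifs <;> omega

theorem top_lt_top {e b : ℕ} (he : e < D.n) (hb : D.block e < b) :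
    D.top (D.owner e) (D.block e) < D.top (D.owner e) b := by
  have hfirst := D.first_le he
  unfold top
  rw [if_neg (show ¬ b ≤ D.first (D.owner e) by omega)]
  split_ifs with h
  · omega
  · have hdeath := D.lt_death (D.owner_lt e he) (not_le.1 h)
    have hsucc := D.alive_succ (D.block e) (D.owner e)
    rw [if_pos ⟨D.birth_le_owner he hdeath, hdeath⟩] at hsucc
    have hmono : D.alive (D.block e + 1) (D.owner e) ≤ D.alive b (D.owner e) := D.alive_mono _ hb
    omega

theorem top_owner_lt {e : ℕ} (he : e < D.n) :
    D.top (D.owner e) (D.block e) < 2 * D.offset (D.owner e + 1) :=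
  (D.top_lt_top he (D.block_lt he)).trans_le (D.top_le (D.owner_lt e he) le_rfl)

theorem top_owner_lt_two_mul {e : ℕ} (he : e < D.n) : D.top (D.owner e) (D.block e) < 2 * D.n :=
  (D.top_owner_lt he).trans_le (Nat.mul_le_mul_left 2 (D.offset_le (D.owner_lt e he)))

theorem top_lt_top_iff {e i b : ℕ} (he : e < D.n) (hi : i < D.k) (hb : b ≤ D.M) :
    D.top (D.owner e) (D.block e) < D.top i b ↔ D.owner e < i ∨ D.owner e = i ∧ D.block e < b := by
  rcases lt_trichotomy (D.owner e) i with hlt | rfl | hgt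
  · have hoffset : D.offset (D.owner e + 1) ≤ D.offset i := D.offset_mono hlt
    have := D.top_owner_lt he
    have := D.two_mul_offset_le_top i b
    simp only [hlt, true_or, iff_true]
    omega
  · simp only [lt_irrefl, true_and, false_or]
    exact ⟨fun h => not_le.1 fun hle => h.not_ge (D.top_mono _ hle), D.top_lt_top he⟩
  · have hoffset : D.offset (i + 1) ≤ D.offset (D.owner e) := D.offset_mono hgt
    have := D.top_le hi hb
    have := D.two_mul_offset_le_top (D.owner e) (D.block e)
    simp only [hgt.not_gt, hgt.ne', false_and, or_self, iff_false]
    omega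

theorem top_injective {e e' : ℕ} (he : e < D.n) (he' : e' < D.n)
    (h : D.top (D.owner e) (D.block e) = D.top (D.owner e') (D.block e')) :
    D.owner e = D.owner e' ∧ D.block e = D.block e' := by
  have hlt := D.top_lt_top_iff he (D.owner_lt e' he') (D.block_lt he').le
  have hgt := D.top_lt_top_iff he' (D.owner_lt e he) (D.block_lt he).le
  simp only [h, lt_irrefl, false_iff] at hlt hgt
  omega

end Family

theorem le_iff_div_lt_or_mod_le (B x y : ℕ) :
    x ≤ y ↔ x / B < y / B ∨ x / B = y / B ∧ x % B ≤ y % B := by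
  rcases lt_trichotomy (x / B) (y / B) with hlt | heq | hgt
  · simpa [hlt] using (Nat.lt_of_div_lt_div hlt).le
  · have hx := Nat.div_add_mod x B
    have hy := Nat.div_add_mod y B
    rw [heq] at hx
    omega
  · simpa [hgt.not_gt, hgt.ne'] using Nat.lt_of_div_lt_div hgt

theorem mod_pow_succ_le_iff (W m x y : ℕ) :
    x % W ^ (m + 1) ≤ y % W ^ (m + 1) ↔ x / W ^ m % W < y / W ^ m % W ∨
      x / W ^ m % W = y / W ^ m % W ∧ x % W ^ m ≤ y % W ^ m := by
  rw [le_iff_div_lt_or_mod_le (W ^ m), pow_succ]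
  simp only [Nat.mod_mul_right_div_self, Nat.mod_mul_right_mod]

theorem Family.before_iff_top (D : Family) {i x e : ℕ} (hi : i < D.k) (hx : x ≤ D.N)
    (he : e < D.n) :
    (D.owner e < i ∨ D.owner e = i ∧ D.elem e ≤ x) ↔
      (D.top (D.owner e) (D.block e) < D.top i (x / D.B) ∨
        (∃ e' < D.n, D.owner e' = i ∧ D.block e' = x / D.B) ∧
          D.top (D.owner e) (D.block e) = D.top i (x / D.B) ∧ D.elem e % D.B ≤ x % D.B) := by
  have hb : x / D.B < D.M := Nat.lt_succ_of_le (Nat.div_le_div_right hx)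
  have hmet : (∃ e' < D.n, D.owner e' = i ∧ D.block e' = x / D.B) ∧
      D.top (D.owner e) (D.block e) = D.top i (x / D.B) ↔
      D.owner e = i ∧ D.block e = x / D.B := by
    constructor
    · rintro ⟨⟨e', he', rfl, hblock⟩, htop⟩
      rw [← hblock] at htop ⊢
      exact D.top_injective he he' htop
    · rintro ⟨rfl, hblock⟩
      exact ⟨⟨e, he, rfl, hblock⟩, by rw [hblock]⟩
  rw [← and_assoc, hmet, D.top_lt_top_iff he hi hb.le, le_iff_div_lt_or_mod_le D.B (D.elem e)]
  change D.owner e < i ∨ D.owner e = i ∧ (D.block e < _ ∨ D.block e = _ ∧ _) ↔ _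
  tauto

/-! ## The trie of the elements inside the blocks -/

theorem size_eq_log2_add_one {v : ℕ} (hv : v ≠ 0) : v.size = v.log2 + 1 :=
  eq_of_forall_lt_iff fun m => by rw [Nat.lt_size, Nat.lt_succ_iff, Nat.le_log2 hv]

theorem select_rank {W v : ℕ} (hv : v < 2 ^ W) : select W v (rank v W) = v.size := by
  rcases eq_or_ne v 0 with rfl | hzero
  · simp [select, rank]
  have hbit := Nat.testBit_log2 hzero
  have hrank : rank v W = rank v v.log2 + 1 := by
    obtain ⟨c, hc⟩ := Nat.exists_eq_add_of_le (size_eq_log2_add_one hzero ▸ Nat.size_le.2 hv)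
    have hhigh : Nat.count (fun b => v.testBit (v.log2 + 1 + b) = true) c = 0 :=
      Nat.count_of_forall_not fun b _ => by
        simp [Nat.testBit_lt_two_pow (Nat.lt_log2_self.trans_le
          (Nat.pow_le_pow_right two_pos (Nat.le_add_right _ b)))]
    rw [rank, hc, Nat.count_add, hhigh, add_zero, Nat.count_succ, if_pos hbit, rank]
  rw [select, if_pos ⟨by omega, le_rfl⟩, hrank, Nat.add_sub_cancel, rank, Nat.nth_count hbit,
    size_eq_log2_add_one hzero]

/-- The bitmap of the node `u`, as far as the elements below `m` are concerned. -/
def bitsUpTo (v dg : ℕ → ℕ) (u : ℕ) : ℕ → ℕ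
  | 0 => 0
  | e + 1 => if v e = u then bitsUpTo v dg u e ||| 2 ^ dg e else bitsUpTo v dg u e

theorem testBit_bitsUpTo (v dg : ℕ → ℕ) (m u d : ℕ) :
    (bitsUpTo v dg u m).testBit d = true ↔ ∃ e < m, v e = u ∧ dg e = d := by
  induction m with
  | zero => simp [bitsUpTo]
  | succ m ih =>
    simp only [Nat.lt_succ_iff_lt_or_eq, or_and_right, exists_or, exists_eq_left, ← ih, bitsUpTo]
    split_ifs with h <;> simp [Nat.testBit_or, Nat.testBit_two_pow, h]

/-- The `j`-th of `tt` digits in base `W`, the most significant first. -/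
def digit (W tt j x : ℕ) : ℕ := x / W ^ (tt - 1 - j) % W

theorem digit_lt {W : ℕ} (hW : 0 < W) (tt j x : ℕ) : digit W tt j x < W := Nat.mod_lt _ hW

theorem mod_pow_sub_le_iff {W tt j : ℕ} (hj : j < tt) (x y : ℕ) :
    x % W ^ (tt - j) ≤ y % W ^ (tt - j) ↔ digit W tt j x < digit W tt j y ∨
      digit W tt j x = digit W tt j y ∧ x % W ^ (tt - (j + 1)) ≤ y % W ^ (tt - (j + 1)) := by
  obtain ⟨m, rfl⟩ := Nat.exists_eq_add_of_lt hj
  have hexp : j + m + 1 - 1 - j = m := by omega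
  rw [show j + m + 1 - j = m + 1 by omega, show j + m + 1 - (j + 1) = m by omega,
    mod_pow_succ_le_iff, digit, digit, hexp]

namespace Family

variable (D : Family)

/-- The number of the node of an element after `j` levels. -/
noncomputable def node (W tt : ℕ) : ℕ → ℕ → ℕ
  | 0, e => D.top (D.owner e) (D.block e)
  | j + 1, e => child W (fun u => bitsUpTo (node W tt j) (fun e => digit W tt j (D.elem e)) u D.n)
      (node W tt j e) (digit W tt j (D.elem e))

/-- The bitmap of a node of level `j`. -/
noncomputable def bits (W tt j u : ℕ) : ℕ :=
  bitsUpTo (D.node W tt j) (fun e => digit W tt j (D.elem e)) u D.n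

theorem node_succ (W tt j e : ℕ) : D.node W tt (j + 1) e =
    child W (D.bits W tt j) (D.node W tt j e) (digit W tt j (D.elem e)) := rfl

theorem trieLevel {W : ℕ} (hW : 0 < W) (tt j : ℕ) :
    TrieLevel W D.n (D.node W tt j) (fun e => digit W tt j (D.elem e)) (D.bits W tt j) :=
  ⟨fun _ _ => digit_lt hW _ _ _, fun u d => testBit_bitsUpTo _ _ D.n u d⟩

/-- After `j` levels, the elements counted for the query `(i, x)` are those in the nodes before
`r` and, if `ex` holds, the elements of the node `r` with at most the remaining digits of `x`. -/
def Reached (W tt i x j r : ℕ) (ex : Prop) : Prop :=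
  r ≤ 2 * D.n ∧ ∀ e < D.n, (D.owner e < i ∨ D.owner e = i ∧ D.elem e ≤ x) ↔
    (D.node W tt j e < r ∨ ex ∧ D.node W tt j e = r ∧ D.elem e % W ^ (tt - j) ≤ x % W ^ (tt - j))

/-- The first block from `b` on that is born by the time `τ`. -/
noncomputable def next (b τ : ℕ) : ℕ := sInf {s | b ≤ s ∧ D.birth s ≤ τ}

variable {D} {W tt i x j r e e' : ℕ} {ex : Prop}

theorem node_lt (hW : 0 < W) (he : e < D.n) : D.node W tt j e < 2 * D.n := by
  cases j with
  | zero => exact D.top_owner_lt_two_mul he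
  | succ j =>
    have L := D.trieLevel hW tt j
    calc D.node W tt (j + 1) e
        < firstChild W (D.bits W tt j) (D.node W tt j e + 1) :=
          child_lt_firstChild_succ (L.digit_lt e he) (L.testBit_digit he)
      _ ≤ D.n := L.firstChild_le _
      _ ≤ 2 * D.n := Nat.le_mul_of_pos_left _ two_pos

theorem node_injective (hW : 0 < W) (hB : D.B = W ^ tt) (hj : j ≤ tt) (he : e < D.n)
    (he' : e' < D.n) (h : D.node W tt j e = D.node W tt j e')
    (hmod : D.elem e % W ^ (tt - j) = D.elem e' % W ^ (tt - j)) : e = e' := by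
  induction j with
  | zero =>
    obtain ⟨howner, hblock⟩ := D.top_injective he he' h
    rw [Nat.sub_zero, ← hB] at hmod
    exact D.elem_inj e he e' he' howner (Nat.ext_div_mod hblock hmod)
  | succ j ih =>
    obtain ⟨hnode, hdigit⟩ := (D.trieLevel hW tt j).child_injective he he' h
    refine ih (by omega) hnode (le_antisymm ?_ ?_)
    · exact (mod_pow_sub_le_iff hj _ _).2 (.inr ⟨hdigit, hmod.le⟩)
    · exact (mod_pow_sub_le_iff hj _ _).2 (.inr ⟨hdigit.symm, hmod.ge⟩)

theorem reached_zero (hB : D.B = W ^ tt) (hi : i < D.k) (hx : x ≤ D.N) :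
    D.Reached W tt i x 0 (D.top i (x / D.B)) (∃ e < D.n, D.owner e = i ∧ D.block e = x / D.B) := by
  have hblock : x / D.B ≤ D.M := Nat.le_succ_of_le (Nat.div_le_div_right hx)
  refine ⟨(D.top_le hi hblock).trans (Nat.mul_le_mul_left 2 (D.offset_le hi)), fun e he => ?_⟩
  rw [D.before_iff_top hi hx he, Nat.sub_zero, ← hB]
  rfl

theorem Reached.succ [Decidable ex] (h : D.Reached W tt i x j r ex) (hW : 0 < W) (hj : j < tt) :
    D.Reached W tt i x (j + 1) (descend W (D.bits W tt j) r (digit W tt j x) ex)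
      (ex ∧ (D.bits W tt j r).testBit (digit W tt j x) = true) := by
  have L := D.trieLevel hW tt j
  have hx := digit_lt hW tt j x
  refine ⟨?_, fun e he => ?_⟩
  · calc descend W (D.bits W tt j) r (digit W tt j x) ex
        ≤ firstChild W (D.bits W tt j) (r + 1) := child_le_firstChild_succ (by split_ifs <;> omega)
      _ ≤ D.n := L.firstChild_le _
      _ ≤ 2 * D.n := Nat.le_mul_of_pos_left _ two_pos
  · rw [h.2 e he, mod_pow_sub_le_iff hj, L.before_iff_before_descend he hx ex]
    rfl

theorem Reached.answer [Decidable ex] (h : D.Reached W tt i x j r ex) (hW : 0 < W)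
    (hB : D.B = W ^ tt) (hj : j + 1 = tt) (hi : i < D.k) :
    (descend W (D.bits W tt j) r (digit W tt j x) ex +
      if ex ∧ (D.bits W tt j r).testBit (digit W tt j x) = true then 1 else 0) =
      D.offset i + #{e ∈ range D.n | D.owner e = i ∧ D.elem e ≤ x} := by
  rw [← D.card_filter_before hi x,
    ← (D.trieLevel hW tt j).card_before_descend _ r (digit_lt hW tt j x) ex]
  · refine congrArg _ (filter_congr fun e he => ?_)
    rw [(h.succ hW (by omega)).2 e (mem_range.1 he), ← hj, Nat.sub_self, pow_zero]
    simp [node_succ, Nat.mod_one]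
  · intro e he e' he' hnode hdigit
    refine node_injective hW hB (by omega) he he' hnode ?_
    simpa [← hj, digit] using hdigit

/-! ## The next block born by a given time -/

section

variable {b s τ : ℕ}

theorem next_spec (hb : b ≤ D.M) (τ : ℕ) :
    b ≤ D.next b τ ∧ D.next b τ ≤ D.M ∧ D.birth (D.next b τ) ≤ τ := by
  have hM : D.M ∈ {s | b ≤ s ∧ D.birth s ≤ τ} := ⟨hb, D.birth_M ▸ Nat.zero_le _⟩
  have hmem := Nat.sInf_mem ⟨_, hM⟩
  exact ⟨hmem.1, Nat.sInf_le hM, hmem.2⟩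

theorem lt_birth_of_lt_next (hs : b ≤ s) (hlt : s < D.next b τ) : τ < D.birth s :=
  not_le.1 fun h => Nat.notMem_of_lt_sInf hlt ⟨hs, h⟩

theorem next_eq_of (hs : b ≤ s) (hbirth : D.birth s ≤ τ)
    (hbefore : ∀ s', b ≤ s' → s' < s → τ < D.birth s') : D.next b τ = s :=
  IsLeast.csInf_eq ⟨⟨hs, hbirth⟩, fun s' ⟨hb, hs'⟩ =>
    not_lt.1 fun hlt => (hbefore s' hb hlt).not_ge hs'⟩

theorem next_self (h : D.birth b ≤ τ) : D.next b τ = b :=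
  next_eq_of le_rfl h fun _ hle hlt => absurd hlt hle.not_gt

theorem next_skip (hbs : b ≤ s) (hs : s ≤ D.M) (h : ∀ s', b ≤ s' → s' < s → τ < D.birth s') :
    D.next b τ = D.next s τ := by
  obtain ⟨hle, -, hbirth⟩ := next_spec hs τ
  refine next_eq_of (hbs.trans hle) hbirth fun s' hb hlt => ?_
  rcases lt_or_ge s' s with hs' | hs'
  · exact h s' hb hs'
  · exact lt_birth_of_lt_next hs' hlt

/-- If the time is not yet `τ` at the block `s` reached by a jump over the largest possible power
of two, then the rest of the way is covered by the ladder of `s`. -/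
theorem next_jump (hb : b < D.M) (hτ : τ < D.birth b) {j : ℕ} (hj : 2 ^ j ≤ D.birth b - τ)
    (hj' : D.birth b - τ < 2 ^ (j + 1)) (hs : s = D.next (b + 1) (D.birth b - 2 ^ j)) :
    D.birth s ≤ τ ∧ D.next b τ = s ∨
      τ < D.birth s ∧ s < D.M ∧ D.birth s - τ ≤ D.death s - D.birth s ∧
        D.next b τ = D.next (s + 1) τ := by
  obtain ⟨hbs, hsM, hbirth⟩ := next_spec (Nat.succ_le_of_lt hb) (D.birth b - 2 ^ j)
  have hbefore : ∀ s', b ≤ s' → s' < s → τ < D.birth s' := by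
    intro s' hle hlt
    rcases hle.eq_or_lt with rfl | hlt'
    · exact hτ
    · have := lt_birth_of_lt_next hlt' (hs ▸ hlt)
      omega
  rw [← hs] at hbs hsM hbirth
  rcases le_or_gt (D.birth s) τ with hle | hgt
  · exact .inl ⟨hle, next_eq_of (by omega) hle hbefore⟩
  have hne : s ≠ D.M := by
    rintro rfl
    simp [D.birth_M] at hgt
  have hdeath := (D.birth_le_death b).trans (D.death_mono (show b ≤ s by omega))
  rw [pow_succ] at hj'
  refine .inr ⟨hgt, by omega, by omega, next_skip (by omega) (by omega) fun s' hle hlt => ?_⟩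
  rcases Nat.lt_succ_iff_lt_or_eq.1 hlt with hlt' | rfl
  · exact hbefore s' hle hlt'
  · exact hgt

theorem alive_next (hb : b ≤ D.M) : D.alive (D.next b τ) τ = D.alive b τ :=
  D.alive_eq_of_lt_birth (next_spec hb τ).1 fun _ => lt_birth_of_lt_next

end

end Family

open WordRAM.Expr (reg const bin wordSize)

/-! ## The parameters of the instance in registers -/

notation "rSets" => 101
notation "rElems" => 102
notation "rBlocks" => 103
notation "rBlockSize" => 104
notation "rJumps" => 105
notation "rBlocksSucc" => 106
notation "rNodes" => 107
notation "rUniverse" => 108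

notation "aOffset" => 0
notation "aElem" => 1
notation "aOwner" => 2
notation "aFirst" => 3
notation "aLast" => 4
notation "aMeet" => 5
notation "aDeath" => 6
notation "aBirth" => 7
notation "aLife" => 8
notation "aFree" => 9
notation "aTop" => 10
notation "aJump" => 11
notation "aLadder" => 12
notation "aNode" => 13

/-- The machine is large enough for the family with blocks of size `W ^ tt`, and the read-only
region holds the input.  The universe size is not mentioned: in the answer to a query its cell
holds the index of the set. -/
structure Setting (D : Family) (G : Layout) (tt : ℕ) : Prop where
  B_eq : D.B = G.W ^ tt
  W_pos : 0 < G.W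
  tt_pos : 0 < tt
  arrays_eq : G.arrays = 14 + 2 * tt
  inputLen_eq : G.inputLen = 2 + D.k + D.n
  two_n_lt : 2 * D.n < G.len
  n_add_k_lt : D.n + D.k < G.len
  M_lt : D.M + 1 < G.len
  jumps_le : (D.M + 1) * D.k.size ≤ G.len
  le_cap : G.inputLen + 14 * G.len + 100 ≤ cap G.W
  N_lt : D.N < cap G.W
  B_lt : D.B < cap G.W
  inp_sets : G.inp 1 = D.k
  inp_card : ∀ i < D.k, G.inp (2 + i) = D.card i
  inp_elem : ∀ e < D.n, G.inp (2 + D.k + e) = D.elem e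

/-- The registers that are needed to access the tables hold the parameters of the instance. -/
structure Access (D : Family) (G : Layout) (σ : Store) : Prop where
  base : σ.regs rBase = G.inputLen
  blockSize : σ.regs rBlockSize = D.B
  jumps : σ.regs rJumps = D.k.size

/-- The registers from `100` on hold the parameters of the instance. -/
structure Consts (D : Family) (G : Layout) (σ : Store) : Prop extends Access D G σ where
  sets : σ.regs rSets = D.k
  elems : σ.regs rElems = D.n
  blocks : σ.regs rBlocks = D.M
  blocksSucc : σ.regs rBlocksSucc = D.M + 1
  nodes : σ.regs rNodes = 2 * D.n

section

variable {D : Family} {G : Layout} {σ σ' : Store}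

theorem Access.frame (h : Access D G σ) {c : Cmd} (hframe : c.Frame σ σ')
    (hc : ∀ r ∈ c.regs, r < 100) : Access D G σ' := by
  have hregs (r : ℕ) (hr : 100 ≤ r) : σ'.regs r = σ.regs r :=
    hframe.regs r fun hr' => (hc r hr').not_ge hr
  exact
    { base := (hregs _ (by decide)).trans h.base
      blockSize := (hregs _ (by decide)).trans h.blockSize
      jumps := (hregs _ (by decide)).trans h.jumps }

theorem Consts.frame (h : Consts D G σ) {c : Cmd} (hframe : c.Frame σ σ')
    (hc : ∀ r ∈ c.regs, r < 100) : Consts D G σ' := by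
  have hregs (r : ℕ) (hr : 100 ≤ r) : σ'.regs r = σ.regs r :=
    hframe.regs r fun hr' => (hc r hr').not_ge hr
  exact
    { toAccess := h.toAccess.frame hframe hc
      sets := (hregs _ (by decide)).trans h.sets
      elems := (hregs _ (by decide)).trans h.elems
      blocks := (hregs _ (by decide)).trans h.blocks
      blocksSucc := (hregs _ (by decide)).trans h.blocksSucc
      nodes := (hregs _ (by decide)).trans h.nodes }

end

/-- An expression for a power of the word size. -/
def powExpr : ℕ → Expr
  | 0 => const 1
  | m + 1 => powExpr m * wordSize

theorem powExpr_natEval (W : ℕ) (ρ : ℕ → ℕ) (m : ℕ) : (powExpr m).natEval W ρ = W ^ m := by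
  induction m with
  | zero => rfl
  | succ m ih => simp [powExpr, ih, pow_succ]

theorem powExpr_fits {W : ℕ} (ρ : ℕ → ℕ) {m : ℕ} (hW : 0 < W) (h : W ^ m < cap W) :
    (powExpr m).Fits W ρ := by
  induction m with
  | zero => simpa [powExpr] using h
  | succ m ih =>
    have hle : W ^ m ≤ W ^ (m + 1) := Nat.pow_le_pow_right hW (by omega)
    simp only [powExpr, Expr.mul_def, Expr.Fits, Op.Fits, powExpr_natEval, Expr.natEval]
    exact ⟨ih (by omega), trivial, by rwa [← pow_succ]⟩

/-- An expression for the number of binary digits of the content of a register. -/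
def sizeExpr (r : ℕ) : Expr := bin .select (reg r) (bin .rank (reg r) wordSize)

theorem sizeExpr_natEval {W : ℕ} {ρ : ℕ → ℕ} {r : ℕ} (h : ρ r < cap W) :
    (sizeExpr r).natEval W ρ = (ρ r).size := by
  simp [sizeExpr, select_rank h]

@[simp] theorem sizeExpr_fits {W : ℕ} {ρ : ℕ → ℕ} {r : ℕ} : (sizeExpr r).Fits W ρ := by
  simp [sizeExpr]

section Setup

local notation "rSet" => 2
local notation "rCard" => 3

/-- Reads the number of lists and the universe size. -/
def setupRead : Cmd :=
  .inp rSets (const 1) ;; .inp rUniverse (const 0) ;; .set rElems (const 0)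

/-- Adds the cardinalities. -/
def setupSum : Cmd :=
  .for rSet rSets (.inp rCard (const 2 + reg rSet) ;; .set rElems (reg rElems + reg rCard))

/-- Computes the parameters that depend on the sum of the cardinalities. -/
def setupParams (tt : ℕ) : Cmd :=
  .set rBase (const 2 + reg rSets + reg rElems) ;; .set rBlockSize (powExpr tt) ;;
  .set rBlocks (reg rUniverse / reg rBlockSize + const 1) ;; .set rJumps (sizeExpr rSets) ;;
  .set rBlocksSucc (reg rBlocks + const 1) ;; .set rNodes (reg rElems + reg rElems)

/-- Puts the parameters of the instance into their registers. -/
def setup (tt : ℕ) : Cmd := setupRead ;; setupSum ;; setupParams tt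

variable {D : Family} {G : Layout} {tt : ℕ} {σ : Store}

theorem setupRead_does (S : Setting D G tt) (hN : G.inp 0 = D.N) :
    Does G setupRead 6 σ fun σ' =>
      σ'.regs rSets = D.k ∧ σ'.regs rUniverse = D.N ∧ σ'.regs rElems = 0 := by
  have := S.le_cap
  have := S.inputLen_eq
  refine Does.of_wp_eq (((σ.put rSets D.k).put rUniverse D.N).put rElems 0) (by decide) ?_ (by simp)
  simp [setupRead, Cmd.wp, hN, S.inp_sets]
  omega

theorem setupSum_does (S : Setting D G tt) (hk : σ.regs rSets = D.k) (hn : σ.regs rElems = 0) :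
    Does G setupSum (18 * D.k + 6) σ fun σ' => σ'.regs rElems = D.n := by
  have hcap := S.le_cap
  have hlen := S.n_add_k_lt
  have hinp := S.inputLen_eq
  refine (Does.for (fun i σ' => σ'.regs rElems = D.offset i) (fun _ => 10) hk (by decide)
    (by decide) (by omega) (by simp [hn, D.offset_zero]) fun i hi σ' _ hr hsum => ?_).mono
    (by simp; omega) fun σ' _ h => h.trans D.offset_k
  have hle := D.offset_le (show i + 1 ≤ D.k from hi)
  have hsucc := D.offset_succ i
  refine Does.of_wp_eq ((σ'.put rCard (D.card i)).put rElems (D.offset (i + 1))) (by decide) ?_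
    (by simp)
  simp [Cmd.wp, hsum, hr, S.inp_card i hi, hsucc]
  omega

theorem setupParams_does (S : Setting D G tt) (hk : σ.regs rSets = D.k)
    (hN : σ.regs rUniverse = D.N) (hn : σ.regs rElems = D.n) :
    Does G (setupParams tt) (setupParams tt).cost σ (Consts D G) := by
  have hcap := S.le_cap
  have htwo := S.two_n_lt
  have hlen := S.n_add_k_lt
  have hinp := S.inputLen_eq
  have hM := S.M_lt
  have hB := S.B_eq ▸ S.B_lt
  have hblocks : D.N / D.B + 1 = D.M := rfl
  let σ' := ((σ.put rBase G.inputLen).put rBlockSize D.B).put rBlocks D.M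
  have hsize : (sizeExpr rSets).natEval G.W σ'.regs = D.k.size := by
    have hlt : σ'.regs rSets < cap G.W := by simp [σ', hk]; omega
    rw [sizeExpr_natEval hlt]
    simp [σ', hk]
  refine Does.of_wp_eq
    (((σ'.put rJumps D.k.size).put rBlocksSucc (D.M + 1)).put rNodes (D.n + D.n)) le_rfl ?_ ?_
  · simp [setupParams, Cmd.wp, hk, hN, hn, powExpr_natEval, powExpr_fits _ S.W_pos hB, hblocks,
      ← S.B_eq, ← hinp, σ', hsize]
    omega
  · exact
      { base := by simp [σ']
        blockSize := by simp [σ']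
        jumps := by simp
        sets := by simp [σ', hk]
        elems := by simp [σ', hn]
        blocks := by simp [σ']
        blocksSucc := by simp
        nodes := by simp [two_mul] }

theorem setup_does (S : Setting D G tt) (hN : G.inp 0 = D.N) :
    Does G (setup tt) (18 * D.k + 12 + (setupParams tt).cost) σ (Consts D G) := by
  refine ((setupRead_does S hN).seq fun σ₁ _ ⟨hk, hN, hn⟩ =>
    (setupSum_does S hk hn).seq fun σ₂ hframe hn => setupParams_does S ?_ ?_ hn).mono
    (by omega) fun _ _ h => h
  · rw [hframe.regs _ (by decide), hk]
  · rw [hframe.regs _ (by decide), hN]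

end Setup

/-! ## Reading the lists -/

section Lists

local notation "rPos" => 2
local notation "rSet" => 3
local notation "rCard" => 4
local notation "rCount" => 5
local notation "rValue" => 6

/-- Stores the offset of a list, and initializes the tables that are indexed by lists. -/
def listHead : Cmd :=
  .inp rCard (const 2 + reg rSet) ;; .st aOffset (reg rSet) (reg rPos) ;;
  .st aFirst (reg rSet) (reg rBlocks) ;;
  .st aFree (reg rSet) (reg rPos + reg rPos + const 1)

/-- Stores the value and the list of a position. -/
def listElem : Cmd :=
  .inp rValue (const 2 + reg rSets + reg rPos) ;; .st aElem (reg rPos) (reg rValue) ;;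
  .st aOwner (reg rPos) (reg rSet) ;; .set rPos (reg rPos + const 1)

/-- Stores a list. -/
def list : Cmd := listHead ;; .for rCount rCard listElem

/-- Stores all lists. -/
def lists : Cmd := .set rPos (const 0) ;; .for rSet rSets list

/-- The arrays hold the first `i` lists, up to position `e`.  The numbers below `2 * offset i + 1`
are taken by nodes of the tries of earlier lists and by the root. -/
structure ListsHeld (D : Family) (σ : Store) (i e : ℕ) : Prop where
  offset : σ.Holds aOffset i D.offset
  first : σ.Holds aFirst i fun _ => D.M
  free : σ.Holds aFree i fun i => 2 * D.offset i + 1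
  elem : σ.Holds aElem e D.elem
  owner : σ.Holds aOwner e D.owner

variable {D : Family} {G : Layout} {tt i e : ℕ} {σ : Store}

theorem listHead_does (S : Setting D G tt) (hσ : Consts D G σ) (hi : i < D.k)
    (hset : σ.regs rSet = i) (hpos : σ.regs rPos = D.offset i)
    (h : ListsHeld D σ i (D.offset i)) :
    Does G listHead 40 σ fun σ' =>
      σ'.regs rCard = D.card i ∧ ListsHeld D σ' (i + 1) (D.offset i) := by
  have := S.le_cap
  have := S.n_add_k_lt
  have := S.inputLen_eq
  have := S.arrays_eq
  have := D.offset_le hi.le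
  refine Does.of_wp_eq ((((σ.put rCard (D.card i)).write aOffset i (D.offset i)).write aFirst i
    D.M).write aFree i (D.offset i + D.offset i + 1)) (by decide) ?_ ⟨by simp, ?_⟩
  · simp [listHead, Cmd.wp, hset, hpos, hσ.base, hσ.blocks, S.inp_card i hi]
    omega
  · exact
      { offset := by simpa using h.offset.write_succ rfl
        first := by simpa using h.first.write_succ rfl
        free := by simpa using h.free.write_succ (by omega)
        elem := by simpa using h.elem
        owner := by simpa using h.owner }

theorem listElem_does (S : Setting D G tt) (hσ : Consts D G σ) (hi : i < D.k)
    (hset : σ.regs rSet = i) (hpos : σ.regs rPos = e) (hle : D.offset i ≤ e)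
    (hlt : e < D.offset (i + 1)) (h : ListsHeld D σ (i + 1) e) :
    Does G listElem 30 σ fun σ' => σ'.regs rPos = e + 1 ∧ ListsHeld D σ' (i + 1) (e + 1) := by
  have := S.le_cap
  have := S.n_add_k_lt
  have := S.inputLen_eq
  have := S.arrays_eq
  have := D.offset_le (show i + 1 ≤ D.k from hi)
  refine Does.of_wp_eq ((((σ.put rValue (D.elem e)).write aElem e (D.elem e)).write aOwner e
    i).put rPos (e + 1)) (by decide) ?_ ⟨by simp, ?_⟩
  · simp [listElem, Cmd.wp, hset, hpos, hσ.base, hσ.sets, S.inp_elem e (by omega)]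
    omega
  · exact
      { offset := by simpa using h.offset
        first := by simpa using h.first
        free := by simpa using h.free
        elem := by simpa using h.elem.write_succ rfl
        owner := by simpa using h.owner.write_succ (D.owner_eq hi hle hlt).symm }

theorem list_does (S : Setting D G tt) (hσ : Consts D G σ) (hi : i < D.k)
    (hset : σ.regs rSet = i) (hpos : σ.regs rPos = D.offset i)
    (h : ListsHeld D σ i (D.offset i)) :
    Does G list (46 + 38 * D.card i) σ fun σ' =>
      σ'.regs rPos = D.offset (i + 1) ∧ ListsHeld D σ' (i + 1) (D.offset (i + 1)) := by
  have hsucc := D.offset_succ i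
  refine ((listHead_does S hσ hi hset hpos h).seq fun σ₁ hframe₁ ⟨hcard, h₁⟩ =>
    Does.for (fun r σ' => σ'.regs rPos = D.offset i + r ∧
      ListsHeld D σ' (i + 1) (D.offset i + r)) (fun _ => 30) hcard (by decide) (by decide) ?_ ?_
    fun r hr σ₂ hframe₂ _ ⟨hpos₂, h₂⟩ => ?_).mono (by simp; omega)
    fun σ' _ h => hsucc ▸ h
  · have := D.offset_le (show i + 1 ≤ D.k from hi)
    have := S.le_cap
    have := S.n_add_k_lt
    omega
  · refine ⟨?_, h₁.offset, h₁.first, h₁.free, h₁.elem, h₁.owner⟩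
    simp [hframe₁.regs 2 (by decide), hpos]
  · have hσ₂ := (hσ.frame hframe₁ (by decide)).frame hframe₂ (by decide)
    have hset₂ : σ₂.regs rSet = i := by
      rw [hframe₂.regs _ (by decide), hframe₁.regs _ (by decide), hset]
    refine (listElem_does S hσ₂ hi hset₂ hpos₂ (by omega) (by omega) h₂).mono le_rfl
      fun σ' _ ⟨hpos', h'⟩ => ⟨?_, h'.offset, h'.first, h'.free, h'.elem, h'.owner⟩
    simpa [add_assoc] using hpos'

theorem lists_does (S : Setting D G tt) (hσ : Consts D G σ) :
    Does G lists (54 * D.k + 38 * D.n + 8) σ fun σ' => ListsHeld D σ' D.k D.n := by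
  have hcap := S.le_cap
  have hlen := S.n_add_k_lt
  have hinit : Does G (.set rPos (const 0)) 2 σ fun σ' => σ'.regs rPos = 0 :=
    Does.set (by simp; omega) (by simp)
  have htime : ∑ i ∈ range D.k, (46 + 38 * D.card i + 8) = 54 * D.k + 38 * D.n := by
    simp only [← D.sum_card, sum_add_distrib, ← mul_sum, sum_const, card_range, smul_eq_mul]
    ring
  refine (hinit.seq fun σ₁ hframe₁ hpos => Does.for (fun i σ' => σ'.regs rPos = D.offset i ∧
    ListsHeld D σ' i (D.offset i)) (fun i => 46 + 38 * D.card i)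
    (hσ.frame hframe₁ (by decide)).sets (by decide) (by decide) (by omega) ?_
    fun i hi σ₂ hframe₂ hset ⟨hpos₂, h₂⟩ => ?_).mono (by omega) fun σ' _ h => D.offset_k ▸ h.2
  · simp only [D.offset_zero]
    refine ⟨by simpa using hpos, ?_, ?_, ?_, ?_, ?_⟩ <;> exact Store.holds_zero _ _ _
  · have hσ₂ := (hσ.frame hframe₁ (by decide)).frame hframe₂ (by decide)
    refine (list_does S hσ₂ hi hset hpos₂ h₂).mono le_rfl
      fun σ' _ ⟨hpos', h'⟩ => ⟨?_, h'.offset, h'.first, h'.free, h'.elem, h'.owner⟩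
    simpa using hpos'

end Lists

/-! ## First blocks, births and deaths -/

section Meets

local notation "rPos" => 2
local notation "rValue" => 3
local notation "rBlock" => 4
local notation "rOwner" => 5
local notation "rFirst" => 6
local notation "rMeet" => 7

/-- Loads the block and the list of a position, and what is known about them so far. -/
def meetLoad : Cmd :=
  .ld rValue aElem (reg rPos) ;; .set rBlock (reg rValue / reg rBlockSize) ;;
  .ld rOwner aOwner (reg rPos) ;; .ld rFirst aFirst (reg rOwner) ;; .ld rMeet aMeet (reg rBlock)

/-- Improves the first block of a list. -/
def firstUpdate : Cmd :=
  .ite (bin .lt (reg rBlock) (reg rFirst)) (.st aFirst (reg rOwner) (reg rBlock)) .skip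

/-- Stores the first list that meets a block. -/
def meetUpdate : Cmd := .ite (reg rMeet) .skip (.st aMeet (reg rBlock) (reg rOwner + const 1))

/-- Computes the first block of every list and the first list of every block. -/
def meets : Cmd :=
  .for rPos rElems (meetLoad ;; firstUpdate ;; meetUpdate) ;; .st aMeet (reg rBlocks) (const 1)

variable {D : Family} {G : Layout} {tt e : ℕ} {σ : Store}

theorem meetLoad_does (S : Setting D G tt) (hσ : Consts D G σ) (helem : σ.Holds aElem D.n D.elem)
    (howner : σ.Holds aOwner D.n D.owner) (he : e < D.n) (hpos : σ.regs rPos = e)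
    (hfirst : σ.Holds aFirst D.k (D.firstUpTo · e))
    (hmeet : σ.Holds aMeet D.M (D.meetUpTo · e)) :
    Does G meetLoad 42 σ fun σ' =>
      σ'.regs rBlock = D.block e ∧ σ'.regs rOwner = D.owner e ∧
      σ'.regs rFirst = D.firstUpTo (D.owner e) e ∧ σ'.regs rMeet = D.meetUpTo (D.block e) e := by
  have := S.two_n_lt
  have := S.n_add_k_lt
  have := S.M_lt
  have := S.arrays_eq
  have hlt := D.owner_lt e he
  have hblock_lt := D.block_lt he
  have hblock : D.elem e / D.B = D.block e := rfl
  refine Does.of_wp_eq (((((σ.put rValue (D.elem e)).put rBlock (D.block e)).put rOwner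
    (D.owner e)).put rFirst (D.firstUpTo (D.owner e) e)).put rMeet (D.meetUpTo (D.block e) e))
    (by decide) ?_ (by simp)
  simp [meetLoad, Cmd.wp, hpos, helem e he, howner e he, hblock, hσ.base, hσ.blockSize,
    hfirst _ hlt, hmeet _ hblock_lt]
  omega

theorem firstUpdate_does (S : Setting D G tt) (hσ : Consts D G σ) (he : e < D.n)
    (hblock : σ.regs rBlock = D.block e) (howner : σ.regs rOwner = D.owner e)
    (hreg : σ.regs rFirst = D.firstUpTo (D.owner e) e)
    (hfirst : σ.Holds aFirst D.k (D.firstUpTo · e)) :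
    Does G firstUpdate 14 σ fun σ' => σ'.Holds aFirst D.k (D.firstUpTo · (e + 1)) := by
  have := S.n_add_k_lt
  have := S.arrays_eq
  have hlt := D.owner_lt e he
  by_cases hless : D.block e < D.firstUpTo (D.owner e) e
  · refine Does.of_wp_eq (σ.write aFirst (D.owner e) (D.block e)) (by decide) ?_
      (hfirst.write (fun i _ hne => ?_) fun _ => ?_)
    · simp [firstUpdate, Cmd.wp, hblock, howner, hreg, hless, hσ.base]
      omega
    · simp [Family.firstUpTo, Ne.symm hne]
    · simp [Family.firstUpTo, hless]
  · refine Does.of_wp_eq σ (by decide) ?_ fun i hi => (hfirst i hi).trans ?_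
    · simp [firstUpdate, Cmd.wp, hblock, hreg, hless]
    · change D.firstUpTo i e = D.firstUpTo i (e + 1)
      rw [Family.firstUpTo, if_neg]
      rintro ⟨rfl, h⟩
      exact hless h

theorem meetUpdate_does (S : Setting D G tt) (hσ : Consts D G σ) (he : e < D.n)
    (hblock : σ.regs rBlock = D.block e) (howner : σ.regs rOwner = D.owner e)
    (hreg : σ.regs rMeet = D.meetUpTo (D.block e) e)
    (hmeet : σ.Holds aMeet D.M (D.meetUpTo · e)) :
    Does G meetUpdate 14 σ fun σ' => σ'.Holds aMeet D.M (D.meetUpTo · (e + 1)) := by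
  have := S.le_cap
  have := S.n_add_k_lt
  have := S.M_lt
  have := S.arrays_eq
  have hlt := D.owner_lt e he
  have hblock_lt := D.block_lt he
  by_cases hzero : D.meetUpTo (D.block e) e = 0
  · refine Does.of_wp_eq (σ.write aMeet (D.block e) (D.owner e + 1)) (by decide) ?_
      (hmeet.write (fun b _ hne => ?_) fun _ => ?_)
    · simp [meetUpdate, Cmd.wp, hblock, howner, hreg, hzero, hσ.base]
      omega
    · simp [Family.meetUpTo, Ne.symm hne]
    · simp [Family.meetUpTo, hzero]
  · refine Does.of_wp_eq σ (by decide) ?_ fun b hb => (hmeet b hb).trans ?_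
    · simp [meetUpdate, Cmd.wp, hreg, hzero]
    · change D.meetUpTo b e = D.meetUpTo b (e + 1)
      rw [Family.meetUpTo, if_neg]
      rintro ⟨rfl, h⟩
      exact hzero h

theorem meetLoop_does (S : Setting D G tt) (hσ : Consts D G σ)
    (helem : σ.Holds aElem D.n D.elem) (howner : σ.Holds aOwner D.n D.owner)
    (hfirst : σ.Holds aFirst D.k fun _ => D.M) (hmeet : σ.Holds aMeet D.M fun _ => 0) :
    Does G (.for rPos rElems (meetLoad ;; firstUpdate ;; meetUpdate)) (78 * D.n + 6) σ fun σ' =>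
      σ'.Holds aFirst D.k D.first ∧ σ'.Holds aMeet D.M (D.meetUpTo · D.n) := by
  have hcap := S.le_cap
  have hlen := S.n_add_k_lt
  refine (Does.for (fun e σ' => σ'.Holds aFirst D.k (D.firstUpTo · e) ∧
    σ'.Holds aMeet D.M (D.meetUpTo · e)) (fun _ => 42 + (14 + 14)) hσ.elems (by decide)
    (by decide) (by omega) ⟨hfirst, hmeet⟩ fun e he σ₁ hframe₁ hpos ⟨hfirst₁, hmeet₁⟩ => ?_).mono
    (by simp; omega) fun _ _ h => h
  have hσ₁ := hσ.frame hframe₁ (by decide)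
  refine (meetLoad_does S hσ₁ (hframe₁.holds (by decide) helem) (hframe₁.holds (by decide) howner)
    he hpos hfirst₁ hmeet₁).seq fun σ₂ hframe₂ ⟨hblock, howner, hregF, hregM⟩ => ?_
  have hσ₂ := hσ₁.frame hframe₂ (by decide)
  refine (firstUpdate_does S hσ₂ he hblock howner hregF
    (hframe₂.holds (by decide) hfirst₁)).seq fun σ₃ hframe₃ hfirst₃ => ?_
  refine (meetUpdate_does S (hσ₂.frame hframe₃ (by decide)) he ?_ ?_ ?_
    (hframe₃.holds (by decide) (hframe₂.holds (by decide) hmeet₁))).mono le_rfl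
    fun σ' hframe' hmeet' => ⟨hframe'.holds (by decide) hfirst₃, hmeet'⟩
  · rw [hframe₃.regs _ (by decide), hblock]
  · rw [hframe₃.regs _ (by decide), howner]
  · rw [hframe₃.regs _ (by decide), hregM]

theorem meets_does (S : Setting D G tt) (hσ : Consts D G σ)
    (helem : σ.Holds aElem D.n D.elem) (howner : σ.Holds aOwner D.n D.owner)
    (hfirst : σ.Holds aFirst D.k fun _ => D.M) (hmeet : σ.Holds aMeet D.M fun _ => 0) :
    Does G meets (78 * D.n + 6 + 9) σ fun σ' =>
      σ'.Holds aFirst D.k D.first ∧ σ'.Holds aMeet (D.M + 1) D.meet := by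
  have := S.le_cap
  have := S.M_lt
  have := S.arrays_eq
  refine (meetLoop_does S hσ helem howner hfirst hmeet).seq fun σ₁ hframe₁ ⟨hfirst₁, hmeet₁⟩ => ?_
  have hσ₁ := hσ.frame hframe₁ (by decide)
  refine Does.of_wp_eq (σ₁.write aMeet D.M 1) (by decide) ?_ ⟨by simpa using hfirst₁, ?_⟩
  · simp [Cmd.wp, hσ₁.base, hσ₁.blocks]
    omega
  · refine Store.Holds.write_succ (fun b hb => ?_) (by simp [Family.meet])
    rw [hmeet₁ b hb, Family.meet, if_neg hb.ne]

end Meets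

section Lasts

local notation "rSet" => 2
local notation "rFirst" => 3

/-- Computes, for every block, the last list that starts in it. -/
def lasts : Cmd :=
  .for rSet rSets (.ld rFirst aFirst (reg rSet) ;; .st aLast (reg rFirst) (reg rSet + const 1))

variable {D : Family} {G : Layout} {tt : ℕ} {σ : Store}

theorem lasts_does (S : Setting D G tt) (hσ : Consts D G σ)
    (hfirst : σ.Holds aFirst D.k D.first) (hlast : σ.Holds aLast D.M fun _ => 0) :
    Does G lasts (27 * D.k + 6) σ fun σ' => σ'.Holds aLast D.M (D.lastUpTo · D.k) := by
  have hcap := S.le_cap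
  have hlen := S.n_add_k_lt
  have hM := S.M_lt
  have harrays := S.arrays_eq
  refine (Does.for (fun j σ' => σ'.Holds aLast D.M (D.lastUpTo · j)) (fun _ => 19) hσ.sets
    (by decide) (by decide) (by omega) hlast fun j hj σ₁ hframe₁ hset hlast₁ => ?_).mono
    (by simp; omega) fun _ _ h => h
  have hσ₁ := hσ.frame hframe₁ (by decide)
  have hfirst₁ := hframe₁.holds (by decide) hfirst j hj
  have hlt := D.first_lt hj
  refine Does.of_wp_eq ((σ₁.put rFirst (D.first j)).write aLast (D.first j) (j + 1)) (by decide)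
    ?_ ?_
  · simp [Cmd.wp, hset, hfirst₁, hσ₁.base]
    omega
  · simp only [Store.put_write, Store.holds_put]
    refine hlast₁.write (fun b _ hne => ?_) fun _ => ?_
    · simp [Family.lastUpTo, Ne.symm hne]
    · simp [Family.lastUpTo]

end Lasts

section Births

local notation "rDeath" => 2
local notation "rLife" => 3
local notation "rBlock" => 4
local notation "rMeet" => 5
local notation "rBirth" => 6
local notation "rLast" => 7

/-- Computes the birth of a block from its death. -/
def birthSet : Cmd :=
  .ld rMeet aMeet (reg rBlock) ;;
  .ite (reg rMeet)
    (.ite (bin .lt (reg rDeath) (reg rMeet)) (.set rBirth (reg rDeath))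
      (.set rBirth (reg rMeet - const 1)))
    (.set rBirth (reg rDeath))

/-- Stores the life span of a block. -/
def lifeStore : Cmd :=
  .st aDeath (reg rBlock) (reg rDeath) ;; .st aBirth (reg rBlock) (reg rBirth) ;;
  .st aLife (reg rBlock) (reg rLife) ;; .set rLife (reg rLife + (reg rDeath - reg rBirth))

/-- Passes from the death of a block to the death of the next one. -/
def deathStep : Cmd :=
  .ld rLast aLast (reg rBlock) ;;
  .ite (bin .lt (reg rDeath) (reg rLast)) (.set rDeath (reg rLast)) .skip

/-- Computes the life spans of all blocks, including the sentinel. -/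
def births : Cmd :=
  (.set rDeath (const 0) ;; .set rLife (const 0)) ;;
  .for rBlock rBlocksSucc (birthSet ;; lifeStore ;; deathStep)

/-- The arrays hold the life spans of the first `b` blocks. -/
structure BirthsHeld (D : Family) (σ : Store) (b : ℕ) : Prop where
  death : σ.Holds aDeath b D.death
  birth : σ.Holds aBirth b D.birth
  life : σ.Holds aLife b D.life

variable {D : Family} {G : Layout} {tt b : ℕ} {σ : Store}

theorem birthSet_does (S : Setting D G tt) (hσ : Consts D G σ)
    (hmeet : σ.Holds aMeet (D.M + 1) D.meet) (hb : b < D.M + 1) (hblock : σ.regs rBlock = b)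
    (hdeath : σ.regs rDeath = D.death b) :
    Does G birthSet 25 σ fun σ' => σ'.regs rBirth = D.birth b := by
  have := S.le_cap
  have := S.M_lt
  have := S.n_add_k_lt
  have := S.arrays_eq
  have := D.death_le b
  have hbirth : D.birth b = if D.meet b = 0 then D.death b else
    if D.death b < D.meet b then D.death b else D.meet b - 1 := by
    unfold Family.birth
    split_ifs <;> omega
  refine Does.of_wp_eq ((σ.put rMeet (D.meet b)).put rBirth (D.birth b)) (by decide) ?_ (by simp)
  simp [birthSet, Cmd.wp, hblock, hmeet b hb, hdeath, hσ.base, hbirth]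
  split_ifs <;> simp_all <;> omega

theorem lifeStore_does (S : Setting D G tt) (hσ : Consts D G σ) (hb : b < D.M + 1)
    (hblock : σ.regs rBlock = b) (hdeath : σ.regs rDeath = D.death b)
    (hbirth : σ.regs rBirth = D.birth b) (hlife : σ.regs rLife = D.life b)
    (h : BirthsHeld D σ b) :
    Does G lifeStore 33 σ fun σ' => σ'.regs rLife = D.life (b + 1) ∧ BirthsHeld D σ' (b + 1) := by
  have := S.le_cap
  have := S.M_lt
  have := S.n_add_k_lt
  have := S.arrays_eq
  have := D.death_le b
  have hle := D.birth_le_death b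
  have hsucc := D.life_succ b
  have := D.life_le (b := b + 1) (by omega)
  refine Does.of_wp_eq ((((σ.write aDeath b (D.death b)).write aBirth b (D.birth b)).write aLife b
    (D.life b)).put rLife (D.life (b + 1))) (by decide) ?_ ⟨by simp, ?_⟩
  · simp [lifeStore, Cmd.wp, hblock, hdeath, hbirth, hlife, hσ.base, hsucc]
    omega
  · exact
      { death := by simpa using h.death.write_succ rfl
        birth := by simpa using h.birth.write_succ rfl
        life := by simpa using h.life.write_succ rfl }

theorem deathStep_does (S : Setting D G tt) (hσ : Consts D G σ)
    (hlast : σ.Holds aLast D.M (D.lastUpTo · D.k)) (hb : b < D.M + 1)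
    (hblock : σ.regs rBlock = b) (hdeath : σ.regs rDeath = D.death b) :
    Does G deathStep 15 σ fun σ' => b < D.M → σ'.regs rDeath = D.death (b + 1) := by
  have := S.M_lt
  have := S.arrays_eq
  have hsucc : D.death (b + 1) = max (D.death b) (D.lastUpTo b D.k) := rfl
  refine Does.block (by decide) fun Q' hQ => ?_
  simp only [deathStep, Cmd.wp]
  refine ⟨by simp [hblock, hσ.base]; omega, by simp, fun hless => ⟨trivial, hQ _ fun hlt => ?_⟩,
    fun hless => hQ _ fun hlt => ?_⟩
  all_goals
    simp only [Expr.natEval, Op.natEval, hblock, hdeath, hlast b hlt, Store.put_regs,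
      Nat.reduceEqDiff, ↓reduceIte, ne_eq, ite_eq_right_iff, one_ne_zero, imp_false, not_lt,
      not_le] at hless ⊢
    omega

theorem births_does (S : Setting D G tt) (hσ : Consts D G σ)
    (hmeet : σ.Holds aMeet (D.M + 1) D.meet) (hlast : σ.Holds aLast D.M (D.lastUpTo · D.k)) :
    Does G births (81 * (D.M + 1) + 10) σ fun σ' => BirthsHeld D σ' (D.M + 1) := by
  have hcap := S.le_cap
  have hM := S.M_lt
  have hinit : Does G (.set rDeath (const 0) ;; .set rLife (const 0)) 4 σ fun σ' =>
      σ'.regs rDeath = 0 ∧ σ'.regs rLife = 0 := by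
    refine Does.of_wp_eq ((σ.put rDeath 0).put rLife 0) (by decide) ?_ (by simp)
    simp [Cmd.wp]
    omega
  refine (hinit.seq fun σ₁ hframe₁ ⟨hdeath₁, hlife₁⟩ => Does.for (fun b σ' =>
    (b < D.M + 1 → σ'.regs rDeath = D.death b) ∧ σ'.regs rLife = D.life b ∧ BirthsHeld D σ' b)
    (fun _ => 25 + (33 + 15)) (hσ.frame hframe₁ (by decide)).blocksSucc (by decide) (by decide)
    (by omega) ?_ fun b hb σ₂ hframe₂ hblock ⟨hdeath₂, hlife₂, h₂⟩ => ?_).mono (by simp; omega)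
    fun _ _ h => h.2.2
  · refine ⟨by simp [hdeath₁, Family.death], by simp [hlife₁, Family.life], ?_, ?_, ?_⟩ <;>
      exact Store.holds_zero _ _ _
  have hσ₂ := (hσ.frame hframe₁ (by decide)).frame hframe₂ (by decide)
  have hmeet₂ := hframe₂.holds (by decide) (hframe₁.holds (by decide) hmeet)
  have hlast₂ := hframe₂.holds (by decide) (hframe₁.holds (by decide) hlast)
  refine (birthSet_does S hσ₂ hmeet₂ hb hblock (hdeath₂ hb)).seq fun σ₃ hframe₃ hbirth => ?_
  have hσ₃ := hσ₂.frame hframe₃ (by decide)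
  have hblock₃ := (hframe₃.regs rBlock (by decide)).trans hblock
  have hdeath₃ := (hframe₃.regs rDeath (by decide)).trans (hdeath₂ hb)
  have hlife₃ := (hframe₃.regs rLife (by decide)).trans hlife₂
  refine (lifeStore_does S hσ₃ hb hblock₃ hdeath₃ hbirth hlife₃
    ⟨hframe₃.holds (by decide) h₂.death, hframe₃.holds (by decide) h₂.birth,
      hframe₃.holds (by decide) h₂.life⟩).seq fun σ₄ hframe₄ ⟨hlife₄, h₄⟩ => ?_
  refine (deathStep_does S (hσ₃.frame hframe₄ (by decide))
    (hframe₄.holds (by decide) (hframe₃.holds (by decide) hlast₂)) hb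
    ((hframe₄.regs _ (by decide)).trans hblock₃)
    ((hframe₄.regs _ (by decide)).trans hdeath₃)).mono le_rfl fun σ' hframe' hdeath' => ?_
  refine ⟨fun hlt => by simpa using hdeath' (by omega), ?_, hframe'.holds (by decide) h₄.death,
    hframe'.holds (by decide) h₄.birth, hframe'.holds (by decide) h₄.life⟩
  simpa using (hframe'.regs rLife (by decide)).trans hlife₄

end Births

/-! ## Numbering the top nodes -/

section Family

variable (D : Family)

theorem Family.life_add_le {b b' : ℕ} (h : b < b') :
    D.life b + (D.death b - D.birth b) ≤ D.life b' :=
  (D.life_succ b).ge.trans (D.life_mono h)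

theorem Family.sum_life_mul (a c m : ℕ) :
    ∑ b ∈ range m, (a * (D.death b - D.birth b) + c) = a * D.life m + c * m := by
  rw [sum_add_distrib, ← mul_sum, sum_const, card_range, smul_eq_mul, mul_comm m, Family.life]

/-- The number of the top node that is assigned to the block `b` in the list `i` if it is alive
there. -/
def Family.free (b i : ℕ) : ℕ := 2 * D.offset i + 1 + D.alive b i

end Family

section Tops

local notation "rBlock" => 2
local notation "rBirth" => 3
local notation "rSpan" => 4
local notation "rLife" => 5
local notation "rIndex" => 6
local notation "rNode" => 7

/-- Loads the birth and the length of the life span of a block. -/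
def lifeLoad : Cmd :=
  .ld rBirth aBirth (reg rBlock) ;; .ld rSpan aDeath (reg rBlock) ;;
  .set rSpan (reg rSpan - reg rBirth) ;; .ld rLife aLife (reg rBlock)

/-- Assigns the next free top node of a list to a block. -/
def topAssign : Cmd :=
  .ld rNode aFree (reg rBirth + reg rIndex) ;; .st aTop (reg rLife + reg rIndex) (reg rNode) ;;
  .st aFree (reg rBirth + reg rIndex) (reg rNode + const 1)

/-- Assigns top nodes to all blocks in all lists in which they are alive. -/
def tops : Cmd := .for rBlock rBlocksSucc (lifeLoad ;; .for rIndex rSpan topAssign)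

/-- Top nodes have been assigned to the blocks before `b`, and to the block `b` in the first `r`
lists in which it is alive. -/
structure TopsHeld (D : Family) (σ : Store) (b r : ℕ) : Prop where
  free : σ.Holds aFree D.k fun i =>
    D.free b i + if D.birth b ≤ i ∧ i < D.birth b + r then 1 else 0
  current : σ.HoldsFrom aTop (D.life b) r fun r' => D.free b (D.birth b + r')
  before : ∀ b' < b, σ.HoldsFrom aTop (D.life b') (D.death b' - D.birth b') fun r' =>
    D.free b' (D.birth b' + r')

variable {D : Family} {G : Layout} {tt b r : ℕ} {σ σ' : Store}

theorem TopsHeld.of_frame {c : Cmd} (h : TopsHeld D σ b r) (hframe : c.Frame σ σ')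
    (hfree : aFree ∉ c.arrs) (htop : aTop ∉ c.arrs) : TopsHeld D σ' b r :=
  ⟨hframe.holds hfree h.free, hframe.holdsFrom htop h.current,
    fun b' hb' => hframe.holdsFrom htop (h.before b' hb')⟩

theorem TopsHeld.put (h : TopsHeld D σ b r) (q v : ℕ) : TopsHeld D (σ.put q v) b r :=
  ⟨h.free, h.current, h.before⟩

theorem TopsHeld.zero (hfree : σ.Holds aFree D.k fun i => 2 * D.offset i + 1) :
    TopsHeld D σ 0 0 where
  free i hi := by
    rw [hfree i hi]
    simp only [Family.free, Family.alive, range_zero, filter_empty, card_empty]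
    split_ifs <;> omega
  current := σ.holdsFrom_zero _ _ _
  before := nofun

theorem TopsHeld.succ (h : TopsHeld D σ b (D.death b - D.birth b)) : TopsHeld D σ (b + 1) 0 where
  free i hi := by
    have hfree := h.free i hi
    rw [Nat.add_sub_cancel' (D.birth_le_death b)] at hfree
    simp only [hfree, Family.free, D.alive_succ]
    split_ifs <;> omega
  current := σ.holdsFrom_zero _ _ _
  before b' hb' := by
    rcases Nat.lt_succ_iff_lt_or_eq.1 hb' with hlt | rfl
    · exact h.before b' hlt
    · exact h.current

theorem lifeLoad_does (S : Setting D G tt) (hσ : Consts D G σ)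
    (hheld : BirthsHeld D σ (D.M + 1)) (hb : b < D.M + 1) (hblock : σ.regs rBlock = b) :
    Does G lifeLoad 28 σ fun σ' => σ'.regs rBirth = D.birth b ∧
      σ'.regs rSpan = D.death b - D.birth b ∧ σ'.regs rLife = D.life b := by
  have := S.le_cap
  have := S.n_add_k_lt
  have := S.M_lt
  have := S.arrays_eq
  have := D.birth_le_death b
  have := D.death_le b
  refine Does.of_wp_eq ((((σ.put rBirth (D.birth b)).put rSpan (D.death b)).put rSpan
    (D.death b - D.birth b)).put rLife (D.life b)) (by decide) ?_ (by simp)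
  simp [lifeLoad, Cmd.wp, hblock, hheld.birth b hb, hheld.death b hb, hheld.life b hb, hσ.base]
  omega

theorem topAssign_does (S : Setting D G tt) (hσ : Consts D G σ) (hb : b < D.M + 1)
    (hr : r < D.death b - D.birth b) (hindex : σ.regs rIndex = r)
    (hbirth : σ.regs rBirth = D.birth b) (hlife : σ.regs rLife = D.life b)
    (h : TopsHeld D σ b r) :
    Does G topAssign 34 σ fun σ' => TopsHeld D σ' b (r + 1) := by
  have := S.le_cap
  have := S.two_n_lt
  have := S.n_add_k_lt
  have := S.M_lt
  have := S.arrays_eq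
  have := D.death_le b
  have hspan := D.life_succ b
  have := D.life_le (show b + 1 ≤ D.M + 1 from hb)
  have hfree : σ.arr aFree (D.birth b + r) = D.free b (D.birth b + r) := by
    simpa using h.free (D.birth b + r) (by omega)
  have hlt : D.free b (D.birth b + r) + 1 < cap G.W := by
    have : D.alive b (D.birth b + r) ≤ b := (card_filter_le _ _).trans (card_range b).le
    have := D.offset_le (show D.birth b + r ≤ D.k by omega)
    unfold Family.free
    omega
  refine Does.of_wp_eq (((σ.write aTop (D.life b + r) (D.free b (D.birth b + r))).write aFree
    (D.birth b + r) (D.free b (D.birth b + r) + 1)).put rNode (D.free b (D.birth b + r)))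
    (by decide) ?_ ⟨?_, ?_, fun b' hb' => ?_⟩
  · simp [topAssign, Cmd.wp, hindex, hbirth, hlife, hσ.base, hfree]
    omega
  · simp only [Store.holds_put]
    refine Store.Holds.write (f := _) (by simpa using h.free) (fun i _ hne => ?_) fun _ => ?_
    · congr 2
      simp only [eq_iff_iff]
      omega
    · rw [if_pos (by omega)]
  · simpa using h.current.write_succ rfl
  · have := D.life_add_le hb'
    simpa using (h.before b' hb').write_of_disjoint (.inr (by omega))

theorem tops_does (S : Setting D G tt) (hσ : Consts D G σ)
    (hheld : BirthsHeld D σ (D.M + 1)) (hfree : σ.Holds aFree D.k fun i => 2 * D.offset i + 1) :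
    Does G tops (42 * (D.M + 1) + 42 * (D.n + D.k) + 6) σ fun σ' => TopsHeld D σ' (D.M + 1) 0 := by
  have hcap := S.le_cap
  have hlen := S.n_add_k_lt
  have hM := S.M_lt
  have hlife_le := D.life_le le_rfl
  refine (Does.for (fun b σ' => TopsHeld D σ' b 0)
    (fun b => 28 + (42 * (D.death b - D.birth b) + 6)) hσ.blocksSucc (by decide) (by decide)
    (by omega) ((TopsHeld.zero hfree).put _ _) fun b hb σ₁ hframe₁ hblock h₁ => ?_).mono
    ?_ fun _ _ h => h
  · have hσ₁ := hσ.frame hframe₁ (by decide)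
    have hheld₁ : BirthsHeld D σ₁ (D.M + 1) :=
      ⟨hframe₁.holds (by decide) hheld.death, hframe₁.holds (by decide) hheld.birth,
        hframe₁.holds (by decide) hheld.life⟩
    refine (lifeLoad_does S hσ₁ hheld₁ hb hblock).seq fun σ₂ hframe₂ ⟨hbirth, hspan, hlife⟩ => ?_
    have hdeath := D.death_le b
    refine (Does.for (fun r σ' => TopsHeld D σ' b r) (fun _ => 34) hspan (by decide) (by decide)
      (by omega)
      ((h₁.of_frame hframe₂ (by decide) (by decide)).put _ _)
      fun r hr σ₃ hframe₃ hindex h₃ => ?_).mono (by simp; omega) fun _ _ h => h.succ.put _ _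
    have hσ₂ := hσ₁.frame hframe₂ (by decide)
    refine (topAssign_does S (hσ₂.frame hframe₃ (by decide)) hb hr hindex
      ((hframe₃.regs _ (by decide)).trans hbirth) ((hframe₃.regs _ (by decide)).trans hlife)
      h₃).mono le_rfl fun _ _ h => h.put _ _
  · have hsum := D.sum_life_mul 42 42 (D.M + 1)
    simp only [show ∀ x, 28 + (x + 6) + 8 = x + 42 by intro; omega, hsum]
    omega

end Tops

/-! ## Jumps and ladders -/

section Family

variable (D : Family)

/-- The jump of length `2 ^ j` from the block `b`: the next block whose birth is earlier than that
of `b` by at least this amount. -/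
noncomputable def Family.jump (b j : ℕ) : ℕ := D.next (b + 1) (D.birth b - 2 ^ j)

/-- The rung `r` of the ladder of the block `b`: the next block whose birth is earlier than that of
`b` by more than `r`. -/
noncomputable def Family.rung (b r : ℕ) : ℕ := D.next (b + 1) (D.birth b - (r + 1))

/-- The length of the ladder of the block `b`. -/
def Family.height (b : ℕ) : ℕ := min (D.death b - D.birth b) (D.birth b)

theorem Family.size_birth_le (b : ℕ) : (D.birth b).size ≤ D.k.size :=
  Nat.size_le_size ((D.birth_le_death b).trans (D.death_le b))

theorem Family.lt_M_of_birth_pos {b : ℕ} (hb : b ≤ D.M) (h : 0 < D.birth b) : b < D.M := by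
  refine hb.lt_of_ne ?_
  rintro rfl
  exact h.ne' D.birth_M

end Family

/-- The arrays hold the births and the starts of the life spans of all blocks, and the jumps and
ladders of the blocks from `b` on. -/
structure LadderTables (D : Family) (σ : Store) (b : ℕ) : Prop where
  birth : σ.Holds aBirth (D.M + 1) D.birth
  life : σ.Holds aLife (D.M + 1) D.life
  jump : ∀ b', b ≤ b' → b' < D.M →
    σ.HoldsFrom aJump (b' * D.k.size) (D.birth b').size (D.jump b')
  ladder : ∀ b', b ≤ b' → b' < D.M →
    σ.HoldsFrom aLadder (D.life b') (D.height b') (D.rung b')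

notation "rFrom" => 20
notation "rTime" => 21
notation "rFound" => 22

section Find

local notation "rBirth" => 23
local notation "rGap" => 24
local notation "rIndex" => 25

/-- Makes the longest jump that does not pass the time in question. -/
def jumpStep : Cmd :=
  .set rGap (reg rBirth - reg rTime) ;; .set rIndex (sizeExpr rGap - const 1) ;;
  .ld rFound aJump (reg rFrom * reg rJumps + reg rIndex) ;; .ld rBirth aBirth (reg rFound)

/-- Climbs the ladder at the target of the jump. -/
def ladderStep : Cmd :=
  .set rGap (reg rBirth - reg rTime) ;; .ld rIndex aLife (reg rFound) ;;
  .ld rFound aLadder (reg rIndex + reg rGap - const 1)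

/-- Finds the first block from `rFrom` on that is born by the time `rTime`. -/
def find : Cmd :=
  .ld rBirth aBirth (reg rFrom) ;;
  .ite (bin .lt (reg rTime) (reg rBirth))
    (jumpStep ;; .ite (bin .lt (reg rTime) (reg rBirth)) ladderStep .skip)
    (.set rFound (reg rFrom))

variable {D : Family} {G : Layout} {tt b s j τ : ℕ} {σ σ' : Store}

theorem LadderTables.of_frame {c : Cmd} (h : LadderTables D σ b) (hframe : c.Frame σ σ')
    (hc : c.arrs = []) : LadderTables D σ' b := by
  have hmem (q : ℕ) : q ∉ c.arrs := by simp [hc]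
  exact
    { birth := hframe.holds (hmem _) h.birth
      life := hframe.holds (hmem _) h.life
      jump := fun b' hle hlt => hframe.holdsFrom (hmem _) (h.jump b' hle hlt)
      ladder := fun b' hle hlt => hframe.holdsFrom (hmem _) (h.ladder b' hle hlt) }

theorem Setting.jump_index_lt (S : Setting D G tt) (hb : b ≤ D.M) (hj : j < D.k.size) :
    b * D.k.size + j < G.len := by
  have hle : (b + 1) * D.k.size ≤ (D.M + 1) * D.k.size := Nat.mul_le_mul_right _ (by omega)
  have hlen := S.jumps_le
  rw [Nat.succ_mul] at hle
  omega

theorem jumpStep_does (S : Setting D G tt) (hσ : Access D G σ) (h : LadderTables D σ b)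
    (hb : b < D.M) (hfrom : σ.regs rFrom = b) (htime : σ.regs rTime = τ)
    (hbirth : σ.regs rBirth = D.birth b) (hτ : τ < D.birth b) (hj : 2 ^ j ≤ D.birth b - τ)
    (hj' : D.birth b - τ < 2 ^ (j + 1)) :
    Does G jumpStep 38 σ fun σ' =>
      σ'.regs rFound = D.jump b j ∧ σ'.regs rBirth = D.birth (D.jump b j) := by
  have := S.le_cap
  have := S.M_lt
  have := S.n_add_k_lt
  have := S.arrays_eq
  have := D.death_le b
  have := D.birth_le_death b
  have hsize : (D.birth b - τ).size = j + 1 :=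
    le_antisymm (Nat.size_le.2 hj') (Nat.lt_size.2 hj)
  have hj_lt : j < (D.birth b).size := Nat.lt_size.2 (by omega)
  have := S.jump_index_lt hb.le (hj_lt.trans_le (D.size_birth_le b))
  have hjump := h.jump b le_rfl hb j hj_lt
  have hnext : D.jump b j ≤ D.M := (Family.next_spec (Nat.succ_le_of_lt hb) _).2.1
  have hbirth' := h.birth (D.jump b j) (by omega)
  have hsize_eval (ρ : ℕ → ℕ) (hρ : ρ rGap = D.birth b - τ) :
      (sizeExpr rGap).natEval G.W ρ = j + 1 := by
    rw [sizeExpr_natEval (by omega), hρ, hsize]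
  refine Does.of_wp_eq ((((σ.put rGap (D.birth b - τ)).put rIndex j).put rFound (D.jump b j)).put
    rBirth (D.birth (D.jump b j))) (by decide) ?_ (by simp)
  simp [jumpStep, Cmd.wp, hfrom, htime, hbirth, hsize_eval, hσ.base, hσ.jumps, hjump, hbirth']
  omega

theorem ladderStep_does (S : Setting D G tt) (hσ : Access D G σ) (h : LadderTables D σ b)
    (hs : b ≤ s) (hsM : s < D.M) (hfound : σ.regs rFound = s) (htime : σ.regs rTime = τ)
    (hbirth : σ.regs rBirth = D.birth s) (hτ : τ < D.birth s)
    (hspan : D.birth s - τ ≤ D.death s - D.birth s) :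
    Does G ladderStep 24 σ fun σ' => σ'.regs rFound = D.next (s + 1) τ := by
  have := S.le_cap
  have := S.M_lt
  have := S.n_add_k_lt
  have := S.arrays_eq
  have := D.death_le s
  have := D.life_succ s
  have := D.life_le (show s + 1 ≤ D.M + 1 by omega)
  have hrung := h.ladder s hs hsM (D.birth s - τ - 1) (by unfold Family.height; omega)
  rw [Family.rung, show D.birth s - (D.birth s - τ - 1 + 1) = τ by omega,
    ← Nat.add_sub_assoc (by omega)] at hrung
  refine Does.of_wp_eq (((σ.put rGap (D.birth s - τ)).put rIndex (D.life s)).put rFound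
    (D.next (s + 1) τ)) (by decide) ?_ (by simp)
  simp [ladderStep, Cmd.wp, hfound, htime, hbirth, hσ.base, h.life s (by omega), hrung]
  omega

theorem find_does (S : Setting D G tt) (hσ : Access D G σ) (h : LadderTables D σ b)
    (hb : b ≤ D.M) (hfrom : σ.regs rFrom = b) (htime : σ.regs rTime = τ) :
    Does G find 86 σ fun σ' => σ'.regs rFound = D.next b τ := by
  have := S.M_lt
  have := S.arrays_eq
  have hload : Does G (.ld rBirth aBirth (reg rFrom)) 8 σ fun σ' => σ'.regs rBirth = D.birth b := by
    refine Does.of_wp_eq (σ.put rBirth (D.birth b)) (by decide) ?_ (by simp)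
    simp [Cmd.wp, hfrom, h.birth b (by omega), hσ.base]
    omega
  refine (hload.seq fun σ₁ hframe₁ hbirth => Does.ite (T₁ := 38 + (4 + (24 + 1))) (T₂ := 2)
    (by simp) (fun hlt => ?_) fun hge => ?_).mono (by decide) fun _ _ h => h
  · have hfrom₁ := (hframe₁.regs rFrom (by decide)).trans hfrom
    have htime₁ := (hframe₁.regs rTime (by decide)).trans htime
    have hσ₁ := hσ.frame hframe₁ (by decide)
    have h₁ := h.of_frame hframe₁ (by decide)
    have hτ : τ < D.birth b := by simpa [htime₁, hbirth] using hlt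
    have hbM := D.lt_M_of_birth_pos hb (by omega)
    have hpos : 0 < (D.birth b - τ).size := Nat.size_pos.2 (by omega)
    obtain ⟨j, hj⟩ : ∃ j, (D.birth b - τ).size = j + 1 := ⟨_, (Nat.sub_add_cancel hpos).symm⟩
    have hj_le : 2 ^ j ≤ D.birth b - τ := Nat.lt_size.1 (by omega)
    have hlt_j : D.birth b - τ < 2 ^ (j + 1) := hj ▸ Nat.lt_size_self _
    have hcases := Family.next_jump hbM hτ hj_le hlt_j (s := D.jump b j) rfl
    refine (jumpStep_does S hσ₁ h₁ hbM hfrom₁ htime₁ hbirth hτ hj_le hlt_j).seq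
      fun σ₂ hframe₂ ⟨hfound, hbirth₂⟩ => ?_
    have htime₂ := (hframe₂.regs rTime (by decide)).trans htime₁
    refine Does.ite (by simp) (fun hlt₂ => ?_) fun hge₂ => .skip ?_
    · obtain ⟨hle, -⟩ | ⟨hτ', hsM, hspan, hnext⟩ := hcases
      · simp [htime₂, hbirth₂, hle.not_gt] at hlt₂
      · rw [hnext]
        exact ladderStep_does S (hσ₁.frame hframe₂ (by decide)) (h₁.of_frame hframe₂ (by decide))
          ((Nat.le_succ b).trans (Family.next_spec hbM _).1) hsM hfound htime₂ hbirth₂ hτ' hspan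
    · obtain ⟨-, hnext⟩ | ⟨hτ', -⟩ := hcases
      · rw [hnext, hfound]
      · simp [htime₂, hbirth₂, hτ'] at hge₂
  · refine Does.set (by simp) ?_
    have hle : D.birth b ≤ τ := by
      simpa [hbirth, (hframe₁.regs rTime (by decide)).trans htime] using hge
    simpa [Family.next_self hle] using (hframe₁.regs rFrom (by decide)).trans hfrom

end Find

section Jumps

local notation "rCount" => 2
local notation "rBlock" => 3
local notation "rBirth" => 4
local notation "rSize" => 5
local notation "rHeight" => 6
local notation "rLife" => 7
local notation "rJump" => 8
local notation "rRung" => 9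

/-- Loads the parameters of the current block. -/
def jumpsLoad : Cmd :=
  .set rBlock (reg rBlocks - reg rCount) ;; .ld rBirth aBirth (reg rBlock) ;;
  .set rSize (sizeExpr rBirth) ;; .ld rLife aLife (reg rBlock) ;;
  .ld rHeight aDeath (reg rBlock) ;; .set rHeight (reg rHeight - reg rBirth) ;;
  .ite (bin .lt (reg rBirth) (reg rHeight)) (.set rHeight (reg rBirth)) .skip

/-- Computes and stores one jump of the current block. -/
def jumpSet : Cmd :=
  (.set rFrom (reg rBlock + const 1) ;;
    .set rTime (reg rBirth - bin .shl (const 1) (reg rJump))) ;; find ;;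
  .st aJump (reg rBlock * reg rJumps + reg rJump) (reg rFound)

/-- Computes and stores one rung of the ladder of the current block. -/
def rungSet : Cmd :=
  (.set rFrom (reg rBlock + const 1) ;;
    .set rTime (reg rBirth - (reg rRung + const 1))) ;; find ;;
  .st aLadder (reg rLife + reg rRung) (reg rFound)

/-- Computes the jumps and the ladders of all blocks, from the last block down to the first. -/
def jumps : Cmd :=
  .for rCount rBlocksSucc (jumpsLoad ;; .for rJump rSize jumpSet ;; .for rRung rHeight rungSet)

/-- The tables are complete for the blocks after `b`, and hold the first `j` jumps and the first
`r` rungs of the block `b`. -/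
structure LaddersHeld (D : Family) (σ : Store) (b j r : ℕ) : Prop where
  tables : LadderTables D σ (b + 1)
  jump : b < D.M → σ.HoldsFrom aJump (b * D.k.size) j (D.jump b)
  ladder : σ.HoldsFrom aLadder (D.life b) r (D.rung b)

variable {D : Family} {G : Layout} {tt b j r c : ℕ} {σ σ' : Store}

theorem LadderTables.put (h : LadderTables D σ b) (q v : ℕ) : LadderTables D (σ.put q v) b :=
  ⟨h.birth, h.life, h.jump, h.ladder⟩

theorem LaddersHeld.put (h : LaddersHeld D σ b j r) (q v : ℕ) : LaddersHeld D (σ.put q v) b j r :=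
  ⟨h.tables.put q v, h.jump, h.ladder⟩

theorem LaddersHeld.of_frame {a : Cmd} (h : LaddersHeld D σ b j r) (hframe : a.Frame σ σ')
    (ha : a.arrs = []) : LaddersHeld D σ' b j r :=
  ⟨h.tables.of_frame hframe ha, fun hb => hframe.holdsFrom (by simp [ha]) (h.jump hb),
    hframe.holdsFrom (by simp [ha]) h.ladder⟩

theorem LaddersHeld.zero (h : LadderTables D σ (b + 1)) : LaddersHeld D σ b 0 0 :=
  ⟨h, fun _ => σ.holdsFrom_zero _ _ _, σ.holdsFrom_zero _ _ _⟩

theorem LaddersHeld.complete (h : LaddersHeld D σ b (D.birth b).size (D.height b)) :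
    LadderTables D σ b where
  birth := h.tables.birth
  life := h.tables.life
  jump b' hle hlt := by
    obtain rfl | hlt' := hle.eq_or_lt
    · exact h.jump hlt
    · exact h.tables.jump b' hlt' hlt
  ladder b' hle hlt := by
    obtain rfl | hlt' := hle.eq_or_lt
    · exact h.ladder
    · exact h.tables.ladder b' hlt' hlt

theorem LaddersHeld.write_jump (h : LaddersHeld D σ b j r) (hj : j < D.k.size) :
    LaddersHeld D (σ.write aJump (b * D.k.size + j) (D.jump b j)) b (j + 1) r where
  tables :=
    { birth := by simpa using h.tables.birth
      life := by simpa using h.tables.life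
      jump := fun b' hle hlt => by
        have : (b + 1) * D.k.size ≤ b' * D.k.size := Nat.mul_le_mul_right _ hle
        rw [Nat.succ_mul] at this
        exact (h.tables.jump b' hle hlt).write_of_disjoint (.inl (by omega))
      ladder := by simpa using h.tables.ladder }
  jump hb := (h.jump hb).write_succ rfl
  ladder := by simpa using h.ladder

theorem LaddersHeld.write_rung (h : LaddersHeld D σ b j r) (hr : r < D.height b) :
    LaddersHeld D (σ.write aLadder (D.life b + r) (D.rung b r)) b j (r + 1) where
  tables :=
    { birth := by simpa using h.tables.birth
      life := by simpa using h.tables.life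
      jump := by simpa using h.tables.jump
      ladder := fun b' hle hlt => by
        have := D.life_add_le hle
        have : D.height b ≤ D.death b - D.birth b := min_le_left _ _
        exact (h.tables.ladder b' hle hlt).write_of_disjoint (.inl (by omega)) }
  jump := by simpa using h.jump
  ladder := h.ladder.write_succ rfl

theorem jumpsLoad_does (S : Setting D G tt) (hσ : Consts D G σ) (hc : c < D.M + 1)
    (hcount : σ.regs rCount = c) (hbirth : σ.Holds aBirth (D.M + 1) D.birth)
    (hdeath : σ.Holds aDeath (D.M + 1) D.death) (hlife : σ.Holds aLife (D.M + 1) D.life) :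
    Does G jumpsLoad 100 σ fun σ' =>
      σ'.regs rBlock = D.M - c ∧ σ'.regs rBirth = D.birth (D.M - c) ∧
      σ'.regs rSize = (D.birth (D.M - c)).size ∧ σ'.regs rHeight = D.height (D.M - c) ∧
      σ'.regs rLife = D.life (D.M - c) := by
  have := S.le_cap
  have := S.M_lt
  have := S.n_add_k_lt
  have := S.arrays_eq
  generalize hb : D.M - c = b
  have := D.death_le b
  have := D.birth_le_death b
  have hbirth_b := hbirth b (by omega)
  have hdeath_b := hdeath b (by omega)
  have hlife_b := hlife b (by omega)
  have hsize (ρ : ℕ → ℕ) (hρ : ρ rBirth = D.birth b) :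
      (sizeExpr rBirth).natEval G.W ρ = (D.birth b).size := by
    rw [sizeExpr_natEval (by omega), hρ]
  let σ₁ := (((((σ.put rBlock b).put rBirth (D.birth b)).put rSize (D.birth b).size).put rLife
    (D.life b)).put rHeight (D.death b)).put rHeight (D.death b - D.birth b)
  by_cases hlt : D.birth b < D.death b - D.birth b
  · have hheight : D.height b = D.birth b := min_eq_right hlt.le
    refine Does.of_wp_eq (σ₁.put rHeight (D.birth b)) (by decide) ?_ (by simp [σ₁, hheight])
    simp [σ₁, jumpsLoad, Cmd.wp, hcount, hσ.base, hσ.blocks, hb, hbirth_b, hdeath_b, hlife_b,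
      hsize, hlt]
    omega
  · have hheight : D.height b = D.death b - D.birth b := min_eq_left (not_lt.1 hlt)
    refine Does.of_wp_eq σ₁ (by decide) ?_ (by simp [σ₁, hheight])
    simp [σ₁, jumpsLoad, Cmd.wp, hcount, hσ.base, hσ.blocks, hb, hbirth_b, hdeath_b, hlife_b,
      hsize, hlt]
    omega

theorem jumpSet_does (S : Setting D G tt) (hσ : Consts D G σ) (hb : b ≤ D.M)
    (hj : j < (D.birth b).size) (hblock : σ.regs rBlock = b) (hbirth : σ.regs rBirth = D.birth b)
    (hjump : σ.regs rJump = j) (h : LaddersHeld D σ b j r) :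
    Does G jumpSet 200 σ fun σ' => LaddersHeld D σ' b (j + 1) r := by
  have := S.le_cap
  have := S.M_lt
  have := S.n_add_k_lt
  have := S.arrays_eq
  have := D.death_le b
  have := D.birth_le_death b
  have hpow : 2 ^ j ≤ D.birth b := Nat.lt_size.1 hj
  have hbM := D.lt_M_of_birth_pos hb (Nat.pos_of_ne_zero fun h0 => by simp [h0] at hj)
  have hj' := hj.trans_le (D.size_birth_le b)
  have hindex := S.jump_index_lt hb hj'
  have hset : Does G (.set rFrom (reg rBlock + const 1) ;;
      .set rTime (reg rBirth - bin .shl (const 1) (reg rJump))) 40 σ fun σ' =>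
      σ'.regs rFrom = b + 1 ∧ σ'.regs rTime = D.birth b - 2 ^ j := by
    refine Does.of_wp_eq ((σ.put rFrom (b + 1)).put rTime (D.birth b - 2 ^ j)) (by decide) ?_
      (by simp)
    simp [Cmd.wp, hblock, hbirth, hjump]
    omega
  refine (hset.seq fun σ₁ hframe₁ ⟨hfrom, htime⟩ => ?_ : Does G _ (40 + (86 + 40)) σ _).mono
    (by decide) fun _ _ h => h
  have hσ₁ := hσ.frame hframe₁ (by decide)
  have h₁ := h.of_frame hframe₁ rfl
  refine (find_does S hσ₁.toAccess h₁.tables hbM hfrom htime).seq fun σ₂ hframe₂ hfound => ?_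
  have hσ₂ := hσ₁.frame hframe₂ (by decide)
  have hblock₂ : σ₂.regs rBlock = b := by
    rw [hframe₂.regs _ (by decide), hframe₁.regs _ (by decide), hblock]
  have hjump₂ : σ₂.regs rJump = j := by
    rw [hframe₂.regs _ (by decide), hframe₁.regs _ (by decide), hjump]
  refine Does.of_wp_eq (σ₂.write aJump (b * D.k.size + j) (D.jump b j)) (by decide) ?_
    ((h₁.of_frame hframe₂ (by decide)).write_jump hj')
  simp [Cmd.wp, hblock₂, hjump₂, hfound, hσ₂.jumps, hσ₂.base, Family.jump]
  omega

theorem rungSet_does (S : Setting D G tt) (hσ : Consts D G σ) (hb : b ≤ D.M)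
    (hr : r < D.height b) (hblock : σ.regs rBlock = b) (hbirth : σ.regs rBirth = D.birth b)
    (hlife : σ.regs rLife = D.life b) (hrung : σ.regs rRung = r) (h : LaddersHeld D σ b j r) :
    Does G rungSet 200 σ fun σ' => LaddersHeld D σ' b j (r + 1) := by
  have := S.le_cap
  have := S.M_lt
  have := S.n_add_k_lt
  have := S.arrays_eq
  have := D.death_le b
  have := D.birth_le_death b
  obtain ⟨hr_span, hr_birth⟩ := lt_min_iff.1 hr
  have hbM := D.lt_M_of_birth_pos hb (by omega)
  have := D.life_succ b
  have := D.life_le (show b + 1 ≤ D.M + 1 by omega)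
  have hset : Does G (.set rFrom (reg rBlock + const 1) ;;
      .set rTime (reg rBirth - (reg rRung + const 1))) 40 σ fun σ' =>
      σ'.regs rFrom = b + 1 ∧ σ'.regs rTime = D.birth b - (r + 1) := by
    refine Does.of_wp_eq ((σ.put rFrom (b + 1)).put rTime (D.birth b - (r + 1))) (by decide) ?_
      (by simp)
    simp [Cmd.wp, hblock, hbirth, hrung]
    omega
  refine (hset.seq fun σ₁ hframe₁ ⟨hfrom, htime⟩ => ?_ : Does G _ (40 + (86 + 40)) σ _).mono
    (by decide) fun _ _ h => h
  have hσ₁ := hσ.frame hframe₁ (by decide)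
  have h₁ := h.of_frame hframe₁ rfl
  refine (find_does S hσ₁.toAccess h₁.tables hbM hfrom htime).seq fun σ₂ hframe₂ hfound => ?_
  have hσ₂ := hσ₁.frame hframe₂ (by decide)
  have hlife₂ : σ₂.regs rLife = D.life b := by
    rw [hframe₂.regs _ (by decide), hframe₁.regs _ (by decide), hlife]
  have hrung₂ : σ₂.regs rRung = r := by
    rw [hframe₂.regs _ (by decide), hframe₁.regs _ (by decide), hrung]
  refine Does.of_wp_eq (σ₂.write aLadder (D.life b + r) (D.rung b r)) (by decide) ?_
    ((h₁.of_frame hframe₂ (by decide)).write_rung hr)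
  simp [Cmd.wp, hlife₂, hrung₂, hfound, hσ₂.base, Family.rung]
  omega

theorem jumpsBody_does (S : Setting D G tt) (hσ : Consts D G σ) (hc : c < D.M + 1)
    (hcount : σ.regs rCount = c) (hdeath : σ.Holds aDeath (D.M + 1) D.death)
    (h : LadderTables D σ (D.M - c + 1)) :
    Does G (jumpsLoad ;; .for rJump rSize jumpSet ;; .for rRung rHeight rungSet)
      (208 * (D.death (D.M - c) - D.birth (D.M - c)) + (208 * D.k.size + 112)) σ
      fun σ' => LadderTables D σ' (D.M - c) := by
  have hcap := S.le_cap
  have hn := S.n_add_k_lt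
  have hload := jumpsLoad_does S hσ hc hcount h.birth hdeath h.life
  generalize hb : D.M - c = b at h hload ⊢
  have hbM : b ≤ D.M := by omega
  have hdeath_le := D.death_le b
  have hsize := D.size_birth_le b
  have hspan : D.height b ≤ D.death b - D.birth b := min_le_left _ _
  have hk : D.k.size ≤ D.k := Nat.size_le.2 Nat.lt_two_pow_self
  refine (hload.seq fun σ₁ hframe₁ ⟨hblock, hbirth, hrSize, hheight, hlife⟩ => ?_ :
    Does G _ (100 + (208 * (D.birth b).size + 6 + (208 * D.height b + 6))) σ _).mono
    (by omega) fun _ _ h => h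
  have hσ₁ := hσ.frame hframe₁ (by decide)
  have h₁ : LaddersHeld D σ₁ b 0 0 := .zero (h.of_frame hframe₁ (by decide))
  refine ((Does.for (fun j σ' => LaddersHeld D σ' b j 0) (fun _ => 200) hrSize (by decide)
    (by decide) (by omega) (h₁.put _ _) fun j hj σ₂ hframe₂ hjump h₂ => ?_).mono
    (by simp [mul_comm]) fun _ _ h => h).seq fun σ₂ hframe₂ h₂ => ?_
  · exact (jumpSet_does S (hσ₁.frame hframe₂ (by decide)) hbM hj
      ((hframe₂.regs _ (by decide)).trans hblock) ((hframe₂.regs _ (by decide)).trans hbirth)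
      hjump h₂).mono le_rfl fun _ _ h => h.put _ _
  have hσ₂ := hσ₁.frame hframe₂ (by decide)
  have hheight₂ := (hframe₂.regs rHeight (by decide)).trans hheight
  refine (Does.for (fun r σ' => LaddersHeld D σ' b (D.birth b).size r) (fun _ => 200) hheight₂
    (by decide) (by decide) (by omega) (h₂.put _ _) fun r hr σ₃ hframe₃ hrung h₃ => ?_).mono
    (by simp [mul_comm]) fun _ _ h => h.complete
  have hkeep (q : ℕ) (hq : q ∉ (Cmd.for rJump rSize jumpSet).regs)
      (hq' : q ∉ (Cmd.for rRung rHeight rungSet).regs) : σ₃.regs q = σ₁.regs q :=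
    (hframe₃.regs q hq').trans (hframe₂.regs q hq)
  exact (rungSet_does S (hσ₂.frame hframe₃ (by decide)) hbM hr
    ((hkeep _ (by decide) (by decide)).trans hblock)
    ((hkeep _ (by decide) (by decide)).trans hbirth)
    ((hkeep _ (by decide) (by decide)).trans hlife) hrung h₃).mono le_rfl fun _ _ h => h.put _ _

theorem jumps_does (S : Setting D G tt) (hσ : Consts D G σ)
    (hheld : BirthsHeld D σ (D.M + 1)) :
    Does G jumps (208 * (D.n + D.k) + (208 * D.k.size + 120) * (D.M + 1) + 6) σ
      fun σ' => LadderTables D σ' 0 := by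
  have hcap := S.le_cap
  have hM := S.M_lt
  have hlife := D.life_le le_rfl
  have hzero : LadderTables D σ (D.M + 1 - 0) :=
    ⟨hheld.birth, hheld.life, fun b hle hlt => by omega, fun b hle hlt => by omega⟩
  refine (Does.for (fun c σ' => LadderTables D σ' (D.M + 1 - c))
    (fun c => 208 * (D.death (D.M - c) - D.birth (D.M - c)) + (208 * D.k.size + 112))
    hσ.blocksSucc (by decide) (by decide) (by omega) (hzero.put _ _)
    fun c hc σ₁ hframe₁ hcount h₁ => ?_).mono ?_ fun _ _ h => by simpa using h
  · rw [show D.M + 1 - c = D.M - c + 1 by omega] at h₁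
    refine (jumpsBody_does S (hσ.frame hframe₁ (by decide)) hc hcount
      (hframe₁.holds (by decide) hheld.death) h₁).mono le_rfl fun _ _ h => ?_
    rw [Nat.add_sub_add_right]
    exact h.put _ _
  · have hsum := D.sum_life_mul 208 (208 * D.k.size + 120) (D.M + 1)
    rw [← sum_range_reflect] at hsum
    simp only [Nat.add_sub_cancel] at hsum
    simp only [Nat.add_assoc, Nat.reduceAdd] at hsum ⊢
    omega

end Jumps

/-! ## The top node of a query -/

notation "rQuerySet" => 0
notation "rQuery" => 1
notation "rQueryOffset" => 2
notation "rQueryNode" => 5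
notation "rQueryFlag" => 6

section Top

local notation "rFirst" => 3
local notation "rBlock" => 4
local notation "rLife" => 7
local notation "rBirth" => 8

/-- Loads the parameters of the query. -/
def topLoad : Cmd :=
  .ld rQueryOffset aOffset (reg rQuerySet) ;; .ld rFirst aFirst (reg rQuerySet) ;;
  .set rBlock (reg rQuery / reg rBlockSize)

/-- Reads off the top node from the block found. -/
def topRead : Cmd :=
  .ld rLife aLife (reg rFound) ;; .ld rBirth aBirth (reg rFound) ;;
  .ld rQueryNode aTop (reg rLife + (reg rQuerySet - reg rBirth)) ;;
  .set rQueryFlag (bin .eq (reg rFound) (reg rBlock))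

/-- Determines the top node of a block after the first block of the set. -/
def topAfter : Cmd :=
  (.set rFrom (reg rBlock) ;; .set rTime (reg rQuerySet)) ;; find ;; topRead

/-- Determines the top node of a block up to the first block of the set. -/
def topUpTo : Cmd :=
  .set rQueryNode (reg rQueryOffset + reg rQueryOffset) ;;
  .set rQueryFlag (bin .eq (reg rFirst) (reg rBlock))

/-- Determines the top node of the block of a number with respect to a set, and whether the set
meets this block. -/
def topFind : Cmd :=
  topLoad ;; .ite (bin .lt (reg rFirst) (reg rBlock)) topAfter topUpTo

/-- The arrays hold the tables from which the top nodes are computed. -/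
structure TopTables (D : Family) (σ : Store) : Prop where
  offset : σ.Holds aOffset D.k D.offset
  first : σ.Holds aFirst D.k D.first
  ladders : LadderTables D σ 0
  top : ∀ b < D.M + 1,
    σ.HoldsFrom aTop (D.life b) (D.death b - D.birth b) fun r => D.free b (D.birth b + r)

open Classical in
/-- The registers hold the node `r`, from which the search for `x` in the set `i` continues if
`p` holds. -/
structure Located (D : Family) (σ : Store) (i x r : ℕ) (p : Prop) : Prop where
  query : σ.regs rQuery = x
  offset : σ.regs rQueryOffset = D.offset i
  node : σ.regs rQueryNode = r
  flag : σ.regs rQueryFlag = if p then 1 else 0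

variable {D : Family} {G : Layout} {tt i x b r : ℕ} {σ σ' : Store}

theorem LadderTables.mono {b' : ℕ} (h : LadderTables D σ b) (hle : b ≤ b') :
    LadderTables D σ b' :=
  ⟨h.birth, h.life, fun c hc => h.jump c (hle.trans hc), fun c hc => h.ladder c (hle.trans hc)⟩

theorem TopTables.of_frame {c : Cmd} (h : TopTables D σ) (hframe : c.Frame σ σ')
    (hc : ∀ q ∈ c.arrs, 13 ≤ q) : TopTables D σ' := by
  have hmem (q : ℕ) (hq : q < 13) : q ∉ c.arrs := fun hq' => (hc q hq').not_gt hq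
  exact
    { offset := hframe.holds (hmem _ (by decide)) h.offset
      first := hframe.holds (hmem _ (by decide)) h.first
      ladders :=
        { birth := hframe.holds (hmem _ (by decide)) h.ladders.birth
          life := hframe.holds (hmem _ (by decide)) h.ladders.life
          jump := fun b hle hlt => hframe.holdsFrom (hmem _ (by decide)) (h.ladders.jump b hle hlt)
          ladder := fun b hle hlt =>
            hframe.holdsFrom (hmem _ (by decide)) (h.ladders.ladder b hle hlt) }
      top := fun b hb => hframe.holdsFrom (hmem _ (by decide)) (h.top b hb) }

theorem topLoad_does (S : Setting D G tt) (hσ : Access D G σ) (h : TopTables D σ) (hi : i < D.k)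
    (hset : σ.regs rQuerySet = i) (hquery : σ.regs rQuery = x) :
    Does G topLoad 24 σ fun σ' =>
      σ'.regs rQueryOffset = D.offset i ∧ σ'.regs rFirst = D.first i ∧
      σ'.regs rBlock = x / D.B := by
  have := S.n_add_k_lt
  have := S.arrays_eq
  refine Does.of_wp_eq (((σ.put rQueryOffset (D.offset i)).put rFirst (D.first i)).put rBlock
    (x / D.B)) (by decide) ?_ (by simp)
  simp [topLoad, Cmd.wp, hset, hquery, hσ.base, hσ.blockSize, h.offset i hi, h.first i hi]
  omega

theorem topRead_does (S : Setting D G tt) (hσ : Access D G σ) (h : TopTables D σ) (hi : i < D.k)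
    (hb : b < D.M) (hfirst : D.first i < b) (hset : σ.regs rQuerySet = i)
    (hblock : σ.regs rBlock = b) (hfound : σ.regs rFound = D.next b i) :
    Does G topRead 44 σ fun σ' => σ'.regs rQueryNode = D.top i b ∧
      σ'.regs rQueryFlag = if D.next b i = b then 1 else 0 := by
  have := S.le_cap
  have := S.M_lt
  have := S.n_add_k_lt
  have := S.arrays_eq
  obtain ⟨hle, hM, hborn⟩ := Family.next_spec hb.le i
  have halive := Family.alive_next hb.le (τ := i)
  have := D.lt_death hi hfirst
  have := D.death_mono hle
  have := D.life_succ (D.next b i)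
  have := D.life_le (show D.next b i + 1 ≤ D.M + 1 by omega)
  have htop : σ.arr aTop (D.life (D.next b i) + (i - D.birth (D.next b i))) = D.top i b := by
    refine (h.top (D.next b i) (by omega) _ (by omega)).trans ?_
    simp only [Nat.add_sub_cancel' hborn, Family.free, halive, Family.top, hfirst.not_ge, if_false]
  refine Does.of_wp_eq ((((σ.put rLife (D.life (D.next b i))).put rBirth
    (D.birth (D.next b i))).put rQueryNode (D.top i b)).put rQueryFlag
    (if D.next b i = b then 1 else 0)) (by decide) ?_ (by simp)
  simp [topRead, Cmd.wp, hset, hblock, hfound, hσ.base, h.ladders.birth (D.next b i) (by omega),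
    h.ladders.life (D.next b i) (by omega), htop]
  omega

theorem topAfter_does (S : Setting D G tt) (hσ : Access D G σ) (h : TopTables D σ) (hi : i < D.k)
    (hb : b < D.M) (hfirst : D.first i < b) (hset : σ.regs rQuerySet = i)
    (hblock : σ.regs rBlock = b) :
    Does G topAfter 150 σ fun σ' => σ'.regs rQueryNode = D.top i b ∧
      σ'.regs rQueryFlag = if D.next b i = b then 1 else 0 := by
  have harg : Does G (.set rFrom (reg rBlock) ;; .set rTime (reg rQuerySet)) 20 σ fun σ' =>
      σ'.regs rFrom = b ∧ σ'.regs rTime = i :=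
    Does.of_wp_eq ((σ.put rFrom b).put rTime i) (by decide) (by simp [Cmd.wp, hset, hblock])
      (by simp)
  refine (harg.seq fun σ₁ hframe₁ ⟨hfrom, htime⟩ => (find_does S (hσ.frame hframe₁ (by decide))
    ((h.ladders.mono b.zero_le).of_frame hframe₁ rfl) hb.le hfrom htime).seq
    fun σ₂ hframe₂ hfound => topRead_does S
      ((hσ.frame hframe₁ (by decide)).frame hframe₂ (by decide))
      ((h.of_frame hframe₁ (by decide)).of_frame hframe₂ (by decide)) hi hb hfirst ?_ ?_
      hfound).mono (by decide) fun _ _ h => h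
  · rw [hframe₂.regs _ (by decide), hframe₁.regs _ (by decide), hset]
  · rw [hframe₂.regs _ (by decide), hframe₁.regs _ (by decide), hblock]

theorem topUpTo_does (S : Setting D G tt) (hi : i < D.k) (hle : b ≤ D.first i)
    (hoffset : σ.regs rQueryOffset = D.offset i) (hfirst : σ.regs rFirst = D.first i)
    (hblock : σ.regs rBlock = b) :
    Does G topUpTo 20 σ fun σ' => σ'.regs rQueryNode = D.top i b ∧
      σ'.regs rQueryFlag = if D.first i = b then 1 else 0 := by
  have := S.le_cap
  have := S.two_n_lt
  have := D.offset_le hi.le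
  have htop : D.top i b = D.offset i + D.offset i := by rw [Family.top, if_pos hle, two_mul]
  refine Does.of_wp_eq ((σ.put rQueryNode (D.top i b)).put rQueryFlag
    (if D.first i = b then 1 else 0)) (by decide) ?_ (by simp)
  simp [topUpTo, Cmd.wp, hoffset, hfirst, hblock, htop]
  omega

theorem topFind_does (S : Setting D G tt) (hσ : Access D G σ) (h : TopTables D σ) (hi : i < D.k)
    (hx : x ≤ D.N) (hset : σ.regs rQuerySet = i) (hquery : σ.regs rQuery = x) :
    Does G topFind 200 σ fun σ' => Located D σ' i x (D.top i (x / D.B))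
      (∃ e < D.n, D.owner e = i ∧ D.block e = x / D.B) := by
  classical
  have hb : x / D.B < D.M := Nat.lt_succ_of_le (Nat.div_le_div_right hx)
  refine ((topLoad_does S hσ h hi hset hquery).seq fun σ₁ hframe₁ ⟨hoffset, hfirst, hblock⟩ =>
    Does.ite (T₁ := 150) (T₂ := 20) (by simp) (fun hlt => ?_) fun hge => ?_).mono (by decide)
    fun _ _ h => h
  all_goals
    generalize x / D.B = b at *
    have hquery₁ := (hframe₁.regs rQuery (by decide)).trans hquery
  · have hlt : D.first i < b := by simpa [hfirst, hblock] using hlt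
    refine (topAfter_does S (hσ.frame hframe₁ (by decide)) (h.of_frame hframe₁ (by decide)) hi hb
      hlt ((hframe₁.regs _ (by decide)).trans hset) hblock).mono le_rfl
      fun σ₂ hframe₂ ⟨hnode, hflag⟩ => ?_
    have hnext : D.next b i = b ↔ D.birth b ≤ i :=
      ⟨fun heq => heq ▸ (Family.next_spec hb.le i).2.2, Family.next_self⟩
    simp only [hnext, D.birth_le_iff hi hlt hb] at hflag
    exact ⟨(hframe₂.regs _ (by decide)).trans hquery₁, (hframe₂.regs _ (by decide)).trans hoffset,
      hnode, by convert hflag⟩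
  · have hle : b ≤ D.first i := by simpa [hfirst, hblock] using hge
    refine (topUpTo_does S hi hle hoffset hfirst hblock).mono le_rfl
      fun σ₂ hframe₂ ⟨hnode, hflag⟩ => ?_
    have hmeets : D.first i = b ↔ ∃ e < D.n, D.owner e = i ∧ D.block e = b := by
      refine ⟨fun heq => heq ▸ D.first_attained hi, ?_⟩
      rintro ⟨e, he, rfl, rfl⟩
      exact (D.first_le he).antisymm hle
    simp only [hmeets] at hflag
    exact ⟨(hframe₂.regs _ (by decide)).trans hquery₁, (hframe₂.regs _ (by decide)).trans hoffset,
      hnode, by convert hflag⟩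

end Top

section Nodes

local notation "rElem" => 10

/-- Loads the current element as a query. -/
def nodeLoad : Cmd := .ld rQuerySet aOwner (reg rElem) ;; .ld rQuery aElem (reg rElem)

/-- Stores the top node of every element. -/
def nodes : Cmd :=
  .for rElem rElems (nodeLoad ;; topFind ;; .st aNode (reg rElem) (reg rQueryNode))

variable {D : Family} {G : Layout} {tt : ℕ} {σ : Store}

theorem nodes_does (S : Setting D G tt) (hσ : Consts D G σ) (h : TopTables D σ)
    (helem : σ.Holds aElem D.n D.elem) (howner : σ.Holds aOwner D.n D.owner) :
    Does G nodes (258 * D.n + 6) σ fun σ' =>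
      σ'.Holds aNode D.n fun e => D.top (D.owner e) (D.block e) := by
  have := S.le_cap
  have := S.two_n_lt
  have := S.n_add_k_lt
  have := S.arrays_eq
  refine (Does.for (fun e σ' => σ'.Holds aNode e fun e => D.top (D.owner e) (D.block e))
    (fun _ => 30 + (200 + 20)) hσ.elems (by decide) (by decide) (by omega) (σ.holds_zero _ _)
    fun e he σ₁ hframe₁ hindex h₁ => ?_).mono (by simp; omega) fun _ _ h => h
  have hσ₁ := hσ.frame hframe₁ (by decide)
  have hload : Does G nodeLoad 30 σ₁ fun σ' =>
      σ'.regs rQuerySet = D.owner e ∧ σ'.regs rQuery = D.elem e := by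
    refine Does.of_wp_eq ((σ₁.put rQuerySet (D.owner e)).put rQuery (D.elem e)) (by decide) ?_
      (by simp)
    simp [nodeLoad, Cmd.wp, hindex, hσ₁.base, hframe₁.holds (by decide) howner e he,
      hframe₁.holds (by decide) helem e he]
    omega
  refine hload.seq fun σ₂ hframe₂ ⟨hset, hquery⟩ => ?_
  have hσ₂ := hσ₁.frame hframe₂ (by decide)
  have htables := (h.of_frame hframe₁ (by decide)).of_frame hframe₂ (by decide)
  refine (topFind_does S hσ₂.toAccess htables (D.owner_lt e he) (D.elem_le e he) hset hquery).seq
    fun σ₃ hframe₃ hlocated => ?_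
  have hσ₃ := hσ₂.frame hframe₃ (by decide)
  have hindex₃ : σ₃.regs rElem = e := by
    rw [hframe₃.regs _ (by decide), hframe₂.regs _ (by decide), hindex]
  refine Does.of_wp_eq (σ₃.write aNode e (D.top (D.owner e) (D.block e))) (by decide) ?_ ?_
  · simp [Cmd.wp, hindex₃, hσ₃.base, hlocated.node, Family.block]
    omega
  · simpa using (hframe₃.holds (by decide) (hframe₂.holds (by decide) h₁)).write_succ rfl

end Nodes

/-! ## The levels of the tries -/

notation "aBits" j:max => 14 + 2 * j
notation "aChild" j:max => 15 + 2 * j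

/-- An expression for a digit of the content of a register. -/
def digitExpr (tt j r : ℕ) : Expr := bin .mod (reg r / powExpr (tt - 1 - j)) wordSize

theorem digitExpr_natEval {W tt j r x : ℕ} {ρ : ℕ → ℕ} (h : ρ r = x) :
    (digitExpr tt j r).natEval W ρ = digit W tt j x := by
  simp [digitExpr, powExpr_natEval, digit, h]

theorem digitExpr_fits {D : Family} {G : Layout} {tt : ℕ} (S : Setting D G tt) (j r : ℕ)
    (ρ : ℕ → ℕ) : (digitExpr tt j r).Fits G.W ρ := by
  have hpow : G.W ^ (tt - 1 - j) < cap G.W :=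
    (Nat.pow_le_pow_right S.W_pos (by omega)).trans_lt (S.B_eq ▸ S.B_lt)
  simp [digitExpr, powExpr_fits ρ S.W_pos hpow]

section Levels

local notation "rIndex" => 2
local notation "rNode" => 3
local notation "rDigit" => 4
local notation "rBits" => 5
local notation "rChild" => 6

/-- Marks the digit of the current element in the bitmap of its node. -/
def bitSet (tt j : ℕ) : Cmd :=
  .ld rNode aNode (reg rIndex) ;; .ld rDigit aElem (reg rIndex) ;;
  .set rDigit (digitExpr tt j rDigit) ;; .ld rBits (aBits j) (reg rNode) ;;
  .st (aBits j) (reg rNode) (bin .or (reg rBits) (bin .shl (const 1) (reg rDigit)))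

/-- Computes the first child of the node after the current one. -/
def childSet (j : ℕ) : Cmd :=
  .ld rNode (aChild j) (reg rIndex) ;; .ld rDigit (aBits j) (reg rIndex) ;;
  .st (aChild j) (reg rIndex + const 1) (reg rNode + bin .rank (reg rDigit) wordSize)

/-- Moves the current element to its node of the next level. -/
def nodeSet (tt j : ℕ) : Cmd :=
  .ld rNode aNode (reg rIndex) ;; .ld rDigit aElem (reg rIndex) ;;
  .set rDigit (digitExpr tt j rDigit) ;; .ld rBits (aBits j) (reg rNode) ;;
  .ld rChild (aChild j) (reg rNode) ;;
  .st aNode (reg rIndex) (reg rChild + bin .rank (reg rBits) (reg rDigit))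

/-- Builds the level `j`. -/
def level (tt j : ℕ) : Cmd :=
  .for rIndex rElems (bitSet tt j) ;; .for rIndex rNodes (childSet j) ;;
  .for rIndex rElems (nodeSet tt j)

/-- Builds the first `j` levels. -/
def levels (tt : ℕ) : ℕ → Cmd
  | 0 => .skip
  | j + 1 => levels tt j ;; level tt j

/-- A bound for the time per element that is spent on the level `j`. -/
def levelCost (tt j : ℕ) : ℕ :=
  (bitSet tt j).cost + 2 * (childSet j).cost + (nodeSet tt j).cost + 32

/-- The arrays hold the bitmaps and the first children of the nodes of the level `j`. -/
structure LevelTables (D : Family) (G : Layout) (tt : ℕ) (σ : Store) (j : ℕ) : Prop where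
  bits : σ.Holds (aBits j) (2 * D.n + 1) (D.bits G.W tt j)
  child : σ.Holds (aChild j) (2 * D.n + 1) (firstChild G.W (D.bits G.W tt j))

variable {D : Family} {G : Layout} {tt j j' r q : ℕ} {σ σ' : Store}

theorem lt_of_mem_regs_level (h : r ∈ (level tt j).regs) : r < 100 := by
  simp only [level, bitSet, childSet, nodeSet, Cmd.regs, Cmd.mem_regs_for, List.mem_append,
    List.append_nil, List.cons_append, List.nil_append, List.mem_cons, List.not_mem_nil, or_false,
    or_self_left] at h
  omega

theorem mem_arrs_level (h : q ∈ (level tt j).arrs) : q = aNode ∨ q = aBits j ∨ q = aChild j := by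
  simp only [level, bitSet, childSet, nodeSet, Cmd.arrs, Cmd.arrs_for, List.nil_append,
    List.cons_append, List.mem_cons, List.not_mem_nil, or_false] at h
  omega

theorem lt_of_mem_regs_levels (h : r ∈ (levels tt j).regs) : r < 100 := by
  induction j with
  | zero => simp [levels, Cmd.regs] at h
  | succ j ih =>
    rw [levels, Cmd.regs, List.mem_append] at h
    exact h.elim ih lt_of_mem_regs_level

theorem mem_arrs_levels (h : q ∈ (levels tt j).arrs) : 13 ≤ q ∧ q < aBits j := by
  induction j with
  | zero => simp [levels, Cmd.arrs] at h
  | succ j ih =>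
    rw [levels, Cmd.arrs, List.mem_append] at h
    rcases h with h | h
    · have := ih h
      omega
    · have := mem_arrs_level h
      omega

theorem LevelTables.of_frame {c : Cmd} (h : LevelTables D G tt σ j) (hframe : c.Frame σ σ')
    (hbits : aBits j ∉ c.arrs) (hchild : aChild j ∉ c.arrs) : LevelTables D G tt σ' j :=
  ⟨hframe.holds hbits h.bits, hframe.holds hchild h.child⟩

theorem levelBits_does (S : Setting D G tt) (hσ : Consts D G σ) (hj : j < tt)
    (helem : σ.Holds aElem D.n D.elem) (hnode : σ.Holds aNode D.n (D.node G.W tt j))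
    (hbits : σ.Holds (aBits j) (2 * D.n + 1) 0) :
    Does G (.for rIndex rElems (bitSet tt j)) (((bitSet tt j).cost + 8) * D.n + 6) σ fun σ' =>
      σ'.Holds (aBits j) (2 * D.n + 1) (D.bits G.W tt j) := by
  have := S.le_cap
  have := S.two_n_lt
  have := S.n_add_k_lt
  have := S.arrays_eq
  refine (Does.for (fun e σ' => σ'.Holds (aBits j) (2 * D.n + 1)
      fun u => bitsUpTo (D.node G.W tt j) (fun e => digit G.W tt j (D.elem e)) u e)
    (fun _ => (bitSet tt j).cost) hσ.elems (by simp [bitSet, Cmd.regs])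
    (by simp [bitSet, Cmd.regs]) (by omega) hbits fun e he σ₁ hframe hindex h => ?_).mono
    (by simp; ring_nf; omega) fun _ _ h => h
  have hσ₁ := hσ.frame hframe (by simp [bitSet, Cmd.regs])
  have helem_e := hframe.holds (by simp [bitSet, Cmd.arrs]; omega) helem e he
  have hnode_e := hframe.holds (by simp [bitSet, Cmd.arrs]; omega) hnode e he
  have hlt := Family.node_lt (tt := tt) S.W_pos (j := j) he
  have hbits_e : σ₁.arr (aBits j) (D.node G.W tt j e) = bitsUpTo (D.node G.W tt j)
      (fun e => digit G.W tt j (D.elem e)) (D.node G.W tt j e) e := h _ (by omega)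
  have hdigit (ρ : ℕ → ℕ) (hρ : ρ rDigit = D.elem e) :
      (digitExpr tt j rDigit).natEval G.W ρ = digit G.W tt j (D.elem e) := digitExpr_natEval hρ
  have hpow : 2 ^ digit G.W tt j (D.elem e) < cap G.W :=
    Nat.pow_lt_pow_right (by norm_num) (digit_lt S.W_pos _ _ _)
  generalize hv : bitsUpTo (D.node G.W tt j) (fun e => digit G.W tt j (D.elem e))
    (D.node G.W tt j e) e = v at hbits_e
  refine Does.of_wp_eq (((((σ₁.put rNode (D.node G.W tt j e)).put rDigit (D.elem e)).put rDigit
    (digit G.W tt j (D.elem e))).put rBits v).write (aBits j) (D.node G.W tt j e)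
    (v ||| 2 ^ digit G.W tt j (D.elem e))) le_rfl ?_ ?_
  · simp [bitSet, Cmd.wp, hindex, hσ₁.base, helem_e, hnode_e, hbits_e, hdigit, digitExpr_fits S]
    omega
  · simp only [Store.holds_put]
    refine Store.Holds.write (f := _) (by simpa using h) (fun u _ hne => ?_) fun _ => ?_
    · rw [bitsUpTo, if_neg hne.symm]
    · rw [bitsUpTo, if_pos rfl, hv]

theorem levelChildren_does (S : Setting D G tt) (hσ : Consts D G σ) (hj : j < tt)
    (hbits : σ.Holds (aBits j) (2 * D.n + 1) (D.bits G.W tt j))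
    (hzero : σ.arr (aChild j) 0 = 0) :
    Does G (.for rIndex rNodes (childSet j)) (((childSet j).cost + 8) * (2 * D.n) + 6) σ fun σ' =>
      σ'.Holds (aChild j) (2 * D.n + 1) (firstChild G.W (D.bits G.W tt j)) := by
  have := S.le_cap
  have := S.two_n_lt
  have := S.n_add_k_lt
  have := S.arrays_eq
  refine (Does.for (fun u σ' => σ'.Holds (aChild j) (u + 1) (firstChild G.W (D.bits G.W tt j)))
    (fun _ => (childSet j).cost) hσ.nodes (by simp [childSet, Cmd.regs])
    (by simp [childSet, Cmd.regs]) (by omega) (fun u hu => ?_)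
    fun u hu σ₁ hframe hindex h => ?_).mono (by simp; ring_nf; omega) fun _ _ h => h
  · obtain rfl : u = 0 := by omega
    exact hzero
  have hσ₁ := hσ.frame hframe (by simp [childSet, Cmd.regs])
  have hbits_u := hframe.holds (by simp [childSet, Cmd.arrs]) hbits u (by omega)
  have := (D.trieLevel S.W_pos tt j).firstChild_le (u + 1)
  have hsucc := firstChild_succ G.W (D.bits G.W tt j) u
  refine Does.of_wp_eq (((σ₁.put rNode (firstChild G.W (D.bits G.W tt j) u)).put rDigit
    (D.bits G.W tt j u)).write (aChild j) (u + 1) (firstChild G.W (D.bits G.W tt j) (u + 1)))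
    le_rfl ?_ (by simpa using h.write_succ rfl)
  simp [childSet, Cmd.wp, hindex, hσ₁.base, hbits_u, h u (Nat.lt_succ_self u), hsucc]
  omega

theorem levelNodes_does (S : Setting D G tt) (hσ : Consts D G σ) (hj : j < tt)
    (helem : σ.Holds aElem D.n D.elem) (hnode : σ.Holds aNode D.n (D.node G.W tt j))
    (htables : LevelTables D G tt σ j) :
    Does G (.for rIndex rElems (nodeSet tt j)) (((nodeSet tt j).cost + 8) * D.n + 6) σ fun σ' =>
      σ'.Holds aNode D.n (D.node G.W tt (j + 1)) := by
  have := S.le_cap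
  have := S.two_n_lt
  have := S.n_add_k_lt
  have := S.arrays_eq
  refine (Does.for (fun e σ' => σ'.Holds aNode D.n
      fun e' => if e' < e then D.node G.W tt (j + 1) e' else D.node G.W tt j e')
    (fun _ => (nodeSet tt j).cost) hσ.elems (by simp [nodeSet, Cmd.regs])
    (by simp [nodeSet, Cmd.regs]) (by omega) (by simpa using hnode)
    fun e he σ₁ hframe hindex h => ?_).mono (by simp; ring_nf; omega)
    fun _ _ h e he => (h e he).trans (if_pos he)
  have hσ₁ := hσ.frame hframe (by simp [nodeSet, Cmd.regs])
  have htables₁ := htables.of_frame hframe (by simp [nodeSet, Cmd.arrs]; omega)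
    (by simp [nodeSet, Cmd.arrs]; omega)
  have helem_e := hframe.holds (by simp [nodeSet, Cmd.arrs]) helem e he
  have hnode_e : σ₁.arr aNode e = D.node G.W tt j e := (h e he).trans (if_neg (lt_irrefl e))
  have hlt := Family.node_lt (tt := tt) S.W_pos (j := j) he
  have hlt' := Family.node_lt (tt := tt) S.W_pos (j := j + 1) he
  have hbits_e := htables₁.bits (D.node G.W tt j e) (by omega)
  have hchild_e := htables₁.child (D.node G.W tt j e) (by omega)
  have hsucc := D.node_succ G.W tt j e
  rw [child] at hsucc
  have hdigit (ρ : ℕ → ℕ) (hρ : ρ rDigit = D.elem e) :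
      (digitExpr tt j rDigit).natEval G.W ρ = digit G.W tt j (D.elem e) := digitExpr_natEval hρ
  refine Does.of_wp_eq ((((((σ₁.put rNode (D.node G.W tt j e)).put rDigit (D.elem e)).put rDigit
    (digit G.W tt j (D.elem e))).put rBits (D.bits G.W tt j (D.node G.W tt j e))).put rChild
    (firstChild G.W (D.bits G.W tt j) (D.node G.W tt j e))).write aNode e
    (D.node G.W tt (j + 1) e)) le_rfl ?_ ?_
  · simp [nodeSet, Cmd.wp, hindex, hσ₁.base, helem_e, hnode_e, hbits_e, hchild_e, hdigit,
      digitExpr_fits S, hsucc]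
    omega
  · simp only [Store.holds_put]
    refine Store.Holds.write (f := _) (by simpa using h) (fun e' _ hne => ?_) fun _ => ?_
    · simp only [Nat.lt_succ_iff_lt_or_eq, hne, or_false]
    · rw [if_pos (Nat.lt_succ_self e)]

theorem level_does (S : Setting D G tt) (hσ : Consts D G σ) (hj : j < tt)
    (helem : σ.Holds aElem D.n D.elem) (hnode : σ.Holds aNode D.n (D.node G.W tt j))
    (hbits : σ.Holds (aBits j) (2 * D.n + 1) 0) (hchild : σ.arr (aChild j) 0 = 0) :
    Does G (level tt j) (levelCost tt j * D.n + 18) σ fun σ' =>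
      σ'.Holds aNode D.n (D.node G.W tt (j + 1)) ∧ LevelTables D G tt σ' j := by
  refine ((levelBits_does S hσ hj helem hnode hbits).seq fun σ₁ hframe₁ hbits₁ => ?_ :
    Does G _ (((bitSet tt j).cost + 8) * D.n + 6 + (((childSet j).cost + 8) * (2 * D.n) + 6 +
      (((nodeSet tt j).cost + 8) * D.n + 6))) σ _).mono
    (by rw [levelCost]; ring_nf; rfl) fun _ _ h => h
  have hσ₁ := hσ.frame hframe₁ (by simp [bitSet, Cmd.regs])
  have helem₁ := hframe₁.holds (by simp [bitSet, Cmd.arrs]; omega) helem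
  have hnode₁ := hframe₁.holds (by simp [bitSet, Cmd.arrs]; omega) hnode
  have hchild₁ : σ₁.arr (aChild j) 0 = 0 := by
    rw [hframe₁.arr _ (by simp [bitSet, Cmd.arrs]), hchild]
  refine (levelChildren_does S hσ₁ hj hbits₁ hchild₁).seq fun σ₂ hframe₂ hchild₂ => ?_
  have htables : LevelTables D G tt σ₂ j :=
    ⟨hframe₂.holds (by simp [childSet, Cmd.arrs]) hbits₁, hchild₂⟩
  refine (levelNodes_does S (hσ₁.frame hframe₂ (by simp [childSet, Cmd.regs])) hj
    (hframe₂.holds (by simp [childSet, Cmd.arrs]; omega) helem₁)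
    (hframe₂.holds (by simp [childSet, Cmd.arrs]; omega) hnode₁) htables).mono le_rfl
    fun σ₃ hframe₃ hnode₃ => ⟨hnode₃, htables.of_frame hframe₃ ?_ ?_⟩
  all_goals
    simp [nodeSet, Cmd.arrs]
    omega

theorem levels_does (S : Setting D G tt) (hσ : Consts D G σ) (helem : σ.Holds aElem D.n D.elem)
    (hnode : σ.Holds aNode D.n (D.node G.W tt 0))
    (hzero : ∀ q, 14 ≤ q → σ.Holds q (2 * D.n + 1) 0) (hj : j ≤ tt) :
    Does G (levels tt j) (1 + ∑ j' ∈ range j, (levelCost tt j' * D.n + 18)) σ fun σ' =>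
      σ'.Holds aNode D.n (D.node G.W tt j) ∧ ∀ j' < j, LevelTables D G tt σ' j' := by
  induction j with
  | zero => exact .skip ⟨hnode, by simp⟩
  | succ j ih =>
    rw [sum_range_succ, ← Nat.add_assoc]
    refine (ih (by omega)).seq fun σ₁ hframe₁ ⟨hnode₁, htables₁⟩ => ?_
    have hσ₁ := hσ.frame hframe₁ fun _ => lt_of_mem_regs_levels
    have hkeep {q : ℕ} (hq : q < 13 ∨ aBits j ≤ q) : q ∉ (levels tt j).arrs := fun h => by
      have := mem_arrs_levels h
      omega
    have hbits := hframe₁.holds (hkeep (.inr le_rfl)) (hzero (aBits j) (by omega))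
    have hchild := hframe₁.holds (hkeep (.inr (by omega))) (hzero (aChild j) (by omega)) 0
      (by omega)
    refine (level_does S hσ₁ (by omega) (hframe₁.holds (hkeep (.inl (by decide))) helem) hnode₁
      hbits hchild).mono le_rfl fun σ₂ hframe₂ ⟨hnode₂, htables₂⟩ => ⟨hnode₂, fun j' hj' => ?_⟩
    obtain hlt | rfl := Nat.lt_succ_iff_lt_or_eq.1 hj'
    · refine (htables₁ j' hlt).of_frame hframe₂ (fun h => ?_) fun h => ?_
      all_goals
        have := mem_arrs_level h
        omega
    · exact htables₂

end Levels

/-! ## Queries -/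

section Query

local notation "rBits" => 7
local notation "rChild" => 8
local notation "rDigit" => 9

/-- Sets the registers that are needed to access the tables. -/
def queryStart (tt : ℕ) : Cmd :=
  .inp rBase (const 0) ;; .inp rSets (const 1) ;; .set rBlockSize (powExpr tt) ;;
  .set rJumps (sizeExpr rSets)

/-- Descends from the level `j` to the next level. -/
def queryLevel (tt j : ℕ) : Cmd :=
  .ld rBits (aBits j) (reg rQueryNode) ;; .ld rChild (aChild j) (reg rQueryNode) ;;
  .set rDigit (digitExpr tt j rQuery) ;;
  .set rQueryNode (reg rChild + reg rQueryFlag * bin .rank (reg rBits) (reg rDigit)) ;;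
  .set rQueryFlag (reg rQueryFlag * bin .and (bin .shr (reg rBits) (reg rDigit)) (const 1))

/-- Descends through the first `j` levels. -/
def queryLevels (tt : ℕ) : ℕ → Cmd
  | 0 => .skip
  | j + 1 => queryLevels tt j ;; queryLevel tt j

/-- The query program; the answer is put into the register `0`. -/
def query (tt : ℕ) : Cmd :=
  queryStart tt ;; topFind ;; queryLevels tt tt ;;
  .set 0 (reg rQueryNode + reg rQueryFlag - reg rQueryOffset)

/-- A bound for the time of a query. -/
def queryCost (tt : ℕ) : ℕ := (queryStart tt).cost + (200 + ((queryLevels tt tt).cost + 6))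

variable {D : Family} {G : Layout} {tt i x j r : ℕ} {p : Prop} {σ : Store}

theorem lt_of_mem_regs_queryLevels (h : r ∈ (queryLevels tt j).regs) : r < 100 := by
  induction j with
  | zero => simp [queryLevels, Cmd.regs] at h
  | succ j ih =>
    rw [queryLevels, Cmd.regs, List.mem_append] at h
    refine h.elim ih fun h => ?_
    simp [queryLevel, Cmd.regs] at h
    omega

theorem queryLevels_arrs (tt j : ℕ) : (queryLevels tt j).arrs = [] := by
  induction j with
  | zero => rfl
  | succ j ih => simp [queryLevels, Cmd.arrs, ih, queryLevel]

theorem query_arrs (tt : ℕ) : (query tt).arrs = [] := by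
  have htop : topFind.arrs = [] := by decide
  simp [query, queryStart, Cmd.arrs, queryLevels_arrs, htop]

theorem shiftRight_mod_two (v d : ℕ) : v >>> d % 2 = if v.testBit d = true then 1 else 0 := by
  rw [Nat.testBit, Nat.one_and_eq_mod_two]
  rcases Nat.mod_two_eq_zero_or_one (v >>> d) with h | h <;> simp [h]

theorem queryStart_does (S : Setting D G tt) (hbase : G.inp 0 = G.inputLen) :
    Does G (queryStart tt) (queryStart tt).cost σ (Access D G) := by
  have := S.le_cap
  have := S.inputLen_eq
  have := S.n_add_k_lt
  have hpow : G.W ^ tt < cap G.W := S.B_eq ▸ S.B_lt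
  have hsize (ρ : ℕ → ℕ) (hρ : ρ rSets = D.k) : (sizeExpr rSets).natEval G.W ρ = D.k.size := by
    rw [sizeExpr_natEval (by omega), hρ]
  refine Does.of_wp_eq ((((σ.put rBase G.inputLen).put rSets D.k).put rBlockSize D.B).put rJumps
    D.k.size) le_rfl ?_ ⟨by simp, by simp, by simp⟩
  simp [queryStart, Cmd.wp, hbase, S.inp_sets, powExpr_natEval, powExpr_fits _ S.W_pos hpow, hsize,
    S.B_eq]
  omega

theorem queryLevel_does [Decidable p] (S : Setting D G tt) (hσ : Access D G σ) (hj : j < tt)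
    (htables : LevelTables D G tt σ j) (hreached : D.Reached G.W tt i x j r p)
    (h : Located D σ i x r p) :
    Does G (queryLevel tt j) (queryLevel tt j).cost σ fun σ' =>
      Located D σ' i x (descend G.W (D.bits G.W tt j) r (digit G.W tt j x) p)
        (p ∧ (D.bits G.W tt j r).testBit (digit G.W tt j x) = true) := by
  have := S.le_cap
  have := S.two_n_lt
  have := S.arrays_eq
  have := hreached.1
  have hbits := htables.bits r (by omega)
  have hchild := htables.child r (by omega)
  have hle := (hreached.succ S.W_pos hj).1
  have hdigit (ρ : ℕ → ℕ) (hρ : ρ rQuery = x) :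
      (digitExpr tt j rQuery).natEval G.W ρ = digit G.W tt j x := digitExpr_natEval hρ
  obtain ⟨hquery, hoffset, hnode, hflag⟩ := h
  generalize digit G.W tt j x = d at *
  unfold descend child at *
  refine Does.of_wp_eq (((((σ.put rBits (D.bits G.W tt j r)).put rChild
    (firstChild G.W (D.bits G.W tt j) r)).put rDigit d).put rQueryNode
    (firstChild G.W (D.bits G.W tt j) r + rank (D.bits G.W tt j r) (if p then d else 0))).put
    rQueryFlag (if p ∧ (D.bits G.W tt j r).testBit d = true then 1 else 0)) le_rfl ?_
    ⟨by simpa, by simpa, by simp, by simp⟩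
  by_cases hp : p
  · simp only [hp, if_true, true_and] at hflag hle ⊢
    simp [queryLevel, Cmd.wp, hσ.base, hnode, hbits, hchild, hdigit, digitExpr_fits S, hquery,
      hflag, shiftRight_mod_two]
    split_ifs <;> omega
  · simp only [hp, if_false, false_and] at hflag hle ⊢
    simp [queryLevel, Cmd.wp, hσ.base, hnode, hbits, hchild, hdigit, digitExpr_fits S, hquery,
      hflag, rank]
    omega

theorem queryLevels_does (S : Setting D G tt) (hσ : Access D G σ) (hj : j ≤ tt)
    (htables : ∀ j' < j, LevelTables D G tt σ j') (hreached : D.Reached G.W tt i x 0 r p)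
    (h : Located D σ i x r p) :
    Does G (queryLevels tt j) (queryLevels tt j).cost σ fun σ' =>
      ∃ r' p', D.Reached G.W tt i x j r' p' ∧ Located D σ' i x r' p' := by
  classical
  induction j with
  | zero => exact .skip ⟨r, p, hreached, h⟩
  | succ j ih =>
    refine (ih (by omega) fun j' hj' => htables j' (by omega)).seq
      fun σ₁ hframe₁ ⟨r₁, p₁, hreached₁, h₁⟩ => ?_
    have hσ₁ := hσ.frame hframe₁ fun _ => lt_of_mem_regs_queryLevels
    have htables₁ := (htables j (Nat.lt_succ_self j)).of_frame hframe₁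
      (by simp [queryLevels_arrs]) (by simp [queryLevels_arrs])
    exact (queryLevel_does S hσ₁ hj htables₁ hreached₁ h₁).mono le_rfl
      fun _ _ h₂ => ⟨_, _, hreached₁.succ S.W_pos hj, h₂⟩

theorem queryAnswer_does (S : Setting D G tt) (hσ : Access D G σ) (hi : i < D.k)
    (htables : ∀ j < tt, LevelTables D G tt σ j) (hreached : D.Reached G.W tt i x 0 r p)
    (h : Located D σ i x r p) :
    Does G (queryLevels tt tt ;; .set 0 (reg rQueryNode + reg rQueryFlag - reg rQueryOffset))
      ((queryLevels tt tt).cost + 6) σ fun σ' =>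
        σ'.regs 0 = #{e ∈ range D.n | D.owner e = i ∧ D.elem e ≤ x} := by
  classical
  have := S.le_cap
  have := S.n_add_k_lt
  have := D.offset_le hi.le
  have hcount : #{e ∈ range D.n | D.owner e = i ∧ D.elem e ≤ x} ≤ D.n :=
    (card_filter_le _ _).trans (card_range _).le
  obtain ⟨t, rfl⟩ : ∃ t, tt = t + 1 := ⟨tt - 1, by have := S.tt_pos; omega⟩
  have hlevels : Does G (queryLevels (t + 1) (t + 1)) (queryLevels (t + 1) (t + 1)).cost σ fun σ' =>
      σ'.regs rQueryNode + σ'.regs rQueryFlag =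
        D.offset i + #{e ∈ range D.n | D.owner e = i ∧ D.elem e ≤ x} ∧
      σ'.regs rQueryOffset = D.offset i := by
    refine (queryLevels_does S hσ t.le_succ (fun j hj => htables j (by omega)) hreached h).seq
      fun σ₁ hframe₁ ⟨r₁, p₁, hreached₁, h₁⟩ => ?_
    have hσ₁ := hσ.frame hframe₁ fun _ => lt_of_mem_regs_queryLevels
    have htables₁ := (htables t (Nat.lt_succ_self t)).of_frame hframe₁
      (by simp [queryLevels_arrs]) (by simp [queryLevels_arrs])
    refine (queryLevel_does S hσ₁ t.lt_succ_self htables₁ hreached₁ h₁).mono le_rfl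
      fun σ₂ _ h₂ => ⟨?_, h₂.offset⟩
    rw [h₂.node, h₂.flag, ← hreached₁.answer S.W_pos S.B_eq rfl hi]
    congr
  refine hlevels.seq fun σ₁ _ ⟨hsum, hoffset⟩ => ?_
  refine Does.of_wp_eq (σ₁.put 0 #{e ∈ range D.n | D.owner e = i ∧ D.elem e ≤ x}) (by decide) ?_
    (by simp)
  simp [Cmd.wp, hsum, hoffset]
  omega

theorem query_does (S : Setting D G tt) (hbase : G.inp 0 = G.inputLen) (h : TopTables D σ)
    (htables : ∀ j < tt, LevelTables D G tt σ j) (hi : i < D.k) (hx : x ≤ D.N)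
    (hset : σ.regs rQuerySet = i) (hquery : σ.regs rQuery = x) :
    Does G (query tt) (queryCost tt) σ fun σ' =>
      σ'.regs 0 = #{e ∈ range D.n | D.owner e = i ∧ D.elem e ≤ x} := by
  refine (queryStart_does S hbase).seq fun σ₁ hframe₁ hσ₁ => ?_
  have hregs {r : ℕ} (hr : r < 100) : σ₁.regs r = σ.regs r :=
    hframe₁.regs r (by simp [queryStart, Cmd.regs]; omega)
  refine (topFind_does S hσ₁ (h.of_frame hframe₁ (by simp [queryStart, Cmd.arrs])) hi hx
    ((hregs (by decide)).trans hset) ((hregs (by decide)).trans hquery)).seq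
    fun σ₂ hframe₂ h₂ => ?_
  have htopFind : topFind.arrs = [] := by decide
  refine queryAnswer_does S (hσ₁.frame hframe₂ (by decide)) hi (fun j hj => ?_)
    (Family.reached_zero S.B_eq hi hx) h₂
  exact ((htables j hj).of_frame hframe₁ (by simp [queryStart, Cmd.arrs])
    (by simp [queryStart, Cmd.arrs])).of_frame hframe₂ (by simp [htopFind]) (by simp [htopFind])

end Query

/-! ## The programs -/

/-- Computes the tables for the upper levels of the tries. -/
def topTables : Cmd := meets ;; lasts ;; births ;; tops ;; jumps

/-- Computes all tables. -/
def preproc (tt : ℕ) : Cmd := setup tt ;; lists ;; topTables ;; nodes ;; levels tt tt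

/-- The factor in the bound for the running time of the preprocessing. -/
def preprocCost (tt : ℕ) : ℕ :=
  700 + (setupParams tt).cost + ∑ j ∈ range tt, (levelCost tt j + 18)

section

variable {D : Family} {G : Layout} {tt i x : ℕ} {σ : Store} {m : ℕ → ℕ}

theorem topTables_does (S : Setting D G tt) (hσ : Consts D G σ) (hlists : ListsHeld D σ D.k D.n)
    (hmeet : σ.Holds aMeet D.M fun _ => 0) (hlast : σ.Holds aLast D.M fun _ => 0) :
    Does G topTables (328 * D.n + 277 * D.k + (208 * D.k.size + 243) * (D.M + 1) + 43) σ
      (TopTables D) := by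
  refine (((meets_does S hσ hlists.elem hlists.owner hlists.first hmeet).seq
    fun σ₁ hframe₁ ⟨hfirst₁, hmeet₁⟩ => ?_ :
    Does G _ (78 * D.n + 6 + 9 + (27 * D.k + 6 + (81 * (D.M + 1) + 10 +
      (42 * (D.M + 1) + 42 * (D.n + D.k) + 6 +
      (208 * (D.n + D.k) + (208 * D.k.size + 120) * (D.M + 1) + 6))))) σ _)).mono
    (by ring_nf; omega) fun _ _ h => h
  have hσ₁ := hσ.frame hframe₁ (by decide)
  refine (lasts_does S hσ₁ hfirst₁ (hframe₁.holds (by decide) hlast)).seq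
    fun σ₂ hframe₂ hlast₂ => ?_
  have hσ₂ := hσ₁.frame hframe₂ (by decide)
  refine (births_does S hσ₂ (hframe₂.holds (by decide) hmeet₁) hlast₂).seq
    fun σ₃ hframe₃ hbirths₃ => ?_
  have hσ₃ := hσ₂.frame hframe₃ (by decide)
  have hfree₃ := hframe₃.holds (by decide)
    (hframe₂.holds (by decide) (hframe₁.holds (by decide) hlists.free))
  refine (tops_does S hσ₃ hbirths₃ hfree₃).seq fun σ₄ hframe₄ htops₄ => ?_
  have hbirths₄ : BirthsHeld D σ₄ (D.M + 1) :=
    ⟨hframe₄.holds (by decide) hbirths₃.death, hframe₄.holds (by decide) hbirths₃.birth,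
      hframe₄.holds (by decide) hbirths₃.life⟩
  refine (jumps_does S (hσ₃.frame hframe₄ (by decide)) hbirths₄).mono le_rfl
    fun σ₅ hframe₅ hladders₅ => ⟨?_, ?_, hladders₅, fun b hb => ?_⟩
  · exact hframe₅.holds (by decide) (hframe₄.holds (by decide) (hframe₃.holds (by decide)
      (hframe₂.holds (by decide) (hframe₁.holds (by decide) hlists.offset))))
  · exact hframe₅.holds (by decide) (hframe₄.holds (by decide) (hframe₃.holds (by decide)
      (hframe₂.holds (by decide) hfirst₁)))
  · exact hframe₅.holdsFrom (by decide) (htops₄.before b hb)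

theorem preproc_does (S : Setting D G tt) (hN : G.inp 0 = D.N) (hzero : ∀ q u, σ.arr q u = 0) :
    Does G (preproc tt) (666 * D.n + 349 * D.k + (208 * D.k.size + 243) * (D.M + 1) + 70 +
      (setupParams tt).cost + ∑ j ∈ range tt, (levelCost tt j * D.n + 18)) σ fun σ' =>
      σ'.regs rBase = G.inputLen ∧ TopTables D σ' ∧ ∀ j < tt, LevelTables D G tt σ' j := by
  refine ((setup_does S hN).seq fun σ₁ hframe₁ hσ₁ => ?_ : Does G _ (18 * D.k + 12 +
    (setupParams tt).cost + (54 * D.k + 38 * D.n + 8 + (328 * D.n + 277 * D.k +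
      (208 * D.k.size + 243) * (D.M + 1) + 43 + (258 * D.n + 6 +
        (1 + ∑ j ∈ range tt, (levelCost tt j * D.n + 18)))))) σ _).mono (by omega) fun _ _ h => h
  have hzero₁ (q u : ℕ) : σ₁.arr q u = 0 := by rw [hframe₁.arr q List.not_mem_nil, hzero]
  refine (lists_does S hσ₁).seq fun σ₂ hframe₂ hlists₂ => ?_
  have hσ₂ := hσ₁.frame hframe₂ (by decide)
  refine (topTables_does S hσ₂ hlists₂ (hframe₂.holds (by decide) fun b _ => hzero₁ _ b)
    (hframe₂.holds (by decide) fun b _ => hzero₁ _ b)).seq fun σ₃ hframe₃ htop₃ => ?_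
  have hσ₃ := hσ₂.frame hframe₃ (by decide)
  have helem₃ := hframe₃.holds (by decide) hlists₂.elem
  refine (nodes_does S hσ₃ htop₃ helem₃ (hframe₃.holds (by decide) hlists₂.owner)).seq
    fun σ₄ hframe₄ hnode₄ => ?_
  have hσ₄ := hσ₃.frame hframe₄ (by decide)
  have hnotMem {c : Cmd} (hc : ∀ q ∈ c.arrs, q < 14) {q : ℕ} (hq : 14 ≤ q) : q ∉ c.arrs :=
    fun hmem => (hc q hmem).not_ge hq
  refine (levels_does S hσ₄ (hframe₄.holds (by decide) helem₃) hnode₄ (fun q hq => ?_) le_rfl).mono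
    le_rfl fun σ₅ hframe₅ ⟨_, htables₅⟩ => ⟨?_, ?_, htables₅⟩
  · exact hframe₄.holds (hnotMem (by decide) hq) (hframe₃.holds (hnotMem (by decide) hq)
      (hframe₂.holds (hnotMem (by decide) hq) fun u _ => hzero₁ q u))
  · exact (hσ₄.frame hframe₅ fun _ => lt_of_mem_regs_levels).base
  · exact (htop₃.of_frame hframe₄ (by decide)).of_frame hframe₅ fun _ hq => (mem_arrs_levels hq).1

theorem preproc_time_le (D : Family) (tt : ℕ) :
    666 * D.n + 349 * D.k + (208 * D.k.size + 243) * (D.M + 1) + 70 + (setupParams tt).cost +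
      ∑ j ∈ range tt, (levelCost tt j * D.n + 18) ≤
    preprocCost tt * ((D.M + 1) * (D.k.size + 1) + D.n + D.k) := by
  have hk := D.k_pos
  set size := (D.M + 1) * (D.k.size + 1) + D.n + D.k with hsize
  have hfixed : 666 * D.n + 349 * D.k + (208 * D.k.size + 243) * (D.M + 1) + 70 ≤ 700 * size := by
    rw [hsize]
    nlinarith [Nat.zero_le (D.M * D.k.size)]
  have hparams : (setupParams tt).cost ≤ (setupParams tt).cost * size :=
    Nat.le_mul_of_pos_right _ (by omega)
  have hlevels : ∑ j ∈ range tt, (levelCost tt j * D.n + 18) ≤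
      (∑ j ∈ range tt, (levelCost tt j + 18)) * size := by
    rw [sum_mul]
    refine sum_le_sum fun j _ => ?_
    rw [add_mul]
    exact Nat.add_le_add (Nat.mul_le_mul_left _ (by omega)) (by omega)
  have hcost : preprocCost tt * size = 700 * size + (setupParams tt).cost * size +
      (∑ j ∈ range tt, (levelCost tt j + 18)) * size := by
    rw [preprocCost, add_mul, add_mul]
  omega

/-- The preprocessing program.  In the end the length of the input is put into the first memory
cell, from which the queries read it. -/
def preprocStmt (tt : ℕ) : Stmt :=
  .seq ((preproc tt).toStmt (14 + 2 * tt)) (.store (const 0) (reg rBase))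

/-- The query program. -/
def queryStmt (tt : ℕ) : Stmt := (query tt).toStmt (14 + 2 * tt)

/-- The layout in which the first cell holds the length of the read-only region. -/
def withInputLen (G : Layout) : Layout := { G with inp := Function.update G.inp 0 G.inputLen }

theorem Setting.withInputLen (S : Setting D G tt) : Setting D (withInputLen G) tt := by
  have hinp {a : ℕ} (ha : a ≠ 0) : (PISNS.withInputLen G).inp a = G.inp a :=
    Function.update_of_ne ha ..
  exact
    { S with
      inp_sets := (hinp (by omega)).trans S.inp_sets
      inp_card := fun i hi => (hinp (by omega)).trans (S.inp_card i hi)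
      inp_elem := fun e he => (hinp (by omega)).trans (S.inp_elem e he) }

theorem represents_withInputLen {A : ℕ → ℕ → ℕ} (h : G.Represents m A) :
    (withInputLen G).Represents (Function.update m 0 G.inputLen) A := by
  refine ⟨fun a ha => ?_, fun q hq i hi => ?_⟩
  · by_cases hzero : a = 0
    · simp [hzero, withInputLen]
    · simp [hzero, withInputLen, h.inp a ha]
  · have := G.inputLen_pos
    rw [Function.update_of_ne (by change G.inputLen + _ ≠ 0; omega)]
    exact h.arr q hq i hi

theorem preprocStmt_exec (S : Setting D G tt) (hN : G.inp 0 = D.N)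
    (hinput : ∀ a < G.inputLen, m a = G.inp a) (hzero : ∀ a, G.inputLen ≤ a → m a = 0) :
    ∃ T ≤ preprocCost tt * ((D.M + 1) * (D.k.size + 1) + D.n + D.k) + 3, ∃ σ : Store, ∃ m',
      Exec G.W G.cells (preprocStmt tt) ⟨fun _ => 0, m⟩ T ⟨σ.regs, m'⟩ ∧
      (withInputLen G).Represents m' σ.arr ∧ TopTables D σ ∧
      ∀ j < tt, LevelTables D G tt σ j := by
  obtain ⟨T, hT, σ, m', hexec, hrep, _, _, hbase, htop, htables⟩ :=
    preproc_does S hN (σ := ⟨fun _ => 0, fun _ _ => 0⟩) (fun _ _ => rfl) m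
      ⟨hinput, fun _ _ _ _ => hzero _ (Nat.le_add_right _ _)⟩
  rw [S.arrays_eq] at hexec
  have hstore := Exec.store (W := G.W) (M := G.cells) (const 0) (reg rBase) ⟨σ.regs, m'⟩
    (by simpa [Expr.eval] using G.inputLen_pos.trans_le ((Nat.le_add_right _ _).trans G.le_cells))
  simp only [Expr.eval, Nat.zero_mod, hbase] at hstore
  exact ⟨T + 3, Nat.add_le_add_right (hT.trans (preproc_time_le D tt)) 3, σ, _, .seq hexec hstore,
    represents_withInputLen hrep, htop, htables⟩

theorem queryStmt_exec (S : Setting D G tt) (hm : (withInputLen G).Represents m σ.arr)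
    (htop : TopTables D σ) (htables : ∀ j < tt, LevelTables D G tt σ j) (hi : i < D.k)
    (hx : x ≤ D.N) :
    ∃ T ≤ queryCost tt, ∃ σ' : State, Exec G.W G.cells (queryStmt tt) (queryState m i x) T σ' ∧
      σ'.regs 0 = #{e ∈ range D.n | D.owner e = i ∧ D.elem e ≤ x} ∧ σ'.mem = m := by
  let σ₀ : Store := ⟨(queryState m i x).regs, σ.arr⟩
  have htop₀ : TopTables D σ₀ :=
    ⟨htop.offset, htop.first, ⟨htop.ladders.birth, htop.ladders.life, htop.ladders.jump,
      htop.ladders.ladder⟩, htop.top⟩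
  have htables₀ (j : ℕ) (hj : j < tt) : LevelTables D (withInputLen G) tt σ₀ j :=
    ⟨(htables j hj).bits, (htables j hj).child⟩
  obtain ⟨T, hT, σ', m', hexec, -, -, hmem, hanswer⟩ :=
    query_does S.withInputLen (by simp [withInputLen]) htop₀ htables₀ hi hx
      (by simp [σ₀, queryState]) (by simp [σ₀, queryState]) m hm
  rw [hmem (query_arrs tt)] at hexec
  rw [S.withInputLen.arrays_eq] at hexec
  exact ⟨T, hT, _, hexec, hanswer, rfl⟩

end

/-! ## The family of an instance -/

/-- The number of elements of the first `i` lists. -/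
def listOffset (Ls : List (List ℕ)) (i : ℕ) : ℕ := ∑ j ∈ range i, (Ls.getD j []).length

/-- The index of the list that contains the element at position `e` of the concatenation. -/
def listOwner (Ls : List (List ℕ)) (e : ℕ) : ℕ :=
  Nat.findGreatest (fun i => listOffset Ls i ≤ e) Ls.length

section

variable {Ls : List (List ℕ)} {e e' i r x : ℕ}

theorem listOffset_mono (Ls : List (List ℕ)) : Monotone (listOffset Ls) := fun _ _ h =>
  sum_le_sum_of_subset (range_mono h)

theorem listOffset_succ (Ls : List (List ℕ)) (i : ℕ) :
    listOffset Ls (i + 1) = listOffset Ls i + (Ls.getD i []).length :=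
  sum_range_succ _ _

theorem listOffset_cons_succ (l : List ℕ) (Ls : List (List ℕ)) (i : ℕ) :
    listOffset (l :: Ls) (i + 1) = l.length + listOffset Ls i := by
  rw [listOffset, sum_range_succ', add_comm]
  rfl

theorem listOffset_length (Ls : List (List ℕ)) :
    listOffset Ls Ls.length = Ls.flatten.length := by
  induction Ls with
  | nil => rfl
  | cons l Ls ih => rw [List.length_cons, listOffset_cons_succ, ih, List.flatten_cons,
      List.length_append]

theorem getD_flatten (Ls : List (List ℕ)) (hr : r < (Ls.getD i []).length) :
    Ls.flatten.getD (listOffset Ls i + r) 0 = (Ls.getD i [])[r] := by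
  induction Ls generalizing i with
  | nil => simp at hr
  | cons l Ls ih =>
    cases i with
    | zero =>
      simp only [List.getD_cons_zero] at hr ⊢
      rw [show listOffset (l :: Ls) 0 = 0 from rfl, Nat.zero_add, List.flatten_cons,
        List.getD_append _ _ _ _ hr, List.getD_eq_getElem _ _ hr]
    | succ i =>
      rw [listOffset_cons_succ, List.flatten_cons, List.getD_append_right _ _ _ _ (by omega),
        Nat.add_assoc, Nat.add_sub_cancel_left]
      exact ih hr

theorem listOwner_eq_iff (hi : i < Ls.length) :
    listOwner Ls e = i ↔ listOffset Ls i ≤ e ∧ e < listOffset Ls (i + 1) := by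
  rw [listOwner, Nat.findGreatest_eq_iff]
  constructor
  · rintro ⟨-, hle, hmax⟩
    refine ⟨?_, not_le.1 (hmax i.lt_succ_self hi)⟩
    rcases Nat.eq_zero_or_pos i with rfl | hpos
    · exact Nat.zero_le _
    · exact hle hpos.ne'
  · rintro ⟨hle, hlt⟩
    exact ⟨hi.le, fun _ => hle, fun j hj _ hje => hlt.not_ge ((listOffset_mono Ls hj).trans hje)⟩

theorem listOwner_lt (he : e < Ls.flatten.length) : listOwner Ls e < Ls.length := by
  refine (Nat.findGreatest_le _).lt_of_ne fun h => ?_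
  have hpos : Ls.length ≠ 0 := by
    rintro hnil
    simp [List.length_eq_zero_iff.1 hnil] at he
  have hle := ((Nat.findGreatest_eq_iff (P := fun i => listOffset Ls i ≤ e)).1 h).2.1 hpos
  rw [listOffset_length] at hle
  exact he.not_ge hle

theorem exists_eq_listOffset_add (he : e < Ls.flatten.length) :
    ∃ r, ∃ hr : r < (Ls.getD (listOwner Ls e) []).length,
      e = listOffset Ls (listOwner Ls e) + r ∧
      Ls.flatten.getD e 0 = (Ls.getD (listOwner Ls e) [])[r] := by
  obtain ⟨hle, hlt⟩ := (listOwner_eq_iff (listOwner_lt he)).1 rfl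
  rw [listOffset_succ] at hlt
  obtain ⟨r, hr⟩ := Nat.exists_eq_add_of_le hle
  have hr_lt : r < (Ls.getD (listOwner Ls e) []).length := by omega
  exact ⟨r, hr_lt, hr, by rw [← getD_flatten Ls hr_lt, ← hr]⟩

theorem mem_getD_iff (hi : i < Ls.length) :
    x ∈ Ls.getD i [] ↔
      ∃ e < Ls.flatten.length, listOwner Ls e = i ∧ Ls.flatten.getD e 0 = x := by
  constructor
  · intro hx
    obtain ⟨r, hr, rfl⟩ := List.getElem_of_mem hx
    have hlt : listOffset Ls i + r < listOffset Ls (i + 1) := by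
      rw [listOffset_succ]
      omega
    refine ⟨listOffset Ls i + r, ?_, (listOwner_eq_iff hi).2 ⟨Nat.le_add_right _ _, hlt⟩,
      getD_flatten Ls hr⟩
    exact hlt.trans_le ((listOffset_mono Ls hi).trans_eq (listOffset_length Ls))
  · rintro ⟨e, he, rfl, rfl⟩
    obtain ⟨r, hr, -, hget⟩ := exists_eq_listOffset_add he
    exact hget ▸ List.getElem_mem hr

theorem eq_of_listOwner_eq (hnodup : (Ls.getD (listOwner Ls e) []).Nodup)
    (he : e < Ls.flatten.length) (he' : e' < Ls.flatten.length)
    (howner : listOwner Ls e = listOwner Ls e')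
    (helem : Ls.flatten.getD e 0 = Ls.flatten.getD e' 0) : e = e' := by
  obtain ⟨r, hr, heq, hget⟩ := exists_eq_listOffset_add he
  obtain ⟨r', hr', heq', hget'⟩ := exists_eq_listOffset_add he'
  simp only [← howner] at hr' heq' hget'
  rw [heq, heq', (hnodup.getElem_inj_iff (hi := hr) (hj := hr')).1 (hget ▸ hget' ▸ helem)]

end

section

variable {k N : ℕ} {S : Fin k → Finset ℕ} {L : Fin k → List ℕ}

theorem IsInstance.mem_of_le_of_le (hI : IsInstance N S) {a b i : Fin k} (hai : a ≤ i) (hib : i ≤ b)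
    {x y : ℕ} (hx : x ∈ S a) (hy : y ∈ S b) (hyx : y ≤ x) : x ∈ S i := by
  obtain ⟨n, hmono, -, hsub, hshrink⟩ := hI.shrinking
  have hstep (j : ℕ) (haj : a ≤ j) : ∀ h : j < k, j ≤ b → x ∈ S ⟨j, h⟩ := by
    induction j, haj using Nat.le_induction with
    | base => exact fun _ _ => hx
    | succ j _ ih =>
      intro h hjb
      have hn : n ⟨j + 1, h⟩ ≤ x :=
        (hmono (show ⟨j + 1, h⟩ ≤ b from hjb)).trans ((mem_Icc.1 (hsub b hy)).1.trans hyx)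
      exact hshrink ⟨j, by omega⟩ _ rfl (mem_inter.2 ⟨ih (by omega) (by omega),
        mem_Icc.2 ⟨hn, (mem_Icc.1 (hsub a hx)).2⟩⟩)
  exact hstep i hai i.2 hib

theorem getD_ofFn (L : Fin k → List ℕ) (i : Fin k) : (List.ofFn L).getD i [] = L i := by
  rw [List.getD_eq_getElem _ _ (by simp), List.getElem_ofFn]

theorem Lists.mem_iff (hL : Lists L S) (i : Fin k) (x : ℕ) : x ∈ S i ↔
    ∃ e < (List.ofFn L).flatten.length, listOwner (List.ofFn L) e = i ∧
      (List.ofFn L).flatten.getD e 0 = x := by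
  rw [← (hL i).2, List.mem_toFinset, ← getD_ofFn L i, mem_getD_iff (by simp)]

theorem Lists.length_eq (hL : Lists L S) (i : Fin k) : (L i).length = #(S i) := by
  rw [← (hL i).2, List.toFinset_card_of_nodup (hL i).1]

theorem Lists.length_flatten (hL : Lists L S) : (List.ofFn L).flatten.length = ∑ i, #(S i) := by
  rw [List.length_flatten, List.map_ofFn, List.sum_ofFn]
  exact sum_congr rfl fun i _ => hL.length_eq i

theorem listOwner_ofFn_lt {e : ℕ} (he : e < (List.ofFn L).flatten.length) :
    listOwner (List.ofFn L) e < k := by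
  simpa using listOwner_lt he

/-- The family of an instance, with blocks of length `B`. -/
def Family.ofInstance (hI : IsInstance N S) (hL : Lists L S) (B : ℕ) : Family where
  N := N
  k := k
  n := (List.ofFn L).flatten.length
  B := B
  card i := ((List.ofFn L).getD i []).length
  elem e := (List.ofFn L).flatten.getD e 0
  owner := listOwner (List.ofFn L)
  k_pos := hI.pos
  card_pos i hi := by
    rw [getD_ofFn L ⟨i, hi⟩, hL.length_eq]
    exact Finset.card_pos.2 (hI.nonempty _)
  sum_card := (congrArg (listOffset _) List.length_ofFn.symm).trans (listOffset_length _)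
  owner_lt _ := listOwner_ofFn_lt
  owner_eq_iff e _ i hi := listOwner_eq_iff (by simpa using hi)
  elem_le e he := by
    obtain ⟨n, -, -, hsub, -⟩ := hI.shrinking
    have hmem := (hL.mem_iff ⟨_, listOwner_ofFn_lt he⟩ _).2 ⟨e, he, rfl, rfl⟩
    exact (mem_Icc.1 (hsub _ hmem)).2
  elem_inj e he e' he' howner helem :=
    eq_of_listOwner_eq (getD_ofFn L ⟨_, listOwner_ofFn_lt he⟩ ▸ (hL _).1) he he' howner helem
  nested e he e' he' i hle hle' helem :=
    have hlt := listOwner_ofFn_lt he'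
    (hL.mem_iff ⟨i, hle'.trans_lt hlt⟩ _).1 <|
      hI.mem_of_le_of_le (a := ⟨_, listOwner_ofFn_lt he⟩) (b := ⟨_, hlt⟩) hle hle'
        ((hL.mem_iff _ _).2 ⟨e, he, rfl, rfl⟩) ((hL.mem_iff _ _).2 ⟨e', he', rfl, rfl⟩) helem

theorem Family.card_ofInstance (hI : IsInstance N S) (hL : Lists L S) (B : ℕ)
    (i : Fin k) (x : ℕ) :
    #{e ∈ range (ofInstance hI hL B).n | (ofInstance hI hL B).owner e = i ∧
      (ofInstance hI hL B).elem e ≤ x} = predRank (S i) x := by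
  rw [predRank, ← card_image_of_injOn (f := (ofInstance hI hL B).elem)]
  · congr 1
    ext y
    simp only [mem_image, mem_filter, mem_range, hL.mem_iff]
    constructor
    · rintro ⟨e, ⟨he, howner, hle⟩, rfl⟩
      exact ⟨⟨e, he, howner, rfl⟩, hle⟩
    · rintro ⟨⟨e, he, howner, rfl⟩, hle⟩
      exact ⟨e, ⟨he, howner, hle⟩, rfl⟩
  · intro e he e' he' helem
    simp only [coe_filter, mem_range, Set.mem_ofPred_eq] at he he'
    exact (ofInstance hI hL B).elem_inj e he.1 e' he'.1 (he.2.1.trans he'.2.1.symm) helem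

theorem length_inputWords (N : ℕ) (L : Fin k → List ℕ) :
    (inputWords N L).length = 2 + k + (List.ofFn L).flatten.length := by
  simp only [inputWords, List.cons_append, List.length_cons, List.length_append, List.length_ofFn]
  omega

theorem inputWords_card (N : ℕ) (L : Fin k → List ℕ) {i : ℕ} (hi : i < k) :
    (inputWords N L).getD (2 + i) 0 = ((List.ofFn L).getD i []).length := by
  rw [getD_ofFn L ⟨i, hi⟩, inputWords, List.getD_append _ _ _ _ (by simp; omega), add_comm]
  simp [hi]

theorem inputWords_elem (N : ℕ) (L : Fin k → List ℕ) (e : ℕ) :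
    (inputWords N L).getD (2 + k + e) 0 = (List.ofFn L).flatten.getD e 0 := by
  have hlength : (N :: k :: List.ofFn fun i => (L i).length).length = 2 + k := by
    simp
    omega
  rw [inputWords, List.getD_append_right _ _ _ _ (by omega), hlength, Nat.add_sub_cancel_left]

end

/-! ## Time and space -/

/-- The length of the arrays. -/
def Family.width (D : Family) : ℕ := 2 * D.n + D.k + 1 + (D.M + 2) * (D.k.size + 1)

/-- The constant of the theorem; `W₀` is the largest word size that need not be supported. -/
def factor (tt W₀ : ℕ) : ℕ :=
  244 + (4 + (14 + 2 * tt) * 10) + (preprocCost tt * 10 + 3) + queryCost tt + 2 ^ (W₀ + 1)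

theorem Family.width_le {D : Family} {W p : ℕ} (hB : D.B = W ^ (p + 1)) (hW : 0 < W)
    (hsize : D.k.size ≤ W) : D.width ≤ 10 * (D.N / W ^ p + D.n) := by
  have hkn := D.k_le_n
  have hk := D.k_pos
  have hsize_le : D.k.size ≤ D.k := Nat.size_le.2 Nat.lt_two_pow_self
  have hblocks : D.N / D.B * (D.k.size + 1) ≤ 2 * (D.N / W ^ p) :=
    calc D.N / D.B * (D.k.size + 1) ≤ D.N / D.B * (2 * W) := Nat.mul_le_mul_left _ (by omega)
      _ = 2 * (D.N / W ^ p / W * W) := by rw [hB, pow_succ, Nat.div_div_eq_div_mul]; ring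
      _ ≤ 2 * (D.N / W ^ p) := Nat.mul_le_mul_left _ (Nat.div_mul_le_self _ _)
  have hwidth : D.width =
      2 * D.n + D.k + 1 + (D.N / D.B * (D.k.size + 1) + 3 * (D.k.size + 1)) := by
    rw [width, M]
    ring
  omega

theorem Family.le_width (D : Family) : (D.M + 1) * (D.k.size + 1) + D.n + D.k ≤ D.width := by
  have : (D.M + 1) * (D.k.size + 1) ≤ (D.M + 2) * (D.k.size + 1) :=
    Nat.mul_le_mul_right _ (by omega)
  rw [width]
  omega

theorem le_factor (tt W₀ : ℕ) :
    244 ≤ factor tt W₀ ∧ 4 + (14 + 2 * tt) * 10 ≤ factor tt W₀ ∧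
      preprocCost tt * 10 + 3 ≤ factor tt W₀ ∧ queryCost tt ≤ factor tt W₀ := by
  rw [factor]
  generalize 2 ^ (W₀ + 1) = q
  omega

theorem Family.space_le (D : Family) {size : ℕ} (W₀ tt : ℕ) (hn : D.n ≤ size)
    (hwidth : D.width ≤ 10 * size) :
    2 + D.k + D.n + (14 + 2 * tt) * D.width ≤ factor tt W₀ * size := by
  have hk := D.k_pos
  have hkn := D.k_le_n
  calc 2 + D.k + D.n + (14 + 2 * tt) * D.width
      ≤ 4 * size + (14 + 2 * tt) * (10 * size) :=
        Nat.add_le_add (by omega) (Nat.mul_le_mul_left _ hwidth)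
    _ = (4 + (14 + 2 * tt) * 10) * size := by ring
    _ ≤ factor tt W₀ * size := Nat.mul_le_mul_right _ (le_factor tt W₀).2.1

theorem Family.time_le (D : Family) {size : ℕ} (W₀ tt : ℕ) (hn : D.n ≤ size)
    (hwidth : D.width ≤ 10 * size) :
    preprocCost tt * ((D.M + 1) * (D.k.size + 1) + D.n + D.k) + 3 ≤ factor tt W₀ * size := by
  have hk := D.k_pos
  have hkn := D.k_le_n
  calc preprocCost tt * ((D.M + 1) * (D.k.size + 1) + D.n + D.k) + 3
      ≤ preprocCost tt * (10 * size) + 3 * size :=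
        Nat.add_le_add (Nat.mul_le_mul_left _ (D.le_width.trans hwidth)) (by omega)
    _ = (preprocCost tt * 10 + 3) * size := by ring
    _ ≤ factor tt W₀ * size := Nat.mul_le_mul_right _ (le_factor tt W₀).2.2.1

theorem exists_forall_pow_lt_two_pow (m : ℕ) : ∃ W₀, ∀ W ≥ W₀, W ^ m < 2 ^ W := by
  have hlim := tendsto_pow_const_div_const_pow_of_one_lt m (one_lt_two (α := ℝ))
  obtain ⟨W₀, hW₀⟩ := Filter.eventually_atTop.1 (hlim.eventually_lt_const one_pos)
  refine ⟨W₀, fun W hW => ?_⟩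
  exact_mod_cast (div_lt_one (by positivity)).1 (hW₀ W hW)

theorem lt_of_factor_mul_le {tt W₀ W n : ℕ} (hn : 1 ≤ n) (h : factor tt W₀ * n ≤ 2 ^ W) :
    W₀ < W := by
  have hpow : 2 ^ (W₀ + 1) ≤ 2 ^ W :=
    ((Nat.le_add_left _ _).trans (Nat.le_mul_of_pos_right _ hn)).trans h
  exact (Nat.pow_le_pow_iff_right one_lt_two).1 hpow

section

variable {k N W p W₀ cells : ℕ} {S : Fin k → Finset ℕ} {L : Fin k → List ℕ}

theorem IsInstance.one_le_sum_card (hI : IsInstance N S) : 1 ≤ ∑ i, #(S i) :=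
  (card_pos.2 (hI.nonempty ⟨0, hI.pos⟩)).trans_le
    (single_le_sum (f := fun i => #(S i)) (fun _ _ => Nat.zero_le _) (mem_univ _))

/-- The layout of a memory for a family: the input words, followed by the arrays. -/
def Family.layout (D : Family) (W cells tt : ℕ) (words : List ℕ)
    (hle : 2 + D.k + D.n + (14 + 2 * tt) * D.width ≤ cells) (hcells : cells ≤ cap W) : Layout where
  W := W
  cells := cells
  inputLen := 2 + D.k + D.n
  arrays := 14 + 2 * tt
  len := D.width
  inp a := words.getD a 0
  inputLen_pos := by omega
  le_cells := hle
  cells_le := hcells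

theorem Family.setting_layout {D : Family} {tt : ℕ} {words : List ℕ} (hB : D.B = W ^ tt)
    (hW : 0 < W) (htt : 0 < tt) (hpow : W ^ tt < cap W) (hcap : 244 * (D.N + D.n) ≤ cap W)
    (hwidth : D.width ≤ 10 * (D.N + D.n)) (hsets : words.getD 1 0 = D.k)
    (hcard : ∀ i < D.k, words.getD (2 + i) 0 = D.card i)
    (helem : ∀ e < D.n, words.getD (2 + D.k + e) 0 = D.elem e) (hle) (hcells) :
    Setting D (D.layout W cells tt words hle hcells) tt := by
  have hk := D.k_pos
  have hkn := D.k_le_n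
  have hlen : D.width = 2 * D.n + D.k + 1 + (D.M + 2) * (D.k.size + 1) := rfl
  have hblocks : D.M + 2 ≤ (D.M + 2) * (D.k.size + 1) := Nat.le_mul_of_pos_right _ (by omega)
  have hjumps : (D.M + 1) * D.k.size ≤ (D.M + 2) * (D.k.size + 1) :=
    Nat.mul_le_mul (by omega) (by omega)
  have two_n_lt : 2 * D.n < D.width := by omega
  have n_add_k_lt : D.n + D.k < D.width := by omega
  have M_lt : D.M + 1 < D.width := by omega
  have jumps_le : (D.M + 1) * D.k.size ≤ D.width := by omega
  have le_cap : 2 + D.k + D.n + 14 * D.width + 100 ≤ cap W := by omega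
  have N_lt : D.N < cap W := by omega
  exact
    { B_eq := hB
      W_pos := hW
      tt_pos := htt
      arrays_eq := rfl
      inputLen_eq := rfl
      two_n_lt
      n_add_k_lt
      M_lt
      jumps_le
      le_cap
      N_lt
      B_lt := hB ▸ hpow
      inp_sets := hsets
      inp_card := hcard
      inp_elem := helem }

theorem exists_exec (hW₀ : ∀ W ≥ W₀, W ^ (p + 1) < 2 ^ W) (hI : IsInstance N S) (hL : Lists L S)
    (hcap : factor (p + 1) W₀ * (N + ∑ i, #(S i)) ≤ 2 ^ W)
    (hspace : factor (p + 1) W₀ * (N / W ^ p + ∑ i, #(S i)) ≤ cells) (hcells : cells ≤ 2 ^ W) :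
    ∃ T ≤ factor (p + 1) W₀ * (N / W ^ p + ∑ i, #(S i)), ∃ σ : State,
      Exec W cells (preprocStmt (p + 1)) (inputState N L) T σ ∧
      ∀ (i : Fin k), ∀ x ≤ N, ∃ T' ≤ factor (p + 1) W₀, ∃ σ' : State,
        Exec W cells (queryStmt (p + 1)) (queryState σ.mem i x) T' σ' ∧
        σ'.regs 0 = predRank (S i) x ∧ σ'.mem = σ.mem := by
  obtain ⟨hcap_factor, -, -, hquery_factor⟩ := le_factor (p + 1) W₀
  have hn := hI.one_le_sum_card
  have hlt : W₀ < W := lt_of_factor_mul_le (hn.trans (Nat.le_add_left _ _)) hcap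
  have hW : 0 < W := by omega
  set D := Family.ofInstance hI hL (W ^ (p + 1))
  have hDn : D.n = ∑ i, #(S i) := hL.length_flatten
  rw [← hDn] at hn hcap hspace ⊢
  have hcap' : 244 * (N + D.n) ≤ cap W := (Nat.mul_le_mul_right _ hcap_factor).trans hcap
  have hkn := D.k_le_n
  have hwidth : D.width ≤ 10 * (N / W ^ p + D.n) :=
    Family.width_le rfl hW (Nat.size_le.2 (show D.k < cap W by omega))
  have hn_le : D.n ≤ N / W ^ p + D.n := Nat.le_add_left _ _
  have hle_cap : N / W ^ p + D.n ≤ D.N + D.n :=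
    Nat.add_le_add_right (Nat.div_le_self _ _) _
  generalize N / W ^ p + D.n = size at *
  have hle := (D.space_le W₀ (p + 1) hn_le hwidth).trans hspace
  have hsetting := Family.setting_layout (words := inputWords N L) rfl hW p.succ_pos
    (hW₀ W hlt.le) hcap' (hwidth.trans (Nat.mul_le_mul_left _ hle_cap)) rfl
    (fun _ => inputWords_card N L) (fun e _ => inputWords_elem N L e) hle hcells
  obtain ⟨T, hT, σ, m, hexec, hrep, htop, htables⟩ := preprocStmt_exec hsetting rfl
    (fun _ _ => rfl)
    fun a ha => List.getD_eq_default _ _ (by rw [length_inputWords]; exact ha)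
  refine ⟨T, hT.trans (D.time_le W₀ (p + 1) hn_le hwidth), _, hexec, fun i x hx => ?_⟩
  obtain ⟨T', hT', σ', hexec', hanswer, hmem⟩ :=
    queryStmt_exec hsetting hrep htop htables i.2 hx
  exact ⟨T', hT'.trans hquery_factor, σ', hexec',
    hanswer.trans (Family.card_ofInstance hI hL _ i x), hmem⟩

theorem div_pow_ceil_add_le_bound {t : ℝ} (hW : 0 < W) :
    ((N / W ^ ⌈t⌉₊ + ∑ i, #(S i) : ℕ) : ℝ) ≤ bound t W N S := by
  have hW_one : (1 : ℝ) ≤ W := by exact_mod_cast hW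
  have hpow : (W : ℝ) ^ t ≤ (W ^ ⌈t⌉₊ : ℕ) := by
    rw [Nat.cast_pow, ← Real.rpow_natCast]
    exact Real.rpow_le_rpow_of_exponent_le hW_one (Nat.le_ceil t)
  rw [bound, Nat.cast_add, Nat.cast_sum]
  gcongr
  exact Nat.cast_div_le.trans (by gcongr)

theorem bound_le {t : ℝ} (ht : 0 ≤ t) (hW : 0 < W) :
    bound t W N S ≤ ((N + ∑ i, #(S i) : ℕ) : ℝ) := by
  have hW_one : (1 : ℝ) ≤ W := by exact_mod_cast hW
  rw [bound, Nat.cast_add, Nat.cast_sum]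
  gcongr
  exact div_le_self N.cast_nonneg (Real.one_le_rpow hW_one ht)

end

end PISNS

theorem mainTheorem4 (t : ℝ) (ht : 1 ≤ t) :
    ∃ (preproc query : WordRAM.Stmt) (c : ℕ),
      ∀ (W N k : ℕ) (S : Fin k → Finset ℕ) (L : Fin k → List ℕ),
        PISNS.IsInstance N S → PISNS.Lists L S →
        c * (N + ∑ i, (S i).card) ≤ 2 ^ W →
        ∃ (T : ℕ) (σ : WordRAM.State),
          WordRAM.Exec W ⌊(c : ℝ) * PISNS.bound t W N S⌋₊ preproc
              (PISNS.inputState N L) T σ ∧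
          (T : ℝ) ≤ (c : ℝ) * PISNS.bound t W N S ∧
          ∀ (i : Fin k) (x : ℕ), 1 ≤ x → x ≤ N →
            ∃ (T' : ℕ) (σ' : WordRAM.State),
              WordRAM.Exec W ⌊(c : ℝ) * PISNS.bound t W N S⌋₊ query
                  (PISNS.queryState σ.mem i x) T' σ' ∧
              T' ≤ c ∧
              σ'.regs 0 = PISNS.predRank (S i) x ∧
              σ'.mem = σ.mem := by
  open PISNS in
  obtain ⟨W₀, hW₀⟩ := exists_forall_pow_lt_two_pow (⌈t⌉₊ + 1)
  set c := factor (⌈t⌉₊ + 1) W₀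
  refine ⟨preprocStmt (⌈t⌉₊ + 1), queryStmt (⌈t⌉₊ + 1), c, fun W N k S L hI hL hcap => ?_⟩
  have hW : 0 < W := Nat.zero_lt_of_lt
    (lt_of_factor_mul_le (hI.one_le_sum_card.trans (Nat.le_add_left _ _)) hcap)
  have hlower : ((c * (N / W ^ ⌈t⌉₊ + ∑ i, (S i).card) : ℕ) : ℝ) ≤ c * bound t W N S := by
    rw [Nat.cast_mul]
    exact mul_le_mul_of_nonneg_left (div_pow_ceil_add_le_bound hW) c.cast_nonneg
  have hupper : ⌊(c : ℝ) * bound t W N S⌋₊ ≤ c * (N + ∑ i, (S i).card) := by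
    refine Nat.floor_le_of_le ?_
    rw [Nat.cast_mul]
    exact mul_le_mul_of_nonneg_left (bound_le (zero_le_one.trans ht) hW) c.cast_nonneg
  obtain ⟨T, hT, σ, hexec, hqueries⟩ :=
    exists_exec hW₀ hI hL hcap (Nat.le_floor hlower) (hupper.trans hcap)
  refine ⟨T, σ, hexec, (Nat.cast_le.2 hT).trans hlower, fun i x _ hx => ?_⟩
  obtain ⟨T', hT', σ', hexec', hanswer, hmem⟩ := hqueries i x hx
  exact ⟨T', σ', hexec', hT', hanswer, hmem⟩
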